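/- **Model.** Two companies have free surpluses $X_t=x+p_1t-\sum_{i\le N^1_t}U^{(1)}_i$, $Y_t=y+p_2t-\sum_{i\le N^2_t}U^{(2)}_i$, where $N^1,N^2$ are Poisson processes with intensities $\lambda_1,\lambda_2>0$, the claim sizes $U^{(k)}_i\ge 0$ have a continuous (atomless) distribution function $F^k$ with finite mean, all these objects are mutually independent, and $p_k>\lambda_kE(U^{(k)}_i)$. Let $\delta>0$, $a_1\in[0,1]$, $a_2=1-a_1$, $\lambda=\lambda_1+\lambda_2$, $p=a_1p_1+a_2p_2$ and $\mathbf R_+^2=[0,\infty)^2$. If a claim makes the surplus of one company negative, the other one covers the exact deficit provided that the sum of the two surpluses is non-negative; otherwise there is ruin, at time $\overline\tau$. For $x\ge 0$, $V^0_k(x)$ is the supremum of the expected discounted dividends $E\int_{[0,\tau)}e^{-\delta s}dL_s$ until ruin of company $k$ alone with initial surplus $x$, over all dividend processes $L$, $L_0=0$, that are non-decreasing, càglàd, predictable with respect to the filtration generated by its free surplus, and never exceed the available surplus; $V_k^0=0$ on $(-\infty,0)$. **Curve strategy.** Let $(\overline x,\overline y)\in\mathbf R_+^2$, $\overline u=\overline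 x-\frac{p_1}{p_2}\overline y$, $\overline v=\overline y-\frac{p_2}{p_1}\overline x$. Let $\xi_1:[\overline u,M_1]\to\mathbf R$ and $\xi_2:[\overline v,M_2]\to\mathbf R$ be continuously differentiable with negative derivatives, $\xi_1(\overline u)=\overline y$, $\xi_1(M_1)=0$, $\xi_2(\overline v)=\overline x$, $\xi_2(M_2)=0$ (if the interval is a single point, no condition on the derivative remains), and such that $u+\frac{p_1}{p_2}\xi_1(u)\ge 0$ and $v+\frac{p_2}{p_1}\xi_2(v)\ge 0$ on their domains. Put $\overline\xi=((\overline x,\overline y),\xi_1,\xi_2)$ and $$\mathcal O_1=\{(x,y)\in\mathbf R_+^2: x-\tfrac{p_1}{p_2}y\ge\overline u\},\quad \mathcal O_2=\{(x,y)\in\mathbf R_+^2: y-\tfrac{p_2}{p_1}x\ge\overline v\},$$ $$\mathcal A_0=\{(\overline x,\overline y)\},\quad \mathcal A_1=\{(u+\tfrac{p_1}{p_2}\xi_1(u),\xi_1(u)):\overline u<u\le M_1\},\quad \mathcal A_2=\{(\xi_2(v),v+\tfrac{p_2}{p_1}\xi_2(v)):\overline v<v\le M_2\},$$ $$\mathcal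 B_0=[\overline x,\infty)\times[\overline y,\infty)\setminus\mathcal A_0,\quad \mathcal B_1=\{(x,y)\in\mathbf R_+^2:y\le\overline y,\ x>\xi_1^{-1}(y)+\tfrac{p_1}{p_2}y\},\quad \mathcal B_2=\{(x,y)\in\mathbf R_+^2:x\le\overline x,\ y>\xi_2^{-1}(x)+\tfrac{p_2}{p_1}x\}.$$ The curve strategy depends on the current surplus $(x,y)$ only. In $\mathcal B_0$ the companies pay the lump sums $x-\overline x$ and $y-\overline y$; in $\mathcal B_1$ Company One pays the lump sum $x-\frac{p_1}{p_2}y-\xi_1^{-1}(y)$; in $\mathcal B_2$ Company Two pays the lump sum $y-\frac{p_2}{p_1}x-\xi_2^{-1}(x)$. At $\mathcal A_0$ both pay their premiums as dividends. On $\mathcal A_1$ only Company One pays, at the rate $-p_2/\xi_1'(x-\frac{p_1}{p_2}y)$, and on $\mathcal A_2$ only Company Two pays, at the rate $-p_1/\xi_2'(y-\frac{p_2}{p_1}x)$; the surplus then stays on the curve. Elsewhere no dividends are paid. With $L^1,L^2$ the accumulated dividends and $(X,Y)$ the controlled surplus for initial surplus $(x,y)$ (including transfers), the value function of the strategy is $$V^{\overline\xi}(x,y)=E\Big(a_1\Big(\int_{[0,\overline\tau)}e^{-\delta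 s}dL^1_s+e^{-\delta\overline\tau}V_1^0(X_{\overline\tau})\Big)+a_2\Big(\int_{[0,\overline\tau)}e^{-\delta s}dL^2_s+e^{-\delta\overline\tau}V_2^0(Y_{\overline\tau})\Big)\Big),$$ where the terminal terms are zero if $\overline\tau=\infty$. **Formulas.** For a function $w$ on $\mathbf R_+^2$ let $H_w=\mathcal I(w)+U$, where $$\mathcal I(w)(x,y)=\lambda_1\int_0^xw(x-\alpha,y)dF^1(\alpha)+\lambda_1\int_x^{x+y}w(0,x+y-\alpha)dF^1(\alpha)+\lambda_2\int_0^yw(x,y-\alpha)dF^2(\alpha)+\lambda_2\int_y^{x+y}w(x+y-\alpha,0)dF^2(\alpha),$$ $$U(x,y)=\lambda_1a_2V_2^0(y)(1-F^1(x+y))+\lambda_2a_1V_1^0(x)(1-F^2(x+y)).$$ For $u\in[\overline u,M_1]$ let $$k_w(u)=e^{(\delta+\lambda)\frac{\xi_1(u)-\xi_1(\overline u)}{p_2}}\frac{p+H_w(\overline x,\overline y)}{\delta+\lambda}+e^{(\delta+\lambda)\frac{\xi_1(u)}{p_2}}a_1\int_{\overline u}^ue^{-(\delta+\lambda)\frac{\xi_1(s)}{p_2}}ds+\frac{e^{(\delta+\lambda)\frac{\xi_1(u)}{p_2}}}{p_2}\int_{\xi_1(u)}^{\xi_1(\overline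 u)}H_w(\xi_1^{-1}(t)+\tfrac{p_1}{p_2}t,t)e^{-(\delta+\lambda)\frac t{p_2}}dt.$$ We say that $w$ satisfies the formulas if for all $(x,y)\in\mathcal O_1$, with $u=x-\frac{p_1}{p_2}y$ and, in (i), $\theta=(\xi_1(u)-y)/p_2$: (i) if $y\le\overline y$ and $x\le\xi_1^{-1}(y)+\frac{p_1}{p_2}y$, then $w(x,y)=e^{-(\delta+\lambda)\theta}k_w(u)+\int_0^\theta e^{-(\delta+\lambda)s}H_w(x+p_1s,y+p_2s)ds$; (ii) if $y\le\overline y$ and $x\ge\xi_1^{-1}(y)+\frac{p_1}{p_2}y$, then $w(x,y)=a_1(x-\xi_1^{-1}(y)-\frac{p_1}{p_2}y)+k_w(\xi_1^{-1}(y))$; (iii) if $x\ge\overline x$ and $y\ge\overline y$, then $w(x,y)=a_1(x-\overline x)+a_2(y-\overline y)+k_w(\overline u)$; and if for all $(x,y)\in\mathcal O_2$ the three formulas hold that result from interchanging the roles of the two companies: with $$\tilde k_w(v)=e^{(\delta+\lambda)\frac{\xi_2(v)-\xi_2(\overline v)}{p_1}}\frac{p+H_w(\overline x,\overline y)}{\delta+\lambda}+e^{(\delta+\lambda)\frac{\xi_2(v)}{p_1}}a_2\int_{\overline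 v}^ve^{-(\delta+\lambda)\frac{\xi_2(s)}{p_1}}ds+\frac{e^{(\delta+\lambda)\frac{\xi_2(v)}{p_1}}}{p_1}\int_{\xi_2(v)}^{\xi_2(\overline v)}H_w(t,\xi_2^{-1}(t)+\tfrac{p_2}{p_1}t)e^{-(\delta+\lambda)\frac t{p_1}}dt,$$ $v=y-\frac{p_2}{p_1}x$ and $\theta=(\xi_2(v)-x)/p_1$, one has $w(x,y)=e^{-(\delta+\lambda)\theta}\tilde k_w(v)+\int_0^\theta e^{-(\delta+\lambda)s}H_w(x+p_1s,y+p_2s)ds$ if $x\le\overline x$ and $y\le\xi_2^{-1}(x)+\frac{p_2}{p_1}x$; $w(x,y)=a_2(y-\xi_2^{-1}(x)-\frac{p_2}{p_1}x)+\tilde k_w(\xi_2^{-1}(x))$ if $x\le\overline x$ and $y\ge\xi_2^{-1}(x)+\frac{p_2}{p_1}x$; and $w(x,y)=a_1(x-\overline x)+a_2(y-\overline y)+\tilde k_w(\overline v)$ if $x\ge\overline x$ and $y\ge\overline y$. **Proposition.** Let $\mathcal M$ be the set of continuous functions $w:\mathbf R_+^2\to[0,\infty)$ for which $w(x,y)-a_1x-a_2y$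 is bounded. Then $V^{\overline\xi}$ is finite, belongs to $\mathcal M$ and satisfies the formulas, and it is the only function in $\mathcal M$ that satisfies them. -/

import Mathlib

open MeasureTheory ProbabilityTheory Set
open scoped NNReal ENNReal

noncomputable section

/-! ### The two insurance companies (index `0` is Company One, index `1` is Company Two) -/

/-- The data of the model: premium rates `p`, claim intensities `lam`, claim size distributions `F`
(continuous, i.e. atomless, on `[0, ∞)`), discount factor `δ` and weight `a1` of Company One. -/
structure CollabParams where
  p : Fin 2 → ℝ
  lam : Fin 2 → ℝ
  F : Fin 2 → Measure ℝ
  δ : ℝ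
  a1 : ℝ
  lam_pos : ∀ k, 0 < lam k
  F_prob : ∀ k, IsProbabilityMeasure (F k)
  F_noAtoms : ∀ k, NullSingletonClass (F k)
  F_nonneg : ∀ k, F k (Iio 0) = 0
  F_integrable : ∀ k, Integrable (fun α => α) (F k)
  netProfit : ∀ k, lam k * ∫ α, α ∂(F k) < p k
  δ_pos : 0 < δ
  a1_nonneg : 0 ≤ a1
  a1_le_one : a1 ≤ 1

namespace CollabParams

/-- The weights `a₁` and `a₂ = 1 - a₁`. -/
def a (q : CollabParams) : Fin 2 → ℝ := ![q.a1, 1 - q.a1]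

/-- `λ = λ₁ + λ₂`. -/
def lamTot (q : CollabParams) : ℝ := q.lam 0 + q.lam 1

/-- `p = a₁ p₁ + a₂ p₂`. -/
def pTot (q : CollabParams) : ℝ := q.a 0 * q.p 0 + q.a 1 * q.p 1

end CollabParams

/-- The two independent compound Poisson claim processes on a probability space: the waiting times
`T k i` between consecutive claims of company `k` are exponential with rate `lam k` (so that the
claims of company `k` arrive along a Poisson process of intensity `lam k`), the claim sizes `U k i`
have law `F k`, and all these variables are mutually independent. -/
structure ClaimModel (q : CollabParams) {Ω : Type*} [MeasurableSpace Ω] (P : Measure Ω) where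
  T : Fin 2 → ℕ → Ω → ℝ
  U : Fin 2 → ℕ → Ω → ℝ
  measurable_T : ∀ k i, Measurable (T k i)
  measurable_U : ∀ k i, Measurable (U k i)
  law_T : ∀ k i, HasLaw (T k i) (expMeasure (q.lam k)) P
  law_U : ∀ k i, HasLaw (U k i) (q.F k) P
  indep : iIndepFun (Sum.elim (fun j : Fin 2 × ℕ => T j.1 j.2) (fun j : Fin 2 × ℕ => U j.1 j.2)) P

namespace ClaimModel

variable {q : CollabParams} {Ω : Type*} [MeasurableSpace Ω] {P : Measure Ω}

/-- Arrival time of the claim number `i + 1` of company `k`. -/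
def arrival (c : ClaimModel q P) (k : Fin 2) (i : ℕ) (ω : Ω) : ℝ :=
  ∑ j ∈ Finset.range (i + 1), c.T k j ω

/-- Total amount claimed from company `k` up to time `t`. -/
def claimsUpTo (c : ClaimModel q P) (k : Fin 2) (t : ℝ≥0) (ω : Ω) : ℝ :=
  (∑' i, if c.arrival k i ω ≤ t then ENNReal.ofReal (c.U k i ω) else 0).toReal

/-- The free (Cramér-Lundberg) surplus of company `k` with initial surplus `x`. -/
def surplus (c : ClaimModel q P) (k : Fin 2) (x : ℝ) (t : ℝ≥0) (ω : Ω) : ℝ :=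
  x + q.p k * t - c.claimsUpTo k t ω

theorem measurable_arrival (c : ClaimModel q P) (k : Fin 2) (i : ℕ) :
    Measurable (c.arrival k i) :=
  Finset.measurable_sum _ fun j _ => c.measurable_T k j

theorem measurable_surplus (c : ClaimModel q P) (k : Fin 2) (x : ℝ) (t : ℝ≥0) :
    Measurable (c.surplus k x t) := by
  refine measurable_const.sub (Measurable.ennreal_toReal (Measurable.tsum fun i => ?_))
  exact Measurable.ite (measurableSet_le (c.measurable_arrival k i) measurable_const)
    (c.measurable_U k i).ennreal_ofReal measurable_const

/-- The filtration generated by the free surplus of company `k`. -/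
def filtration (c : ClaimModel q P) (k : Fin 2) (x : ℝ) : Filtration ℝ≥0 ‹MeasurableSpace Ω› :=
  Filtration.natural (c.surplus k x) fun t => (c.measurable_surplus k x t).stronglyMeasurable

end ClaimModel

/-! ### The one-dimensional optimal dividend problem of a stand-alone company -/

/-- An admissible dividend strategy of company `k` alone with initial surplus `x`: the accumulated
dividends `L` are non-decreasing, càglàd (right limits exist by monotonicity), predictable, and
never exceed the surplus as long as no claim has made the controlled surplus negative. -/
structure SoloStrategy {q : CollabParams} {Ω : Type*} [MeasurableSpace Ω] {P : Measure Ω}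
    (c : ClaimModel q P) (k : Fin 2) (x : ℝ) where
  L : ℝ≥0 → Ω → ℝ
  L_zero : ∀ ω, L 0 ω = 0
  mono : ∀ ω, Monotone fun t => L t ω
  leftCont : ∀ ω t, ContinuousWithinAt (fun s => L s ω) (Iic t) t
  predictable : IsStronglyPredictable (c.filtration k x) L
  le_surplus : ∀ᵐ ω ∂P, ∀ t : ℝ≥0,
    (∀ i, c.arrival k i ω ≤ t → 0 ≤ c.surplus k x (c.arrival k i ω).toNNReal ω
      - L (c.arrival k i ω).toNNReal ω) →
    L t ω ≤ c.surplus k x t ω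

namespace SoloStrategy

variable {q : CollabParams} {Ω : Type*} [MeasurableSpace Ω] {P : Measure Ω}
  {c : ClaimModel q P} {k : Fin 2} {x : ℝ}

theorem mono_real (S : SoloStrategy c k x) (ω : Ω) :
    Monotone fun t : ℝ => S.L t.toNNReal ω :=
  fun _ _ h => S.mono ω (Real.toNNReal_le_toNNReal h)

/-- The set `[0, τ)` of the times before ruin, `τ = inf {t | X_t - L_t < 0}` (ruin occurs at a
claim, so that the controlled surplus is negative at `τ` itself). -/
def beforeRuin (S : SoloStrategy c k x) (ω : Ω) : Set ℝ :=
  {s | 0 ≤ s ∧ ∀ r : ℝ≥0, (r : ℝ) ≤ s → 0 ≤ c.surplus k x r ω - S.L r ω}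

/-- The expected discounted dividends until ruin. -/
def value (S : SoloStrategy c k x) : ℝ≥0∞ :=
  ∫⁻ ω, ∫⁻ s in S.beforeRuin ω, ENNReal.ofReal (Real.exp (-q.δ * s))
    ∂(S.mono_real ω).stieltjesFunction.measure ∂P

end SoloStrategy

/-- The optimal value function `V_k^0` of company `k` alone; it vanishes on `(-∞, 0)`. -/
def soloValue {q : CollabParams} {Ω : Type*} [MeasurableSpace Ω] {P : Measure Ω}
    (c : ClaimModel q P) (k : Fin 2) (x : ℝ) : ℝ :=
  if x < 0 then 0 else (⨆ S : SoloStrategy c k x, S.value).toReal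

/-! ### Curve strategies -/

/-- The data `((x̄, ȳ), ξ₁, ξ₂)` of a curve strategy: `ξ₁` is continuously differentiable on
`[ū, M₁]` with negative derivative `dξ₁`, where `ū = x̄ - (p₁/p₂) ȳ`, `ξ₁ ū = ȳ`, `ξ₁ M₁ = 0`, and
the curve parametrized by `ξ₁` lies in the first quadrant; similarly for `ξ₂`. -/
structure CurveStrategy (q : CollabParams) where
  xbar : ℝ
  ybar : ℝ
  M₁ : ℝ
  M₂ : ℝ
  ξ₁ : ℝ → ℝ
  dξ₁ : ℝ → ℝ
  ξ₂ : ℝ → ℝ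
  dξ₂ : ℝ → ℝ
  xbar_nonneg : 0 ≤ xbar
  ybar_nonneg : 0 ≤ ybar
  le_M₁ : xbar - q.p 0 / q.p 1 * ybar ≤ M₁
  le_M₂ : ybar - q.p 1 / q.p 0 * xbar ≤ M₂
  hasDeriv₁ : ∀ u ∈ Icc (xbar - q.p 0 / q.p 1 * ybar) M₁,
    HasDerivWithinAt ξ₁ (dξ₁ u) (Icc (xbar - q.p 0 / q.p 1 * ybar) M₁) u
  hasDeriv₂ : ∀ v ∈ Icc (ybar - q.p 1 / q.p 0 * xbar) M₂,
    HasDerivWithinAt ξ₂ (dξ₂ v) (Icc (ybar - q.p 1 / q.p 0 * xbar) M₂) v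
  contDeriv₁ : ContinuousOn dξ₁ (Icc (xbar - q.p 0 / q.p 1 * ybar) M₁)
  contDeriv₂ : ContinuousOn dξ₂ (Icc (ybar - q.p 1 / q.p 0 * xbar) M₂)
  deriv_neg₁ : ∀ u ∈ Icc (xbar - q.p 0 / q.p 1 * ybar) M₁, dξ₁ u < 0
  deriv_neg₂ : ∀ v ∈ Icc (ybar - q.p 1 / q.p 0 * xbar) M₂, dξ₂ v < 0
  start₁ : ξ₁ (xbar - q.p 0 / q.p 1 * ybar) = ybar
  start₂ : ξ₂ (ybar - q.p 1 / q.p 0 * xbar) = xbar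
  finish₁ : ξ₁ M₁ = 0
  finish₂ : ξ₂ M₂ = 0
  quadrant₁ : ∀ u ∈ Icc (xbar - q.p 0 / q.p 1 * ybar) M₁, 0 ≤ u + q.p 0 / q.p 1 * ξ₁ u
  quadrant₂ : ∀ v ∈ Icc (ybar - q.p 1 / q.p 0 * xbar) M₂, 0 ≤ v + q.p 1 / q.p 0 * ξ₂ v

namespace CurveStrategy

variable {q : CollabParams}

/-- `ū`, the `x`-intercept of the line of slope `p₂/p₁` through `(x̄, ȳ)`. -/
def ubar (ξ : CurveStrategy q) : ℝ := ξ.xbar - q.p 0 / q.p 1 * ξ.ybar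

/-- `v̄`, the `y`-intercept of the line of slope `p₂/p₁` through `(x̄, ȳ)`. -/
def vbar (ξ : CurveStrategy q) : ℝ := ξ.ybar - q.p 1 / q.p 0 * ξ.xbar

/-- The inverse of `ξ₁ : [ū, M₁] → [0, ȳ]`. -/
def inv₁ (ξ : CurveStrategy q) : ℝ → ℝ := Function.invFunOn ξ.ξ₁ (Icc ξ.ubar ξ.M₁)

/-- The inverse of `ξ₂ : [v̄, M₂] → [0, x̄]`. -/
def inv₂ (ξ : CurveStrategy q) : ℝ → ℝ := Function.invFunOn ξ.ξ₂ (Icc ξ.vbar ξ.M₂)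

/-- The first quadrant. -/
def quadrant : Set (ℝ × ℝ) := {z | 0 ≤ z.1 ∧ 0 ≤ z.2}

/-- The part of the first quadrant below the line of slope `p₂/p₁` through `(x̄, ȳ)`. -/
def O₁ (ξ : CurveStrategy q) : Set (ℝ × ℝ) :=
  {z | z ∈ quadrant ∧ ξ.ubar ≤ z.1 - q.p 0 / q.p 1 * z.2}

/-- The part of the first quadrant above the line of slope `p₂/p₁` through `(x̄, ȳ)`. -/
def O₂ (ξ : CurveStrategy q) : Set (ℝ × ℝ) :=
  {z | z ∈ quadrant ∧ ξ.vbar ≤ z.2 - q.p 1 / q.p 0 * z.1}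

def A₀ (ξ : CurveStrategy q) : Set (ℝ × ℝ) := {(ξ.xbar, ξ.ybar)}

def A₁ (ξ : CurveStrategy q) : Set (ℝ × ℝ) :=
  (fun u => (u + q.p 0 / q.p 1 * ξ.ξ₁ u, ξ.ξ₁ u)) '' Ioc ξ.ubar ξ.M₁

def A₂ (ξ : CurveStrategy q) : Set (ℝ × ℝ) :=
  (fun v => (ξ.ξ₂ v, v + q.p 1 / q.p 0 * ξ.ξ₂ v)) '' Ioc ξ.vbar ξ.M₂

def B₀ (ξ : CurveStrategy q) : Set (ℝ × ℝ) := (Ici ξ.xbar ×ˢ Ici ξ.ybar) \ ξ.A₀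

def B₁ (ξ : CurveStrategy q) : Set (ℝ × ℝ) :=
  {z | z ∈ quadrant ∧ z.2 ≤ ξ.ybar ∧ ξ.inv₁ z.2 + q.p 0 / q.p 1 * z.2 < z.1}

def B₂ (ξ : CurveStrategy q) : Set (ℝ × ℝ) :=
  {z | z ∈ quadrant ∧ z.1 ≤ ξ.xbar ∧ ξ.inv₂ z.1 + q.p 1 / q.p 0 * z.1 < z.2}

open scoped Classical in
/-- The lump sums paid by the two companies at surplus `z`. The remaining points of the quadrant
form the non-action region and the curve, where no lump sum is paid. -/
def lump (ξ : CurveStrategy q) (z : ℝ × ℝ) : Fin 2 → ℝ :=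
  if z ∈ ξ.B₀ then ![z.1 - ξ.xbar, z.2 - ξ.ybar]
  else if z ∈ ξ.B₁ then ![z.1 - q.p 0 / q.p 1 * z.2 - ξ.inv₁ z.2, 0]
  else if z ∈ ξ.B₂ then ![0, z.2 - q.p 1 / q.p 0 * z.1 - ξ.inv₂ z.1]
  else 0

/-- The surplus just after the lump sums are paid. -/
def land (ξ : CurveStrategy q) (z : ℝ × ℝ) : ℝ × ℝ := (z.1 - ξ.lump z 0, z.2 - ξ.lump z 1)

open scoped Classical in
/-- The rates at which the two companies pay dividends at surplus `z`: the premium rates at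
`(x̄, ȳ)`, the rate that keeps the surplus on the curve for Company One on `A₁` and for Company Two
on `A₂`, and nothing elsewhere. -/
def rate (ξ : CurveStrategy q) (z : ℝ × ℝ) : Fin 2 → ℝ :=
  if z ∈ ξ.A₀ then q.p
  else if z ∈ ξ.A₁ then ![-q.p 1 / ξ.dξ₁ (z.1 - q.p 0 / q.p 1 * z.2), 0]
  else if z ∈ ξ.A₂ then ![0, -q.p 0 / ξ.dξ₂ (z.2 - q.p 1 / q.p 0 * z.1)]
  else 0

open scoped Classical in
/-- The surplus after a time `t` without claims, starting from a point `z` of the non-action region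
or of the curve. Below the line through `(x̄, ȳ)`, no dividends are paid until the curve `A₁` is hit;
then Company Two still pays nothing, so that its surplus keeps growing at rate `p₂`, and the surplus
slides along `A₁` until it reaches `(x̄, ȳ)`, where it stays. Above the line the roles of the
companies are interchanged. -/
def flow (ξ : CurveStrategy q) (z : ℝ × ℝ) (t : ℝ) : ℝ × ℝ :=
  if z ∈ ξ.O₁ then
    if t ≤ (ξ.ξ₁ (z.1 - q.p 0 / q.p 1 * z.2) - z.2) / q.p 1 then (z.1 + q.p 0 * t, z.2 + q.p 1 * t)
    else if z.2 + q.p 1 * t ≤ ξ.ybar then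
      (ξ.inv₁ (z.2 + q.p 1 * t) + q.p 0 / q.p 1 * (z.2 + q.p 1 * t), z.2 + q.p 1 * t)
    else (ξ.xbar, ξ.ybar)
  else
    if t ≤ (ξ.ξ₂ (z.2 - q.p 1 / q.p 0 * z.1) - z.1) / q.p 0 then (z.1 + q.p 0 * t, z.2 + q.p 1 * t)
    else if z.1 + q.p 0 * t ≤ ξ.xbar then
      (z.1 + q.p 0 * t, ξ.inv₂ (z.1 + q.p 0 * t) + q.p 1 / q.p 0 * (z.1 + q.p 0 * t))
    else (ξ.xbar, ξ.ybar)

end CurveStrategy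

/-! ### The controlled surplus process of a curve strategy and its value function -/

/-- The collaboration rule at a claim: the deficit of one company is covered by the other one if
that is possible. -/
def cover (z : ℝ × ℝ) : ℝ × ℝ :=
  if z.1 + z.2 < 0 then z
  else if z.1 < 0 then (0, z.1 + z.2)
  else if z.2 < 0 then (z.1 + z.2, 0)
  else z

/-- The situation just after a claim: the time, the number of claims of each company so far, and
the two surplus levels (after a possible transfer, before any dividend payment). -/
structure ClaimState where
  time : ℝ
  count : Fin 2 → ℕ
  pos : ℝ × ℝ

namespace CurveStrategy

variable {q : CollabParams} {Ω : Type*} [MeasurableSpace Ω] {P : Measure Ω}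

/-- The time of the next claim of either company after the situation `s`. -/
def nextTime (c : ClaimModel q P) (ω : Ω) (s : ClaimState) : ℝ :=
  min (c.arrival 0 (s.count 0) ω) (c.arrival 1 (s.count 1) ω)

/-- The surplus under the curve strategy at time `t`, between the situation `s` and the next
claim. -/
def between (ξ : CurveStrategy q) (s : ClaimState) (t : ℝ) : ℝ × ℝ :=
  ξ.flow (ξ.land s.pos) (t - s.time)

/-- From one claim to the next one; nothing changes after the ruin time `τ̄`, at which the sum of
the surplus levels becomes negative. -/
def nextState (ξ : CurveStrategy q) (c : ClaimModel q P) (ω : Ω) (s : ClaimState) : ClaimState :=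
  if s.pos.1 + s.pos.2 < 0 then s
  else if c.arrival 0 (s.count 0) ω ≤ c.arrival 1 (s.count 1) ω then
    { time := nextTime c ω s
      count := ![s.count 0 + 1, s.count 1]
      pos := cover ((ξ.between s (nextTime c ω s)).1 - c.U 0 (s.count 0) ω,
        (ξ.between s (nextTime c ω s)).2) }
  else
    { time := nextTime c ω s
      count := ![s.count 0, s.count 1 + 1]
      pos := cover ((ξ.between s (nextTime c ω s)).1,
        (ξ.between s (nextTime c ω s)).2 - c.U 1 (s.count 1) ω) }

/-- The situation after `n` claims, with initial surplus levels `z`. -/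
def state (ξ : CurveStrategy q) (c : ClaimModel q P) (z : ℝ × ℝ) (ω : Ω) : ℕ → ClaimState
  | 0 => { time := 0, count := 0, pos := z }
  | n + 1 => ξ.nextState c ω (ξ.state c z ω n)

/-- No ruin up to and including the claim number `n`. -/
def alive (ξ : CurveStrategy q) (c : ClaimModel q P) (z : ℝ × ℝ) (ω : Ω) (n : ℕ) : Prop :=
  0 ≤ (ξ.state c z ω n).pos.1 + (ξ.state c z ω n).pos.2

open scoped Classical in
/-- The random measure `dL^k` on `[0, τ̄)` of the dividends of company `k` under the curve strategy,
split along the claim times: a lump sum at the beginning of each period between two claims and then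
payments at the rate given by the current surplus. -/
def dividends (ξ : CurveStrategy q) (c : ClaimModel q P) (z : ℝ × ℝ) (k : Fin 2) (ω : Ω) :
    Measure ℝ :=
  Measure.sum fun n : ℕ =>
    if ξ.alive c z ω n then
      ENNReal.ofReal (ξ.lump (ξ.state c z ω n).pos k) • Measure.dirac (ξ.state c z ω n).time
      + (volume.restrict (Ico (ξ.state c z ω n).time (ξ.state c z ω (n + 1)).time)).withDensity
          (fun s => ENNReal.ofReal (ξ.rate (ξ.between (ξ.state c z ω n) s) k))
    else 0

open scoped Classical in
/-- The discounted terminal payoff `e^{-δ τ̄} V_k^0` of company `k` at the ruin time `τ̄` (zero if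
ruin never occurs; at most one term of the sum is present). -/
def terminal (ξ : CurveStrategy q) (c : ClaimModel q P) (z : ℝ × ℝ) (k : Fin 2) (ω : Ω) : ℝ≥0∞ :=
  ∑' n : ℕ,
    if ξ.alive c z ω n ∧ ¬ ξ.alive c z ω (n + 1) then
      ENNReal.ofReal (Real.exp (-q.δ * (ξ.state c z ω (n + 1)).time)
        * soloValue c k (![(ξ.state c z ω (n + 1)).pos.1, (ξ.state c z ω (n + 1)).pos.2] k))
    else 0

/-- The expected weighted discounted dividends of the curve strategy, as an element of
`[0, ∞]`. -/
def expectedPayoff (ξ : CurveStrategy q) (c : ClaimModel q P) (z : ℝ × ℝ) : ℝ≥0∞ :=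
  ∫⁻ ω, ∑ k : Fin 2, ENNReal.ofReal (q.a k) *
    (∫⁻ s, ENNReal.ofReal (Real.exp (-q.δ * s)) ∂(ξ.dividends c z k ω) + ξ.terminal c z k ω) ∂P

/-- The value function `V^ξ` of the curve strategy. -/
def value (ξ : CurveStrategy q) (c : ClaimModel q P) (z : ℝ × ℝ) : ℝ :=
  (ξ.expectedPayoff c z).toReal

/-! ### The explicit formulas -/

/-- The integral operator `I`. -/
def opI (q : CollabParams) (w : ℝ × ℝ → ℝ) (z : ℝ × ℝ) : ℝ :=
  q.lam 0 * (∫ α in Icc 0 z.1, w (z.1 - α, z.2) ∂(q.F 0))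
  + q.lam 0 * (∫ α in Ioc z.1 (z.1 + z.2), w (0, z.1 + z.2 - α) ∂(q.F 0))
  + q.lam 1 * (∫ α in Icc 0 z.2, w (z.1, z.2 - α) ∂(q.F 1))
  + q.lam 1 * (∫ α in Ioc z.2 (z.1 + z.2), w (z.1 + z.2 - α, 0) ∂(q.F 1))

/-- The function `U`; note that `(F k).real (Ioi s)` is `1 - F^k(s)`. -/
def opU (c : ClaimModel q P) (z : ℝ × ℝ) : ℝ :=
  q.lam 0 * q.a 1 * soloValue c 1 z.2 * (q.F 0).real (Ioi (z.1 + z.2))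
  + q.lam 1 * q.a 0 * soloValue c 0 z.1 * (q.F 1).real (Ioi (z.1 + z.2))

/-- The function `H = I(w) + U`. -/
def opH (c : ClaimModel q P) (w : ℝ × ℝ → ℝ) (z : ℝ × ℝ) : ℝ := opI q w z + opU c z

/-- The function `k` on `[ū, M₁]`. -/
def k₁ (ξ : CurveStrategy q) (c : ClaimModel q P) (w : ℝ × ℝ → ℝ) (u : ℝ) : ℝ :=
  Real.exp ((q.δ + q.lamTot) * ((ξ.ξ₁ u - ξ.ξ₁ ξ.ubar) / q.p 1))
      * (q.pTot / (q.δ + q.lamTot) + 1 / (q.δ + q.lamTot)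
          * opH c w (ξ.ubar + q.p 0 / q.p 1 * ξ.ξ₁ ξ.ubar, ξ.ξ₁ ξ.ubar))
  + Real.exp ((q.δ + q.lamTot) * (ξ.ξ₁ u / q.p 1)) * q.a 0
      * (∫ s in ξ.ubar..u, Real.exp (-(q.δ + q.lamTot) * (ξ.ξ₁ s / q.p 1)))
  + Real.exp ((q.δ + q.lamTot) * (ξ.ξ₁ u / q.p 1)) / q.p 1
      * (∫ t in ξ.ξ₁ u..ξ.ξ₁ ξ.ubar, opH c w (ξ.inv₁ t + q.p 0 / q.p 1 * t, t)
          * Real.exp (-(q.δ + q.lamTot) * (t / q.p 1)))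

/-- The function `k̃` on `[v̄, M₂]`. -/
def k₂ (ξ : CurveStrategy q) (c : ClaimModel q P) (w : ℝ × ℝ → ℝ) (v : ℝ) : ℝ :=
  Real.exp ((q.δ + q.lamTot) * ((ξ.ξ₂ v - ξ.ξ₂ ξ.vbar) / q.p 0))
      * (q.pTot / (q.δ + q.lamTot) + 1 / (q.δ + q.lamTot)
          * opH c w (ξ.ξ₂ ξ.vbar, ξ.vbar + q.p 1 / q.p 0 * ξ.ξ₂ ξ.vbar))
  + Real.exp ((q.δ + q.lamTot) * (ξ.ξ₂ v / q.p 0)) * q.a 1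
      * (∫ s in ξ.vbar..v, Real.exp (-(q.δ + q.lamTot) * (ξ.ξ₂ s / q.p 0)))
  + Real.exp ((q.δ + q.lamTot) * (ξ.ξ₂ v / q.p 0)) / q.p 0
      * (∫ t in ξ.ξ₂ v..ξ.ξ₂ ξ.vbar, opH c w (t, ξ.inv₂ t + q.p 1 / q.p 0 * t)
          * Real.exp (-(q.δ + q.lamTot) * (t / q.p 0)))

/-- The explicit formulas that express `W` through `W₀`, on each piece of the quadrant. -/
structure Formulas (ξ : CurveStrategy q) (c : ClaimModel q P) (W₀ W : ℝ × ℝ → ℝ) : Prop where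
  below_inner : ∀ z ∈ ξ.O₁, z.2 ≤ ξ.ybar → z.1 ≤ ξ.inv₁ z.2 + q.p 0 / q.p 1 * z.2 →
    W z = Real.exp (-(q.δ + q.lamTot) * ((ξ.ξ₁ (z.1 - q.p 0 / q.p 1 * z.2) - z.2) / q.p 1))
        * ξ.k₁ c W₀ (z.1 - q.p 0 / q.p 1 * z.2)
      + ∫ s in 0..(ξ.ξ₁ (z.1 - q.p 0 / q.p 1 * z.2) - z.2) / q.p 1,
          Real.exp (-(q.δ + q.lamTot) * s) * opH c W₀ (z.1 + q.p 0 * s, z.2 + q.p 1 * s)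
  below_outer : ∀ z ∈ ξ.O₁, z.2 ≤ ξ.ybar → ξ.inv₁ z.2 + q.p 0 / q.p 1 * z.2 ≤ z.1 →
    W z = q.a 0 * (z.1 - ξ.inv₁ z.2 - q.p 0 / q.p 1 * z.2) + ξ.k₁ c W₀ (ξ.inv₁ z.2)
  below_corner : ∀ z ∈ ξ.O₁, ξ.xbar ≤ z.1 → ξ.ybar ≤ z.2 →
    W z = q.a 0 * (z.1 - ξ.xbar) + q.a 1 * (z.2 - ξ.ybar)
      + ξ.k₁ c W₀ (ξ.xbar - q.p 0 / q.p 1 * ξ.ybar)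
  above_inner : ∀ z ∈ ξ.O₂, z.1 ≤ ξ.xbar → z.2 ≤ ξ.inv₂ z.1 + q.p 1 / q.p 0 * z.1 →
    W z = Real.exp (-(q.δ + q.lamTot) * ((ξ.ξ₂ (z.2 - q.p 1 / q.p 0 * z.1) - z.1) / q.p 0))
        * ξ.k₂ c W₀ (z.2 - q.p 1 / q.p 0 * z.1)
      + ∫ s in 0..(ξ.ξ₂ (z.2 - q.p 1 / q.p 0 * z.1) - z.1) / q.p 0,
          Real.exp (-(q.δ + q.lamTot) * s) * opH c W₀ (z.1 + q.p 0 * s, z.2 + q.p 1 * s)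
  above_outer : ∀ z ∈ ξ.O₂, z.1 ≤ ξ.xbar → ξ.inv₂ z.1 + q.p 1 / q.p 0 * z.1 ≤ z.2 →
    W z = q.a 1 * (z.2 - ξ.inv₂ z.1 - q.p 1 / q.p 0 * z.1) + ξ.k₂ c W₀ (ξ.inv₂ z.1)
  above_corner : ∀ z ∈ ξ.O₂, ξ.xbar ≤ z.1 → ξ.ybar ≤ z.2 →
    W z = q.a 0 * (z.1 - ξ.xbar) + q.a 1 * (z.2 - ξ.ybar)
      + ξ.k₂ c W₀ (ξ.ybar - q.p 1 / q.p 0 * ξ.xbar)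

/-- The class `M` of continuous non-negative functions `w` on the first quadrant for which
`w(x, y) - a₁ x - a₂ y` is bounded. -/
def classM (q : CollabParams) : Set (ℝ × ℝ → ℝ) :=
  {w | (∀ z ∈ quadrant, 0 ≤ w z) ∧ ContinuousOn w quadrant ∧
    ∃ K, ∀ z ∈ quadrant, |w z - q.a 0 * z.1 - q.a 1 * z.2| ≤ K}

end CurveStrategy

end

/-! Between two claims the controlled surplus moves deterministically. At the first claim, since
exponential clocks have no memory, the waiting times and claim sizes still to come are independent
of what has been seen and have the same law as at the start. Hence the value V solves V = T V. Here
T w (`opT`, in real form `opReal`) is the lump sum plus the integral over s > 0 of exp(-(δ+λ)s)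
times (dividend rate + H_w) at the surplus reached at time s without a claim.
`ClaimData.lintegral_first` is the decomposition at the first claim. By
`PeriodControl.lintegral_payoff` the expected payoff of N periods is T^N 0, and `expectedPayoff_eq`
and `iSup_iterate_eq` let N tend to infinity by monotone convergence.

The formulas are the equation W = T W₀ written out. `DecreasingCurve.integral_path` evaluates the
reward along a motion that follows a line, slides along the curve and rests at the corner, which
yields `formulas_opReal`. The regions cover the quadrant, so the formulas leave no freedom
(`Formulas.eqOn`), and a function of M satisfies them with itself on both sides exactly when T fixes
it on the quadrant.

T shrinks uniform distances by the factor λ/(δ+λ) < 1 (`opT_add_const`) and maps M into itself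
(`opReal_mem_classM`). The growth bound holds because the lump sum leaves the surplus in a bounded
set. Continuity is the delicate point: V_k^0 is only shown to be finite and non-decreasing
(`SoloStrategy.value_le`, `monotone_soloValue`), so H_w is controlled only off countably many
horizontal and vertical lines. A line of positive slope meets these at countably many times, so
integrals of H_w along such lines still depend continuously on the starting point
(`continuousOn_line`). Iterates of T that start in M therefore converge uniformly to V. This gives
the continuity of V, and any fixed point in M must equal V. -/

noncomputable section

/-! ### Coordinates of an infinite product of probability measures -/

section InfinitePi

variable {ι : Type*} {ν : ι → Measure ℝ} [∀ i, IsProbabilityMeasure (ν i)]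

/-- Two coordinates and a disjoint family of coordinates with the same marginals are independent,
and the family has again the law of the full product. -/
theorem map_infinitePi_pop (j₁ j₂ : ι) (h12 : j₁ ≠ j₂) (σ : ι → ι) (hσ : Function.Injective σ)
    (h1 : ∀ i, σ i ≠ j₁) (h2 : ∀ i, σ i ≠ j₂) (hν : ∀ i, ν (σ i) = ν i) :
    (Measure.infinitePi ν).map (fun d => ((d j₁, d j₂), fun i => d (σ i)))
      = ((ν j₁).prod (ν j₂)).prod (Measure.infinitePi ν) := by
  have hind : iIndepFun (fun i (d : ι → ℝ) => d i) (Measure.infinitePi ν) :=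
    iIndepFun_infinitePi (X := fun _ x => x) (fun _ => measurable_id)
  have hlaw2 : (Measure.infinitePi ν).map (fun d i => d (σ i)) = Measure.infinitePi ν := by
    rw [Measure.map_infinitePi_infinitePi_of_inj hσ]
    simp_rw [hν]
  have hlaw1 := Measure.infinitePi_map_eval_prod (P := ν) h12
  have hI : IndepFun (fun d : ι → ℝ => (d j₁, d j₂)) (fun d i => d (σ i))
      (Measure.infinitePi ν) := by
    -- Disjoint sets of independent coordinates generate independent σ-algebras; the reindexed
    -- family only uses coordinates in the range of `σ`, which avoids `j₁` and `j₂`.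
    have key := indep_iSup_of_disjoint (S := {j₁, j₂}) (T := Set.range σ)
      (fun i => (measurable_pi_apply i).comap_le) hind
      (by
        rw [Set.disjoint_left]
        rintro x (rfl | rfl) ⟨i, hi⟩
        · exact h1 i hi
        · exact h2 i hi)
    refine indep_of_indep_of_le_left (indep_of_indep_of_le_right key ?_) ?_
    · rw [← measurable_iff_comap_le]
      refine @measurable_pi_lambda _ _ _ (_) _ _ fun i => ?_
      rw [measurable_iff_comap_le]
      exact le_iSup₂_of_le (σ i) ⟨i, rfl⟩ le_rfl
    · rw [← measurable_iff_comap_le]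
      refine @Measurable.prodMk _ _ _ _ _ (_) _ _ ?_ ?_ <;> rw [measurable_iff_comap_le]
      · exact le_iSup₂_of_le j₁ (by simp) le_rfl
      · exact le_iSup₂_of_le j₂ (by simp) le_rfl
  rw [(indepFun_iff_map_prod_eq_prod_map_map (by fun_prop)
    (measurable_pi_lambda _ fun _ => measurable_pi_apply _).aemeasurable).1 hI, hlaw1, hlaw2]

/-- Resampling one coordinate of a product measure does not change the measure. -/
theorem map_update_infinitePi [DecidableEq ι] (j : ι) :
    ((ν j).prod (Measure.infinitePi ν)).map (fun x => Function.update x.2 j x.1)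
      = Measure.infinitePi ν := by
  have hm : Measurable (fun x : ℝ × (ι → ℝ) => Function.update x.2 j x.1) := by
    refine measurable_pi_lambda _ fun i => ?_
    by_cases h : i = j
    · subst h; simpa using measurable_fst
    · simp only [Function.update_of_ne h]; fun_prop
  refine Measure.eq_infinitePi _ fun s t ht => ?_
  rw [Measure.map_apply hm (MeasurableSet.pi s.countable_toSet fun i _ => ht i)]
  -- On a box, the constraint at `j` falls on the fresh coordinate and all others on the old ones,
  -- so the two factors multiply back to the measure of the box.
  by_cases hj : j ∈ s
  · have : (fun x : ℝ × (ι → ℝ) => Function.update x.2 j x.1) ⁻¹' (Set.pi s t)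
        = t j ×ˢ Set.pi (s.erase j) t := by
      ext x
      simp only [mem_preimage, Set.mem_pi, Finset.mem_coe, mem_prod, Finset.mem_erase]
      constructor
      · intro h
        refine ⟨by simpa using h j hj, fun i hi => ?_⟩
        simpa [Function.update_of_ne hi.1] using h i hi.2
      · rintro ⟨h0, h⟩ i hi
        by_cases hij : i = j
        · subst hij; simpa using h0
        · simpa [Function.update_of_ne hij] using h i ⟨hij, hi⟩
    rw [this, Measure.prod_prod, Measure.infinitePi_pi _ (fun i _ => ht i),
      Finset.mul_prod_erase s (fun i => ν i (t i)) hj]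
  · have : (fun x : ℝ × (ι → ℝ) => Function.update x.2 j x.1) ⁻¹' (Set.pi s t)
        = univ ×ˢ Set.pi s t := by
      ext x
      simp only [mem_preimage, Set.mem_pi, Finset.mem_coe, mem_prod, mem_univ, true_and]
      refine forall₂_congr fun i hi => ?_
      rw [Function.update_of_ne (by rintro rfl; exact hj hi)]
    rw [this, Measure.prod_prod, Measure.infinitePi_pi _ (fun i _ => ht i)]
    simp

end InfinitePi

/-! ### The exponential distribution -/

theorem lintegral_expMeasure (r : ℝ) {h : ℝ → ℝ≥0∞} (hh : Measurable h) :
    ∫⁻ x, h x ∂(expMeasure r)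
      = ∫⁻ x in Ioi 0, ENNReal.ofReal (r * Real.exp (-(r * x))) * h x := by
  rw [expMeasure, gammaMeasure, lintegral_withDensity_eq_lintegral_mul _ (by
    exact (measurable_exponentialPDFReal r).ennreal_ofReal) hh, setLIntegral_congr Ioi_ae_eq_Ici,
    ← lintegral_indicator measurableSet_Ici]
  refine lintegral_congr fun x => ?_
  have := exponentialPDF_eq r x
  rw [exponentialPDF, exponentialPDFReal] at this
  simp only [Pi.mul_apply, gammaPDF, this, indicator, mem_Ici]
  split_ifs <;> simp

/-- The exponential distribution has no memory. -/
theorem lintegral_expMeasure_memoryless {r t : ℝ} (ht : 0 ≤ t) {h : ℝ → ℝ≥0∞}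
    (hh : Measurable h) :
    ∫⁻ x in Ioi t, h (x - t) ∂(expMeasure r)
      = ENNReal.ofReal (Real.exp (-(r * t))) * ∫⁻ x, h x ∂(expMeasure r) := by
  have hm : Measurable fun x => h (x - t) := by fun_prop
  rw [← lintegral_indicator measurableSet_Ioi, lintegral_expMeasure _ (hm.indicator measurableSet_Ioi),
    lintegral_expMeasure _ hh, ← lintegral_const_mul _ (by fun_prop),
    ← lintegral_indicator measurableSet_Ioi, ← lintegral_indicator measurableSet_Ioi,
    ← lintegral_add_right_eq_self _ t]
  refine lintegral_congr fun x => ?_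
  simp only [indicator, mem_Ioi]
  by_cases hx : 0 < x
  · have h1 : 0 < x + t := by linarith
    have h2 : t < x + t := by linarith
    simp only [hx, h1, h2, if_true, add_sub_cancel_right]
    rw [← mul_assoc, ← ENNReal.ofReal_mul (by positivity)]
    congr 2
    rw [show -(r * (x + t)) = -(r * t) + -(r * x) by ring, Real.exp_add]
    ring
  · have h2 : ¬ t < x + t := by linarith
    simp [hx, h2]

/-- Besides giving the tail of the exponential law, this is later read backwards, to write a
discount factor as an integral over all later times. -/
theorem lintegral_exp_Ioi {r : ℝ} (hr : 0 < r) (t : ℝ) :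
    ∫⁻ s in Ioi t, ENNReal.ofReal (r * Real.exp (-(r * s)))
      = ENNReal.ofReal (Real.exp (-(r * t))) := by
  have hint : IntegrableOn (fun s => r * Real.exp (-(r * s))) (Ioi t) := by
    have := (exp_neg_integrableOn_Ioi t hr).const_mul r
    simp only [neg_mul] at this
    exact this
  rw [← ofReal_integral_eq_lintegral_ofReal hint
    (Filter.Eventually.of_forall fun s => by positivity)]
  congr 1
  have := integral_exp_mul_Ioi (a := -r) (by linarith) t
  rw [integral_const_mul]
  simp only [neg_mul] at this
  rw [this]
  field_simp

theorem expMeasure_ae_pos (r : ℝ) : ∀ᵐ x ∂(expMeasure r), 0 < x := by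
  rw [ae_iff]
  have : {x : ℝ | ¬ 0 < x} = Iic 0 := by ext; simp
  rw [this, ← lintegral_indicator_one measurableSet_Iic,
    lintegral_expMeasure _ (measurable_one.indicator measurableSet_Iic)]
  refine (setLIntegral_congr_fun measurableSet_Ioi fun x hx => ?_).trans (lintegral_zero)
  rw [indicator_of_notMem (by simpa using hx), mul_zero]

instance expMeasure_nullSingletonClass (r : ℝ) : NullSingletonClass (expMeasure r) := by
  unfold expMeasure gammaMeasure
  infer_instance

/-! ### The claim data seen at a fixed time and the first claim -/

/-- Waiting times (`Sum.inl (k, i)`) and claim sizes (`Sum.inr (k, i)`) of both companies; the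
waiting times `Sum.inl (k, 0)` are counted from the present. -/
abbrev ClaimData := (Fin 2 × ℕ) ⊕ (Fin 2 × ℕ) → ℝ

namespace ClaimData

instance (q : CollabParams) (k : Fin 2) : IsProbabilityMeasure (q.F k) := q.F_prob k

instance (q : CollabParams) (k : Fin 2) : IsProbabilityMeasure (expMeasure (q.lam k)) :=
  isProbabilityMeasure_expMeasure (q.lam_pos k)

/-- The marginal laws of the claim data. -/
def marginal (q : CollabParams) : (Fin 2 × ℕ) ⊕ (Fin 2 × ℕ) → Measure ℝ :=
  Sum.elim (fun j => expMeasure (q.lam j.1)) (fun j => q.F j.1)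

instance (q : CollabParams) (i) : IsProbabilityMeasure (marginal q i) := by
  rcases i with i | i <;> simp only [marginal, Sum.elim_inl, Sum.elim_inr] <;> infer_instance

/-- The law of the claim data. -/
def law (q : CollabParams) : Measure ClaimData := Measure.infinitePi (marginal q)

instance (q : CollabParams) : IsProbabilityMeasure (law q) := by unfold law; infer_instance

/-- The company with the first claim. -/
def first (d : ClaimData) : Fin 2 := if d (.inl (0, 0)) ≤ d (.inl (1, 0)) then 0 else 1

/-- The time of the first claim. -/
def firstTime (d : ClaimData) : ℝ := min (d (.inl (0, 0))) (d (.inl (1, 0)))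

/-- The index of the data after a claim of company `k`. -/
def shiftIndex (k : Fin 2) : (Fin 2 × ℕ) ⊕ (Fin 2 × ℕ) → (Fin 2 × ℕ) ⊕ (Fin 2 × ℕ) :=
  Sum.map (fun j => (j.1, if j.1 = k then j.2 + 1 else j.2))
    (fun j => (j.1, if j.1 = k then j.2 + 1 else j.2))

/-- The data seen just after the first claim, if it is a claim of company `k`. -/
def shift (k : Fin 2) (d : ClaimData) : ClaimData :=
  -- In `Fin 2` the other company is `1 - k`. Its clock is not restarted by the claim: only the
  -- elapsed time is subtracted from it.
  Function.update (fun i => d (shiftIndex k i)) (.inl (1 - k, 0))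
    (d (.inl (1 - k, 0)) - d (.inl (k, 0)))

theorem measurable_update {ι : Type*} [DecidableEq ι] (j : ι) :
    Measurable (fun x : (ι → ℝ) × ℝ => Function.update x.1 j x.2) := by
  refine measurable_pi_lambda _ fun i => ?_
  by_cases h : i = j
  · subst h; simpa using measurable_snd
  · simp only [Function.update_of_ne h]; fun_prop

theorem measurable_shift (k : Fin 2) : Measurable (shift k) := by
  refine (measurable_update _).comp (Measurable.prodMk ?_ (by fun_prop))
  exact measurable_pi_lambda _ fun i => measurable_pi_apply _

theorem measurable_first : Measurable first :=
  Measurable.ite (measurableSet_le (by fun_prop) (by fun_prop)) measurable_const measurable_const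

theorem measurable_firstTime : Measurable firstTime := by unfold firstTime; fun_prop

theorem shiftIndex_injective (k : Fin 2) : Function.Injective (shiftIndex k) := by
  refine Function.Injective.sumMap ?_ ?_ <;>
  · rintro ⟨i, m⟩ ⟨j, n⟩ h
    simp only [Prod.mk.injEq] at h ⊢
    obtain ⟨rfl, h⟩ := h
    refine ⟨rfl, ?_⟩
    split_ifs at h <;> omega

/-- Resampling the clock of company `i` separately from all other data reduces this to the
one-dimensional lack of memory, applied with the other data frozen. -/
theorem lintegral_law_memoryless (q : CollabParams) (i : Fin 2) {t : ℝ} (ht : 0 ≤ t)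
    {g : ClaimData → ℝ≥0∞} (hg : Measurable g) :
    ∫⁻ d, (if t < d (.inl (i, 0)) then
        g (Function.update d (.inl (i, 0)) (d (.inl (i, 0)) - t)) else 0) ∂(law q)
      = ENNReal.ofReal (Real.exp (-(q.lam i * t))) * ∫⁻ d, g d ∂(law q) := by
  have hu := measurable_update (ι := (Fin 2 × ℕ) ⊕ (Fin 2 × ℕ)) (.inl (i, 0))
  have hu' : Measurable (fun x : ℝ × ClaimData => Function.update x.2 (.inl (i, 0)) x.1) :=
    hu.comp measurable_swap
  have key (f : ClaimData → ℝ≥0∞) (hf : Measurable f) : ∫⁻ d, f d ∂(law q)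
      = ∫⁻ d, ∫⁻ r, f (Function.update d (.inl (i, 0)) r) ∂(expMeasure (q.lam i)) ∂(law q) := by
    conv_lhs => rw [law, ← map_update_infinitePi (ν := marginal q) (.inl (i, 0))]
    rw [lintegral_map hf hu']
    exact lintegral_prod_symm' _ (hf.comp hu')
  rw [key g hg, key, ← lintegral_const_mul]
  · refine lintegral_congr fun d => ?_
    rw [← lintegral_expMeasure_memoryless ht, ← lintegral_indicator measurableSet_Ioi]
    · refine lintegral_congr fun r => ?_
      simp [indicator]
    · exact hg.comp (hu.comp (measurable_const.prodMk measurable_id))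
  · exact (hg.comp hu).lintegral_prod_right'
  · refine Measurable.ite (measurableSet_lt measurable_const (by fun_prop)) ?_ measurable_const
    exact hg.comp (hu.comp (measurable_id.prodMk (by fun_prop)))

/-- Split off the winning clock and its claim size with `map_infinitePi_pop`. Given that the clock
rings at `s`, the other clock is still running with an exponential probability, and then what is
left of it has its original law, so the shifted data are as good as new. -/
theorem lintegral_first_eq (q : CollabParams) (k : Fin 2) {G : ℝ → ℝ → ClaimData → ℝ≥0∞}
    (hG : Measurable fun x : ℝ × ℝ × ClaimData => G x.1 x.2.1 x.2.2) :
    ∫⁻ d, (if d (.inl (k, 0)) < d (.inl (1 - k, 0)) then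
        G (d (.inl (k, 0))) (d (.inr (k, 0))) (shift k d) else 0) ∂(law q)
      = ∫⁻ s in Ioi 0, ENNReal.ofReal (q.lam k * Real.exp (-(q.lamTot * s)))
          * ∫⁻ α, ∫⁻ d, G s α d ∂(law q) ∂(q.F k) := by
  have hk : (1 - k : Fin 2) ≠ k := by fin_cases k <;> decide
  have hpop := map_infinitePi_pop (ν := marginal q) (.inl (k, 0)) (.inr (k, 0)) (by simp)
    (shiftIndex k) (shiftIndex_injective k)
    (by rintro (⟨i, j⟩ | ⟨i, j⟩) <;> simp [shiftIndex]; intro h; simp [h])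
    (by rintro (⟨i, j⟩ | ⟨i, j⟩) <;> simp [shiftIndex]; intro h; simp [h])
    (by rintro (⟨i, j⟩ | ⟨i, j⟩) <;> simp [shiftIndex, marginal])
  have hsi : shiftIndex k (.inl (1 - k, 0)) = .inl (1 - k, 0) := by simp [shiftIndex, hk]
  set f : (ℝ × ℝ) × ClaimData → ℝ≥0∞ := fun x =>
    if x.1.1 < x.2 (.inl (1 - k, 0)) then
      G x.1.1 x.1.2 (Function.update x.2 (.inl (1 - k, 0)) (x.2 (.inl (1 - k, 0)) - x.1.1))
    else 0 with hf
  have hfm : Measurable f := by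
    refine Measurable.ite (measurableSet_lt (by fun_prop) (by fun_prop)) ?_ measurable_const
    refine hG.comp (Measurable.prodMk (by fun_prop) (Measurable.prodMk (by fun_prop) ?_))
    exact (measurable_update _).comp (Measurable.prodMk (by fun_prop) (by fun_prop))
  have hpm : Measurable (fun d : ClaimData => ((d (.inl (k, 0)), d (.inr (k, 0))),
      fun i => d (shiftIndex k i))) :=
    Measurable.prodMk (by fun_prop) (measurable_pi_lambda _ fun i => measurable_pi_apply _)
  calc _ = ∫⁻ d, f ((d (.inl (k, 0)), d (.inr (k, 0))), fun i => d (shiftIndex k i)) ∂(law q) := by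
        refine lintegral_congr fun d => ?_
        simp only [hf, hsi, shift]
    _ = ∫⁻ x, f x ∂(((expMeasure (q.lam k)).prod (q.F k)).prod (law q)) := by
        rw [law, ← lintegral_map hfm hpm, hpop]
        rfl
    _ = ∫⁻ s, ∫⁻ α, ∫⁻ d, f ((s, α), d) ∂(law q) ∂(q.F k) ∂(expMeasure (q.lam k)) := by
        rw [lintegral_prod _ hfm.aemeasurable, lintegral_prod]
        exact hfm.lintegral_prod_right'.aemeasurable
    _ = _ := by
        rw [lintegral_expMeasure]
        · refine setLIntegral_congr_fun measurableSet_Ioi fun s hs => ?_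
          have h1 (α : ℝ) : ∫⁻ d, f ((s, α), d) ∂(law q)
              = ENNReal.ofReal (Real.exp (-(q.lam (1 - k) * s))) * ∫⁻ d, G s α d ∂(law q) := by
            exact lintegral_law_memoryless q (1 - k) (le_of_lt hs)
              (hG.comp (measurable_const.prodMk (measurable_const.prodMk measurable_id)))
          have h2 : Measurable fun α => ∫⁻ d, G s α d ∂(law q) := by
            have : Measurable fun x : ℝ × ClaimData => G s x.1 x.2 :=
              hG.comp (measurable_const.prodMk measurable_id)
            exact this.lintegral_prod_right'
          simp only [h1]
          -- The density of the winning clock times the survival probability of the other one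
          -- produces the total intensity in the exponent.
          rw [lintegral_const_mul _ h2, ← mul_assoc,
            ← ENNReal.ofReal_mul (mul_nonneg (q.lam_pos k).le (Real.exp_pos _).le), mul_assoc,
            ← Real.exp_add]
          congr 4
          rw [CollabParams.lamTot]
          fin_cases k <;> simp <;> ring
        · have : Measurable fun x : ℝ × ℝ => ∫⁻ d, f (x, d) ∂(law q) := hfm.lintegral_prod_right'
          exact this.lintegral_prod_right'

/-- Ties must be excluded because `first` assigns them to index `0`, while `lintegral_first_eq` uses
a strict inequality. -/
theorem ae_ne_law (q : CollabParams) :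
    ∀ᵐ d ∂(law q), d (.inl (0, 0)) ≠ d (.inl (1, 0)) := by
  have h := Measure.infinitePi_map_eval_prod (P := marginal q) (i := .inl (0, 0))
    (j := .inl (1, 0)) (by simp)
  have h2 : ∀ᵐ x ∂((expMeasure (q.lam 0)).prod (expMeasure (q.lam 1))), x.1 ≠ x.2 := by
    refine (Measure.ae_prod_iff_ae_ae (p := fun x : ℝ × ℝ => x.1 ≠ x.2)
      (measurableSet_eq_fun measurable_fst measurable_snd).compl).2 ?_
    refine Filter.Eventually.of_forall fun x => ?_
    rw [ae_iff]
    have : {a : ℝ | ¬ (x, a).1 ≠ (x, a).2} = {x} := by ext; simp [eq_comm]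
    rw [this, measure_singleton]
  change ∀ᵐ x ∂(marginal q (.inl (0, 0))).prod (marginal q (.inl (1, 0))), x.1 ≠ x.2 at h2
  rw [← h] at h2
  exact ae_of_ae_map (f := fun d : ClaimData => (d (.inl (0, 0)), d (.inl (1, 0))))
    (by fun_prop) h2

/-- Decomposition at the first claim: it is a claim of company `k` at time `s` with density
`lam k * exp (-(lamTot * s))`, and the data seen afterwards are independent of it and have the same
law as before. -/
theorem lintegral_first (q : CollabParams) {G : Fin 2 → ℝ → ℝ → ClaimData → ℝ≥0∞}
    (hG : ∀ k, Measurable fun x : ℝ × ℝ × ClaimData => G k x.1 x.2.1 x.2.2) :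
    ∫⁻ d, G d.first d.firstTime (d (.inr (d.first, 0))) (shift d.first d) ∂(law q)
      = ∑ k, ∫⁻ s in Ioi 0, ENNReal.ofReal (q.lam k * Real.exp (-(q.lamTot * s)))
          * ∫⁻ α, ∫⁻ d, G k s α d ∂(law q) ∂(q.F k) := by
  simp_rw [← fun k => lintegral_first_eq q k (hG k)]
  rw [Fin.sum_univ_two, ← lintegral_add_left]
  · refine lintegral_congr_ae ?_
    filter_upwards [ae_ne_law q] with d hd
    -- Off the ties exactly one of the two summands is active.
    rcases lt_or_gt_of_ne hd with h | h
    · simp [first, firstTime, h, h.le, h.not_gt]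
    · simp [first, firstTime, h, h.le, h.not_gt, h.not_ge]
  · refine Measurable.ite (measurableSet_lt (by fun_prop) (by fun_prop)) ?_ measurable_const
    exact (hG 0).comp (Measurable.prodMk (by fun_prop)
      (Measurable.prodMk (by fun_prop) (measurable_shift 0)))

end ClaimData

/-! ### Dynamic programming for a stationary dividend strategy -/

theorem measurable_cover : Measurable cover := by
  unfold cover
  refine Measurable.ite (measurableSet_lt (by fun_prop) (by fun_prop)) (by fun_prop) ?_
  refine Measurable.ite (measurableSet_lt (by fun_prop) (by fun_prop)) (by fun_prop) ?_
  exact Measurable.ite (measurableSet_lt (by fun_prop) (by fun_prop)) (by fun_prop) (by fun_prop)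

/-- The surplus levels after a claim of size `α` of company `k` at surplus `z`. -/
def claimPos (k : Fin 2) (z : ℝ × ℝ) (α : ℝ) : ℝ × ℝ :=
  cover (if k = 0 then (z.1 - α, z.2) else (z.1, z.2 - α))

theorem measurable_claimPos (k : Fin 2) :
    Measurable fun x : (ℝ × ℝ) × ℝ => claimPos k x.1 x.2 := by
  refine measurable_cover.comp ?_
  split_ifs <;> fun_prop

/-- The dynamics between two claims that a stationary dividend strategy induces: the surplus
`Z z s` at time `s`, the lump sum `ℓ z` paid at the beginning and the rate `ρ z s` of the payments
at time `s`, together with the payoff `R` at ruin. -/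
structure PeriodControl where
  Z : ℝ × ℝ → ℝ → ℝ × ℝ
  ℓ : ℝ × ℝ → ℝ≥0∞
  ρ : ℝ × ℝ → ℝ → ℝ≥0∞
  R : ℝ × ℝ → ℝ≥0∞
  measurable_Z : Measurable fun x : (ℝ × ℝ) × ℝ => Z x.1 x.2
  measurable_ℓ : Measurable ℓ
  measurable_ρ : Measurable fun x : (ℝ × ℝ) × ℝ => ρ x.1 x.2
  measurable_R : Measurable R

namespace PeriodControl

variable (S : PeriodControl) (q : CollabParams)

/-- The value just after a claim: `W` if the companies survive, and the payoff at ruin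
otherwise. -/
def settle (W : ℝ × ℝ → ℝ≥0∞) (z : ℝ × ℝ) : ℝ≥0∞ := if 0 ≤ z.1 + z.2 then W z else S.R z

/-- The discounted payoff during the first `N` periods between claims. -/
def payoff : ℕ → ℝ × ℝ → ClaimData → ℝ≥0∞
  | 0, _, _ => 0
  | N + 1, z, d => S.ℓ z + ((∫⁻ s in Ico 0 d.firstTime, ENNReal.ofReal (Real.exp (-q.δ * s)) * S.ρ z s)
      + ENNReal.ofReal (Real.exp (-q.δ * d.firstTime))
        * S.settle (fun z' => payoff N z' (ClaimData.shift d.first d))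
            (claimPos d.first (S.Z z d.firstTime) (d (.inr (d.first, 0)))))

/-- The operator `H` for functions with values in `[0, ∞]`. -/
def opHE (W : ℝ × ℝ → ℝ≥0∞) (z : ℝ × ℝ) : ℝ≥0∞ :=
  ∑ k, ENNReal.ofReal (q.lam k) * ∫⁻ α, S.settle W (claimPos k z α) ∂(q.F k)

/-- The dynamic programming operator of the strategy. -/
def opT (W : ℝ × ℝ → ℝ≥0∞) (z : ℝ × ℝ) : ℝ≥0∞ :=
  S.ℓ z + ∫⁻ s in Ioi 0, ENNReal.ofReal (Real.exp (-(q.δ + q.lamTot) * s))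
    * (S.ρ z s + S.opHE q W (S.Z z s))

variable {S q}

/-- The parameter is needed since in `payoff` the continuation value depends on the remaining claim
data as well as on the surplus. -/
theorem measurable_settle {β : Type*} [MeasurableSpace β] {f : ℝ × ℝ → β → ℝ≥0∞}
    (hf : Measurable fun x : (ℝ × ℝ) × β => f x.1 x.2) :
    Measurable fun x : (ℝ × ℝ) × β => S.settle (fun z => f z x.2) x.1 :=
  Measurable.ite (measurableSet_le (by fun_prop) (by fun_prop)) hf
    (S.measurable_R.comp measurable_fst)

theorem measurable_settle' {W : ℝ × ℝ → ℝ≥0∞} (hW : Measurable W) : Measurable (S.settle W) :=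
  Measurable.ite (measurableSet_le (by fun_prop) (by fun_prop)) hW S.measurable_R

/-- The moving upper limit is absorbed into an indicator, which leaves an integral over a fixed
domain with a jointly measurable integrand. -/
theorem measurable_running : Measurable fun x : (ℝ × ℝ) × ℝ =>
    ∫⁻ s in Ico 0 x.2, ENNReal.ofReal (Real.exp (-q.δ * s)) * S.ρ x.1 s := by
  simp_rw [← lintegral_indicator (measurableSet_Ico (a := (0 : ℝ)))]
  refine Measurable.lintegral_prod_right (f := fun (x : (ℝ × ℝ) × ℝ) s => (Ico 0 x.2).indicator
    (fun s => ENNReal.ofReal (Real.exp (-q.δ * s)) * S.ρ x.1 s) s) ?_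
  have := S.measurable_ρ
  simp only [indicator, Function.uncurry_def]
  refine Measurable.ite ?_ ?_ measurable_const
  · exact (measurableSet_le measurable_const measurable_snd).inter
      (measurableSet_lt measurable_snd (by fun_prop))
  · refine Measurable.mul (by fun_prop) ?_
    exact this.comp (f := fun x : ((ℝ × ℝ) × ℝ) × ℝ => (x.1.1, x.2)) (by fun_prop)

theorem measurable_payoff (N : ℕ) :
    Measurable fun x : (ℝ × ℝ) × ClaimData => S.payoff q N x.1 x.2 := by
  induction N with
  | zero => exact measurable_const
  | succ N ih =>
    have hτ : Measurable fun x : (ℝ × ℝ) × ClaimData => x.2.firstTime :=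
      ClaimData.measurable_firstTime.comp measurable_snd
    refine (S.measurable_ℓ.comp measurable_fst).add (Measurable.add ?_ (Measurable.mul ?_ ?_))
    · exact (measurable_running (S := S) (q := q)).comp (measurable_fst.prodMk hτ)
    · fun_prop
    · have hk (k : Fin 2) : Measurable fun x : (ℝ × ℝ) × ClaimData =>
          S.settle (fun z' => S.payoff q N z' (ClaimData.shift k x.2))
            (claimPos k (S.Z x.1 x.2.firstTime) (x.2 (.inr (k, 0)))) := by
        refine (measurable_settle (S := S) ih).comp (Measurable.prodMk ?_
          ((ClaimData.measurable_shift k).comp measurable_snd))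
        exact (measurable_claimPos k).comp
          ((S.measurable_Z.comp (measurable_fst.prodMk hτ)).prodMk (by fun_prop))
      -- The company of the first claim occurs as an index; the two measurable versions are glued
      -- along the event that decides it.
      have : MeasurableSet {x : (ℝ × ℝ) × ClaimData | x.2.first = 0} :=
        (ClaimData.measurable_first.comp measurable_snd) (measurableSet_singleton 0)
      have hite : Measurable fun x : (ℝ × ℝ) × ClaimData => if x.2.first = 0 then _ else _ :=
        Measurable.ite this (hk 0) (hk 1)
      convert hite using 1
      funext x
      rcases Fin.exists_fin_two.1 ⟨x.2.first, rfl⟩ with h | h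
      · simp [h]
      · simp [h]

theorem measurable_opHE {W : ℝ × ℝ → ℝ≥0∞} (hW : Measurable W) : Measurable (S.opHE q W) := by
  refine Finset.measurable_sum _ fun k _ => Measurable.const_mul ?_ _
  exact Measurable.lintegral_prod_right (f := fun z α => S.settle W (claimPos k z α))
    ((measurable_settle' hW).comp (measurable_claimPos k))

theorem measurable_opT {W : ℝ × ℝ → ℝ≥0∞} (hW : Measurable W) : Measurable (S.opT q W) := by
  refine S.measurable_ℓ.add ?_
  refine Measurable.lintegral_prod_right (f := fun z s =>
    ENNReal.ofReal (Real.exp (-(q.δ + q.lamTot) * s)) * (S.ρ z s + S.opHE q W (S.Z z s))) ?_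
  refine Measurable.mul (by fun_prop) (S.measurable_ρ.add ?_)
  exact (measurable_opHE hW).comp S.measurable_Z

theorem measurable_iterate (N : ℕ) : Measurable ((S.opT q)^[N] 0) := by
  induction N with
  | zero => exact measurable_const
  | succ N ih => rw [Function.iterate_succ_apply']; exact measurable_opT ih

theorem lamTot_pos (q : CollabParams) : 0 < q.lamTot := add_pos (q.lam_pos 0) (q.lam_pos 1)

/-- Integrating a running payment against the law of the first claim time. -/
theorem lintegral_running (q : CollabParams) {f : ℝ → ℝ≥0∞} (hf : Measurable f) :
    ∫⁻ s in Ioi 0, ENNReal.ofReal (q.lamTot * Real.exp (-(q.lamTot * s))) * ∫⁻ r in Ico 0 s, f r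
      = ∫⁻ r in Ioi 0, ENNReal.ofReal (Real.exp (-(q.lamTot * r))) * f r := by
  have hl := lamTot_pos q
  have tail := lintegral_exp_Ioi hl
  -- Tonelli: a payment at time `r` counts when the first claim comes later, which has probability
  -- `exp (-lamTot * r)`.
  calc _ = ∫⁻ s in Ioi 0, ∫⁻ r in Ioi 0, (if r < s then
        ENNReal.ofReal (q.lamTot * Real.exp (-(q.lamTot * s))) * f r else 0) := by
        refine setLIntegral_congr_fun measurableSet_Ioi fun s hs => ?_
        rw [← lintegral_const_mul _ hf, setLIntegral_congr Ioi_ae_eq_Ici,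
          ← lintegral_indicator measurableSet_Ici, ← lintegral_indicator measurableSet_Ico]
        refine lintegral_congr fun r => ?_
        simp only [indicator, mem_Ico, mem_Ici]
        split_ifs <;> simp_all
    _ = ∫⁻ r in Ioi 0, ∫⁻ s in Ioi 0, (if r < s then
        ENNReal.ofReal (q.lamTot * Real.exp (-(q.lamTot * s))) * f r else 0) := by
        rw [lintegral_lintegral_swap]
        refine Measurable.aemeasurable ?_
        exact Measurable.ite (measurableSet_lt (by fun_prop) (by fun_prop)) (by fun_prop)
          measurable_const
    _ = _ := by
        refine setLIntegral_congr_fun measurableSet_Ioi fun r hr => ?_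
        rw [← tail r, ← lintegral_mul_const _ (by fun_prop), ← lintegral_indicator measurableSet_Ioi,
          ← lintegral_indicator measurableSet_Ioi]
        refine lintegral_congr fun s => ?_
        simp only [indicator, mem_Ioi] at hr ⊢
        by_cases h : r < s
        · simp [h, hr.trans h]
        · simp [h]

/-- The expected payoff of the first `N` periods is an iterate of the dynamic programming
operator. -/
theorem lintegral_payoff (N : ℕ) (z : ℝ × ℝ) :
    ∫⁻ d, S.payoff q N z d ∂(ClaimData.law q) = ((S.opT q)^[N] 0) z := by
  induction N generalizing z with
  | zero => simp [payoff]
  | succ N ih =>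
    set W := (S.opT q)^[N] 0 with hW
    have hWm : Measurable W := measurable_iterate N
    have hrun : Measurable fun s : ℝ =>
        ∫⁻ r in Ico 0 s, ENNReal.ofReal (Real.exp (-q.δ * r)) * S.ρ z r :=
      (measurable_running (S := S) (q := q)).comp (measurable_const.prodMk measurable_id)
    have hρ : Measurable fun s => S.ρ z s :=
      S.measurable_ρ.comp (measurable_const.prodMk measurable_id)
    have hZ : Measurable fun s => S.Z z s :=
      S.measurable_Z.comp (measurable_const.prodMk measurable_id)
    have hG (k : Fin 2) : Measurable fun x : ℝ × ℝ × ClaimData =>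
        ENNReal.ofReal (Real.exp (-q.δ * x.1)) * S.settle (fun z' => S.payoff q N z' x.2.2)
          (claimPos k (S.Z z x.1) x.2.1) := by
      refine Measurable.mul (by fun_prop) ?_
      refine (measurable_settle (S := S) (measurable_payoff N)).comp (Measurable.prodMk ?_
        (by fun_prop))
      exact (measurable_claimPos k).comp ((hZ.comp measurable_fst).prodMk (by fun_prop))
    -- After a survived claim the induction hypothesis applies at the new surplus; at ruin the
    -- payoff no longer depends on the data.
    have hset (k : Fin 2) (s α : ℝ) : ∫⁻ d, S.settle (fun z' => S.payoff q N z' d)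
        (claimPos k (S.Z z s) α) ∂(ClaimData.law q) = S.settle W (claimPos k (S.Z z s) α) := by
      unfold settle
      split_ifs
      · exact ih _
      · simp
    rw [Function.iterate_succ_apply', ← hW]
    simp only [payoff]
    rw [lintegral_add_left measurable_const, lintegral_const, measure_univ, mul_one, opT]
    congr 1
    rw [ClaimData.lintegral_first q (G := fun k s α d =>
        (∫⁻ r in Ico 0 s, ENNReal.ofReal (Real.exp (-q.δ * r)) * S.ρ z r)
        + ENNReal.ofReal (Real.exp (-q.δ * s)) * S.settle (fun z' => S.payoff q N z' d)
          (claimPos k (S.Z z s) α))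
      (fun k => (hrun.comp measurable_fst).add (hG k))]
    have hin (k : Fin 2) (s : ℝ) : ∫⁻ α, ∫⁻ d,
        ((∫⁻ r in Ico 0 s, ENNReal.ofReal (Real.exp (-q.δ * r)) * S.ρ z r)
          + ENNReal.ofReal (Real.exp (-q.δ * s)) * S.settle (fun z' => S.payoff q N z' d)
            (claimPos k (S.Z z s) α)) ∂(ClaimData.law q) ∂(q.F k)
        = (∫⁻ r in Ico 0 s, ENNReal.ofReal (Real.exp (-q.δ * r)) * S.ρ z r)
          + ENNReal.ofReal (Real.exp (-q.δ * s))
            * ∫⁻ α, S.settle W (claimPos k (S.Z z s) α) ∂(q.F k) := by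
      have h1 (α : ℝ) : Measurable fun d => S.settle (fun z' => S.payoff q N z' d)
          (claimPos k (S.Z z s) α) :=
        (measurable_settle (S := S) (measurable_payoff N)).comp
          (measurable_const.prodMk measurable_id)
      have h2 : Measurable fun α => S.settle W (claimPos k (S.Z z s) α) :=
        (measurable_settle' hWm).comp ((measurable_claimPos k).comp
          (measurable_const.prodMk measurable_id))
      have h3 (α : ℝ) : ∫⁻ d,
          ((∫⁻ r in Ico 0 s, ENNReal.ofReal (Real.exp (-q.δ * r)) * S.ρ z r)
          + ENNReal.ofReal (Real.exp (-q.δ * s)) * S.settle (fun z' => S.payoff q N z' d)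
            (claimPos k (S.Z z s) α)) ∂(ClaimData.law q)
          = (∫⁻ r in Ico 0 s, ENNReal.ofReal (Real.exp (-q.δ * r)) * S.ρ z r)
            + ENNReal.ofReal (Real.exp (-q.δ * s)) * S.settle W (claimPos k (S.Z z s) α) := by
        rw [lintegral_add_left measurable_const, lintegral_const, measure_univ, mul_one,
          lintegral_const_mul _ (h1 α), hset]
      simp_rw [h3]
      rw [lintegral_add_left measurable_const, lintegral_const, measure_univ, mul_one,
        lintegral_const_mul _ h2]
    have hHm (k : Fin 2) : Measurable fun s =>
        ∫⁻ α, S.settle W (claimPos k (S.Z z s) α) ∂(q.F k) := by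
      refine Measurable.lintegral_prod_right
        (f := fun s α => S.settle W (claimPos k (S.Z z s) α)) ?_
      exact (measurable_settle' hWm).comp ((measurable_claimPos k).comp
          ((hZ.comp measurable_fst).prodMk measurable_snd))
    simp_rw [hin, mul_add]
    have hHEm : Measurable fun s => S.opHE q W (S.Z z s) := (measurable_opHE hWm).comp hZ
    rw [lintegral_add_left (by fun_prop)]
    simp_rw [fun k => lintegral_add_left (μ := volume.restrict (Ioi (0 : ℝ)))
      (f := fun s => ENNReal.ofReal (q.lam k * Real.exp (-(q.lamTot * s)))
        * ∫⁻ r in Ico 0 s, ENNReal.ofReal (Real.exp (-q.δ * r)) * S.ρ z r) (by fun_prop)]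
    rw [Finset.sum_add_distrib]
    congr 1
    -- Dividends paid before the claim do not depend on who claims, so the two densities add up to
    -- that of the first claim time.
    · rw [← lintegral_finsetSum _ fun k _ => by fun_prop]
      have := lintegral_running q (f := fun r => ENNReal.ofReal (Real.exp (-q.δ * r)) * S.ρ z r)
        (by fun_prop)
      refine Eq.trans ?_ (this.trans ?_)
      · refine lintegral_congr fun s => ?_
        rw [← Finset.sum_mul, Fin.sum_univ_two, ← ENNReal.ofReal_add
          (mul_nonneg (q.lam_pos 0).le (Real.exp_pos _).le)
          (mul_nonneg (q.lam_pos 1).le (Real.exp_pos _).le), ← add_mul]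
        rfl
      · refine lintegral_congr fun s => ?_
        rw [← mul_assoc, ← ENNReal.ofReal_mul (Real.exp_pos _).le, ← Real.exp_add]
        congr 3
        ring
    -- For the payoff after the claim, the discount merges with the density into the exponent `δ +
    -- lamTot`, and the sum over the companies is `opHE`.
    · rw [← lintegral_finsetSum _ fun k _ => by fun_prop]
      refine lintegral_congr fun s => ?_
      rw [opHE, Finset.mul_sum]
      refine Finset.sum_congr rfl fun k _ => ?_
      rw [ENNReal.ofReal_mul (q.lam_pos k).le, show -(q.δ + q.lamTot) * s
        = -(q.lamTot * s) + -q.δ * s by ring, Real.exp_add, ENNReal.ofReal_mul (Real.exp_pos _).le]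
      ring

end PeriodControl

/-! ### Decreasing curves -/

/-- A continuously differentiable function on `[lo, hi]` with negative derivative that vanishes at
`hi`. -/
structure DecreasingCurve where
  lo : ℝ
  hi : ℝ
  f : ℝ → ℝ
  f' : ℝ → ℝ
  le : lo ≤ hi
  hasDeriv : ∀ u ∈ Icc lo hi, HasDerivWithinAt f (f' u) (Icc lo hi) u
  contDeriv : ContinuousOn f' (Icc lo hi)
  deriv_neg : ∀ u ∈ Icc lo hi, f' u < 0
  finish : f hi = 0

namespace DecreasingCurve

variable (C : DecreasingCurve)

/-- The inverse function. -/
def g : ℝ → ℝ := Function.invFunOn C.f (Icc C.lo C.hi)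

theorem lo_mem : C.lo ∈ Icc C.lo C.hi := left_mem_Icc.2 C.le

theorem hi_mem : C.hi ∈ Icc C.lo C.hi := right_mem_Icc.2 C.le

theorem continuousOn_f : ContinuousOn C.f (Icc C.lo C.hi) :=
  fun u hu => (C.hasDeriv u hu).continuousWithinAt

theorem hasDerivAt {u : ℝ} (hu : u ∈ Ioo C.lo C.hi) : HasDerivAt C.f (C.f' u) u :=
  (C.hasDeriv u (Ioo_subset_Icc_self hu)).hasDerivAt (Icc_mem_nhds hu.1 hu.2)

theorem strictAntiOn : StrictAntiOn C.f (Icc C.lo C.hi) := by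
  refine strictAntiOn_of_deriv_neg (convex_Icc _ _) C.continuousOn_f fun u hu => ?_
  rw [interior_Icc] at hu
  rw [(C.hasDerivAt hu).deriv]
  exact C.deriv_neg u (Ioo_subset_Icc_self hu)

theorem image_eq : C.f '' Icc C.lo C.hi = Icc 0 (C.f C.lo) := by
  refine Subset.antisymm ?_ ?_
  · rintro _ ⟨u, hu, rfl⟩
    refine ⟨?_, C.strictAntiOn.antitoneOn C.lo_mem hu hu.1⟩
    rw [← C.finish]
    exact C.strictAntiOn.antitoneOn hu C.hi_mem hu.2
  · have := intermediate_value_Icc' C.le C.continuousOn_f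
    rwa [C.finish] at this

theorem f_mem {u : ℝ} (hu : u ∈ Icc C.lo C.hi) : C.f u ∈ Icc 0 (C.f C.lo) :=
  C.image_eq ▸ mem_image_of_mem _ hu

theorem top_nonneg : 0 ≤ C.f C.lo := (C.f_mem C.lo_mem).1

theorem g_mem {t : ℝ} (ht : t ∈ Icc 0 (C.f C.lo)) : C.g t ∈ Icc C.lo C.hi :=
  Function.invFunOn_mem (by rw [← C.image_eq] at ht; exact ht)

theorem f_g {t : ℝ} (ht : t ∈ Icc 0 (C.f C.lo)) : C.f (C.g t) = t :=
  Function.invFunOn_eq (by rw [← C.image_eq] at ht; exact ht)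

theorem g_f {u : ℝ} (hu : u ∈ Icc C.lo C.hi) : C.g (C.f u) = u :=
  C.strictAntiOn.injOn (C.g_mem (C.f_mem hu)) hu (C.f_g (C.f_mem hu))

theorem g_lt_iff {t u : ℝ} (ht : t ∈ Icc 0 (C.f C.lo)) (hu : u ∈ Icc C.lo C.hi) :
    C.g t < u ↔ C.f u < t := by
  rw [← C.strictAntiOn.lt_iff_gt hu (C.g_mem ht), C.f_g ht]

theorem le_g_iff {t u : ℝ} (ht : t ∈ Icc 0 (C.f C.lo)) (hu : u ∈ Icc C.lo C.hi) :
    u ≤ C.g t ↔ t ≤ C.f u := by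
  rw [← not_lt, C.g_lt_iff ht hu, not_lt]

/-- The preimage of a closed set under the inverse is an image under `f` of a compact set, hence
closed. -/
theorem continuousOn_g : ContinuousOn C.g (Icc 0 (C.f C.lo)) := by
  rw [continuousOn_iff_isClosed]
  intro t ht
  refine ⟨C.f '' (Icc C.lo C.hi ∩ t), ?_, ?_⟩
  · refine IsCompact.isClosed ?_
    exact (isCompact_Icc.inter_right ht).image_of_continuousOn
      (C.continuousOn_f.mono inter_subset_left)
  · ext y
    constructor
    · rintro ⟨hy, hy'⟩
      exact ⟨⟨C.g y, ⟨C.g_mem hy', hy⟩, C.f_g hy'⟩, hy'⟩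
    · rintro ⟨⟨u, ⟨hu, hut⟩, rfl⟩, hy'⟩
      exact ⟨by rw [mem_preimage, C.g_f hu]; exact hut, hy'⟩

/-- Off the range of the curve `invFunOn` returns one fixed default value, so `g` is continuous on
an interval and constant outside it. -/
theorem measurable_g : Measurable C.g := by
  classical
  refine measurable_of_restrict_of_restrict_compl (s := Icc 0 (C.f C.lo)) measurableSet_Icc
    (continuousOn_iff_continuous_domRestrict.1 C.continuousOn_g).measurable ?_
  have : (Icc 0 (C.f C.lo))ᶜ.domRestrict C.g = fun _ => Classical.choice inferInstance := by
    funext t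
    have h : ¬ ∃ a ∈ Icc C.lo C.hi, C.f a = t := fun ⟨a, ha, hat⟩ => t.2 (hat ▸ C.f_mem ha)
    exact dif_neg h
  rw [this]
  exact measurable_const

/-- The projection to `[lo, hi]`. -/
def clamp (u : ℝ) : ℝ := max C.lo (min C.hi u)

theorem continuous_clamp : Continuous C.clamp := by unfold clamp; fun_prop

theorem clamp_mem (u : ℝ) : C.clamp u ∈ Icc C.lo C.hi :=
  ⟨le_max_left _ _, max_le C.le (min_le_left _ _)⟩

theorem clamp_of_mem {u : ℝ} (hu : u ∈ Icc C.lo C.hi) : C.clamp u = u := by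
  rw [clamp, min_eq_right hu.2, max_eq_right hu.1]

/-- Nothing is assumed about `f` outside `[lo, hi]`; composing with the projection gives an
everywhere continuous substitute for measurability proofs. -/
theorem continuous_f_clamp : Continuous fun u => C.f (C.clamp u) :=
  C.continuousOn_f.comp_continuous C.continuous_clamp C.clamp_mem

theorem continuous_f'_clamp : Continuous fun u => C.f' (C.clamp u) :=
  C.contDeriv.comp_continuous C.continuous_clamp C.clamp_mem

/-- By compactness the slope stays away from zero, which bounds the dividend rates along the curve.
-/
theorem exists_deriv_le : ∃ ε > 0, ∀ u ∈ Icc C.lo C.hi, C.f' u ≤ -ε := by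
  obtain ⟨u, hu, h⟩ := isCompact_Icc.exists_isMaxOn (nonempty_Icc.2 C.le) C.contDeriv
  exact ⟨-C.f' u, by linarith [C.deriv_neg u hu], fun v hv => by simpa using h hv⟩

/-! ### The motion along lines and then along the curve -/

/-- The motion with speed `(m, n)` until the curve `{(u + m / n * f u, f u)}` is hit, and then along
the curve until its end point, where it stops. -/
def path (m n : ℝ) (z : ℝ × ℝ) (t : ℝ) : ℝ × ℝ :=
  if t ≤ (C.f (z.1 - m / n * z.2) - z.2) / n then (z.1 + m * t, z.2 + n * t)
  else if z.2 + n * t ≤ C.f C.lo then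
    (C.g (z.2 + n * t) + m / n * (z.2 + n * t), z.2 + n * t)
  else (C.lo + m / n * C.f C.lo, C.f C.lo)

/-- The region between the axis and the curve. -/
def inner (m n : ℝ) : Set (ℝ × ℝ) :=
  {z | 0 ≤ z.1 ∧ 0 ≤ z.2 ∧ z.1 - m / n * z.2 ∈ Icc C.lo C.hi ∧ z.2 ≤ C.f (z.1 - m / n * z.2)}

variable {C} {m n : ℝ}

theorem path_nonneg (hm : 0 < m) (hn : 0 < n)
    (hq : ∀ u ∈ Icc C.lo C.hi, 0 ≤ u + m / n * C.f u) {z : ℝ × ℝ} (hz : z ∈ C.inner m n) {t : ℝ}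
    (ht : 0 ≤ t) : 0 ≤ (C.path m n z t).1 ∧ 0 ≤ (C.path m n z t).2 := by
  obtain ⟨h1, h2, -, -⟩ := hz
  have hnt : 0 ≤ n * t := by positivity
  unfold path
  split_ifs with h h'
  · exact ⟨by positivity, by positivity⟩
  · have hmem : z.2 + n * t ∈ Icc 0 (C.f C.lo) := ⟨by positivity, h'⟩
    have := hq _ (C.g_mem hmem)
    rw [C.f_g hmem] at this
    exact ⟨this, hmem.1⟩
  · exact ⟨hq _ C.lo_mem, C.top_nonneg⟩

/-- The second coordinate never passes the level of the end point, and the intercept `z.1 - m / n *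
z.2` never exceeds `hi`. The bound depends neither on the starting point nor on the time, so rewards
along the motion are bounded uniformly. -/
theorem path_le (hm : 0 < m) (hn : 0 < n) {z : ℝ × ℝ} (hz : z ∈ C.inner m n) {t : ℝ}
    (ht : 0 ≤ t) :
    (C.path m n z t).1 ≤ C.hi + m / n * C.f C.lo ∧ (C.path m n z t).2 ≤ C.f C.lo := by
  obtain ⟨h1, h2, h3, h4⟩ := hz
  have hnt : 0 ≤ n * t := by positivity
  have hr : 0 < m / n := by positivity
  unfold path
  split_ifs with h h'
  · rw [le_div_iff₀ hn] at h
    have h5 : z.2 + n * t ≤ C.f C.lo := by linarith [(C.f_mem h3).2]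
    refine ⟨?_, h5⟩
    have h6 := mul_le_mul_of_nonneg_left h5 hr.le
    have h7 : m * t = m / n * (n * t) := by field_simp
    have := h3.2
    simp only
    nlinarith
  · have hmem : z.2 + n * t ∈ Icc 0 (C.f C.lo) := ⟨by positivity, h'⟩
    have h6 := mul_le_mul_of_nonneg_left h' hr.le
    exact ⟨by linarith [(C.g_mem hmem).2], h'⟩
  · exact ⟨by linarith [C.le], le_rfl⟩

/-- This is `path` with the intercept clamped; the two agree on `inner`, but only this version is
measurable without a restriction on the starting point. -/
theorem measurable_path_clamp (m n : ℝ) : Measurable fun x : (ℝ × ℝ) × ℝ =>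
    if x.2 ≤ (C.f (C.clamp (x.1.1 - m / n * x.1.2)) - x.1.2) / n then
      (x.1.1 + m * x.2, x.1.2 + n * x.2)
    else if x.1.2 + n * x.2 ≤ C.f C.lo then
      (C.g (x.1.2 + n * x.2) + m / n * (x.1.2 + n * x.2), x.1.2 + n * x.2)
    else (C.lo + m / n * C.f C.lo, C.f C.lo) := by
  have h1 := C.continuous_f_clamp.measurable
  have h2 := C.measurable_g
  have h3 : Measurable fun x : (ℝ × ℝ) × ℝ => C.f (C.clamp (x.1.1 - m / n * x.1.2)) :=
    h1.comp (f := fun x : (ℝ × ℝ) × ℝ => x.1.1 - m / n * x.1.2) (by fun_prop)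
  refine Measurable.ite (measurableSet_le (by fun_prop) (by fun_prop)) (by fun_prop) ?_
  exact Measurable.ite (measurableSet_le (by fun_prop) (by fun_prop)) (by fun_prop)
    measurable_const

/-- The discounted reward from the point of the curve with parameter `u` on: the rate
`- a * n / f'` and the reward `h` along the curve, and then the reward `κ * c` at its end point. -/
def curveValue (C : DecreasingCurve) (m n κ a c : ℝ) (h : ℝ × ℝ → ℝ) (u : ℝ) : ℝ :=
  Real.exp (κ * ((C.f u - C.f C.lo) / n)) * c
  + Real.exp (κ * (C.f u / n)) * a * (∫ s in C.lo..u, Real.exp (-κ * (C.f s / n)))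
  + Real.exp (κ * (C.f u / n)) / n
      * (∫ t in C.f u..C.f C.lo, h (C.g t + m / n * t, t) * Real.exp (-κ * (t / n)))

/-- Substitution of the second coordinate for the intercept. The formula for `k` integrates
dividends in the intercept, whereas an integral over time becomes one in the second coordinate, with
the rate contributing `1 / f'`. -/
theorem integral_exp_f (κ : ℝ) {u : ℝ} (hu : u ∈ Icc C.lo C.hi) :
    ∫ s in C.lo..u, Real.exp (-κ * (C.f s / n))
      = ∫ t in C.f u..C.f C.lo, Real.exp (-κ * (t / n)) * (-1 / C.f' (C.g t)) := by
  have hsub : Icc C.lo u ⊆ Icc C.lo C.hi := Icc_subset_Icc_right hu.2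
  have h := intervalIntegral.integral_comp_mul_deriv'' (a := C.lo) (b := u) (f := C.f)
    (f' := C.f') (g := fun t => Real.exp (-κ * (t / n)) * (1 / C.f' (C.g t)))
    (by rw [uIcc_of_le hu.1]; exact C.continuousOn_f.mono hsub)
    (by
      rw [min_eq_left hu.1, max_eq_right hu.1]
      exact fun x hx => (C.hasDerivAt ⟨hx.1, hx.2.trans_le hu.2⟩).hasDerivWithinAt)
    (by rw [uIcc_of_le hu.1]; exact C.contDeriv.mono hsub)
    (by
      rw [uIcc_of_le hu.1]
      have himg : C.f '' Icc C.lo u ⊆ Icc 0 (C.f C.lo) := by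
        rw [← C.image_eq]; exact image_mono hsub
      refine ContinuousOn.mono ?_ himg
      refine ContinuousOn.mul (by fun_prop) (continuousOn_const.div ?_ ?_)
      · exact C.contDeriv.comp C.continuousOn_g fun t ht => C.g_mem ht
      · exact fun t ht => (C.deriv_neg _ (C.g_mem ht)).ne)
  have h2 : ∫ s in C.lo..u, Real.exp (-κ * (C.f s / n))
      = ∫ s in C.lo..u, ((fun t => Real.exp (-κ * (t / n)) * (1 / C.f' (C.g t))) ∘ C.f) s
        * C.f' s := by
    refine intervalIntegral.integral_congr fun s hs => ?_
    rw [uIcc_of_le hu.1] at hs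
    have hne := (C.deriv_neg s (hsub hs)).ne
    simp only [Function.comp, C.g_f (hsub hs)]
    field_simp
  rw [h2, h, intervalIntegral.integral_symm, ← intervalIntegral.integral_neg]
  refine intervalIntegral.integral_congr fun t _ => ?_
  ring

/-- The discounted reward along a motion that starts between the axis and the curve. -/
theorem integral_path {κ a c : ℝ} (hn : 0 < n) (hκ : 0 < κ) {h : ℝ × ℝ → ℝ} {z : ℝ × ℝ}
    (hz : z ∈ C.inner m n) {F : ℝ → ℝ}
    (hF1 : ∀ s, 0 < s → s < (C.f (z.1 - m / n * z.2) - z.2) / n →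
      F s = h (z.1 + m * s, z.2 + n * s))
    (hF2 : ∀ s, (C.f (z.1 - m / n * z.2) - z.2) / n < s → z.2 + n * s < C.f C.lo →
      F s = a * (-n / C.f' (C.g (z.2 + n * s)))
        + h (C.g (z.2 + n * s) + m / n * (z.2 + n * s), z.2 + n * s))
    (hF3 : ∀ s, C.f C.lo < z.2 + n * s → F s = κ * c)
    (hint : IntegrableOn (fun s => Real.exp (-κ * s) * F s) (Ioi 0)) :
    ∫ s in Ioi 0, Real.exp (-κ * s) * F s
      = Real.exp (-κ * ((C.f (z.1 - m / n * z.2) - z.2) / n))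
          * C.curveValue m n κ a c h (z.1 - m / n * z.2)
        + ∫ s in 0..(C.f (z.1 - m / n * z.2) - z.2) / n,
            Real.exp (-κ * s) * h (z.1 + m * s, z.2 + n * s) := by
  obtain ⟨-, hz2, hu, hle⟩ := hz
  set u := z.1 - m / n * z.2 with hu_def
  -- `θ` is the time at which the curve is hit and `θ₂` the time of arrival at its end point; until
  -- `θ₂` the second coordinate grows at the constant speed `n`.
  set θ := (C.f u - z.2) / n with hθ
  set θ₂ := (C.f C.lo - z.2) / n with hθ₂
  have hθ0 : 0 ≤ θ := div_nonneg (by linarith) hn.le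
  have hθθ : θ ≤ θ₂ := by
    rw [hθ, hθ₂]; gcongr; exact (C.f_mem hu).2
  have hi1 : IntervalIntegrable (fun s => Real.exp (-κ * s) * F s) volume 0 θ :=
    (intervalIntegrable_iff_integrableOn_Ioc_of_le hθ0).2 (hint.mono_set Ioc_subset_Ioi_self)
  have hi2 : IntervalIntegrable (fun s => Real.exp (-κ * s) * F s) volume θ θ₂ :=
    (intervalIntegrable_iff_integrableOn_Ioc_of_le hθθ).2
      (hint.mono_set fun s hs => lt_of_le_of_lt hθ0 hs.1)
  have hi3 : IntegrableOn (fun s => Real.exp (-κ * s) * F s) (Ioi θ₂) :=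
    hint.mono_set (Ioi_subset_Ioi (hθ0.trans hθθ))
  have hi23 : IntegrableOn (fun s => Real.exp (-κ * s) * F s) (Ioi θ) :=
    hint.mono_set (Ioi_subset_Ioi hθ0)
  have e1 : ∫ s in 0..θ, Real.exp (-κ * s) * F s
      = ∫ s in 0..θ, Real.exp (-κ * s) * h (z.1 + m * s, z.2 + n * s) := by
    refine intervalIntegral.integral_congr_Ioo_of_le hθ0 fun s hs => ?_
    simp only [hF1 s hs.1 hs.2]
  -- The constant rate `κ * c` from `θ₂` on has discounted total `exp (-κ * θ₂) * c`.
  have e3 : ∫ s in Ioi θ₂, Real.exp (-κ * s) * F s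
      = Real.exp (-κ * θ) * (Real.exp (κ * ((C.f u - C.f C.lo) / n)) * c) := by
    have : ∫ s in Ioi θ₂, Real.exp (-κ * s) * F s = ∫ s in Ioi θ₂, Real.exp (-κ * s) * (κ * c) := by
      refine setIntegral_congr_fun measurableSet_Ioi fun s hs => ?_
      have : C.f C.lo < z.2 + n * s := by
        rw [mem_Ioi, hθ₂, div_lt_iff₀ hn] at hs; linarith
      simp only [hF3 s this]
    rw [this, integral_mul_const, integral_exp_mul_Ioi (by linarith),
      ← mul_assoc (Real.exp (-κ * θ)), ← Real.exp_add]
    have hexp : -κ * θ + κ * ((C.f u - C.f C.lo) / n) = -κ * θ₂ := by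
      rw [hθ, hθ₂]; field_simp; ring
    rw [hexp]
    field_simp
  -- the part along the curve, in terms of the second coordinate
  set A : ℝ → ℝ := fun t => a * (Real.exp (-κ * (t / n)) * (-1 / C.f' (C.g t))) with hA
  set B : ℝ → ℝ := fun t => n⁻¹ * (h (C.g t + m / n * t, t) * Real.exp (-κ * (t / n))) with hB
  set E := Real.exp (κ * (z.2 / n)) with hE
  have hpt : ∀ s ∈ Ioo θ θ₂, Real.exp (-κ * s) * F s
      = (E * n) * (A (z.2 + n * s) + B (z.2 + n * s)) := by
    intro s hs
    have h2 : z.2 + n * s < C.f C.lo := by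
      have := hs.2; rw [hθ₂, lt_div_iff₀ hn] at this; linarith
    rw [hF2 s hs.1 h2]
    have hexp : Real.exp (-κ * s) = E * Real.exp (-κ * ((z.2 + n * s) / n)) := by
      rw [hE, ← Real.exp_add]; congr 1; field_simp; ring
    rw [hexp, hA, hB]
    field_simp
  have hAi : IntervalIntegrable A volume (C.f u) (C.f C.lo) := by
    refine ContinuousOn.intervalIntegrable ?_
    rw [uIcc_of_le (C.f_mem hu).2]
    refine ContinuousOn.mono ?_ (Icc_subset_Icc_left (C.f_mem hu).1)
    refine continuousOn_const.mul (ContinuousOn.mul (by fun_prop) (continuousOn_const.div ?_ ?_))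
    · exact C.contDeriv.comp C.continuousOn_g fun t ht => C.g_mem ht
    · exact fun t ht => (C.deriv_neg _ (C.g_mem ht)).ne
  have hend1 : n * θ + z.2 = C.f u := by rw [hθ]; field_simp; ring
  have hend2 : n * θ₂ + z.2 = C.f C.lo := by rw [hθ₂]; field_simp; ring
  -- Integrability of `h` along the curve is not assumed. That of the sum is transported from `F` by
  -- an affine change of variable, and subtracting the continuous `A` leaves `B`.
  have hABi : IntervalIntegrable (fun t => A t + B t) volume (C.f u) (C.f C.lo) := by
    have h1 : IntervalIntegrable (fun s => (E * n) * (A (z.2 + n * s) + B (z.2 + n * s)))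
        volume θ θ₂ := by
      rw [intervalIntegrable_iff_integrableOn_Ioo_of_le hθθ] at hi2 ⊢
      exact hi2.congr_fun hpt measurableSet_Ioo
    have h2 : IntervalIntegrable (fun s => A (z.2 + n * s) + B (z.2 + n * s)) volume θ θ₂ := by
      have := h1.const_mul (E * n)⁻¹
      refine this.congr ?_
      have hne : E * n ≠ 0 := mul_ne_zero (Real.exp_pos _).ne' hn.ne'
      exact fun s _ => inv_mul_cancel_left₀ hne _
    have h3 := (h2.comp_sub_right (z.2 / n)).comp_mul_right (c := n⁻¹)
    have e (x : ℝ) : z.2 + n * (x * n⁻¹ - z.2 / n) = x := by field_simp; ring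
    simp only [e] at h3
    convert h3 using 1
    · rw [← hend1]; field_simp
    · rw [← hend2]; field_simp
  have hBi : IntervalIntegrable B volume (C.f u) (C.f C.lo) := by
    simpa using hABi.sub hAi
  have e2 : ∫ s in θ..θ₂, Real.exp (-κ * s) * F s
      = E * ((∫ t in C.f u..C.f C.lo, A t) + ∫ t in C.f u..C.f C.lo, B t) := by
    rw [intervalIntegral.integral_congr_Ioo_of_le hθθ hpt, intervalIntegral.integral_const_mul,
      ← intervalIntegral.integral_add hAi hBi,
      intervalIntegral.integral_comp_add_mul (fun t => A t + B t) hn.ne', smul_eq_mul,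
      add_comm z.2, add_comm z.2, hend1, hend2]
    field_simp
  have hEθ : E = Real.exp (-κ * θ) * Real.exp (κ * (C.f u / n)) := by
    rw [hE, hθ, ← Real.exp_add]; congr 1; field_simp; ring
  -- The half-line is reassembled from its three pieces, cut at `θ` and `θ₂`.
  rw [← intervalIntegral.integral_Ioi_sub_Ioi hint hθ0, sub_eq_iff_eq_add] at e1
  rw [← intervalIntegral.integral_Ioi_sub_Ioi hi23 hθθ, sub_eq_iff_eq_add] at e2
  rw [e1, e2, e3, hEθ, curveValue, integral_exp_f κ hu]
  simp only [hA, hB, intervalIntegral.integral_const_mul]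
  ring

end DecreasingCurve

/-! ### Positivity of the parameters and geometry of a curve strategy -/

namespace CollabParams

/-- The net profit condition makes the premium exceed a quantity that is non-negative because claims
are. -/
theorem p_pos (q : CollabParams) (k : Fin 2) : 0 < q.p k := by
  refine lt_of_le_of_lt (mul_nonneg (q.lam_pos k).le ?_) (q.netProfit k)
  refine integral_nonneg_of_ae ?_
  rw [Filter.EventuallyLE, ae_iff]
  convert q.F_nonneg k using 2
  ext x
  simp

theorem a_nonneg (q : CollabParams) (k : Fin 2) : 0 ≤ q.a k := by
  fin_cases k
  · simpa [a] using q.a1_nonneg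
  · simpa [a] using q.a1_le_one

theorem a_le_one (q : CollabParams) (k : Fin 2) : q.a k ≤ 1 := by
  fin_cases k
  · simpa [a] using q.a1_le_one
  · simpa [a] using q.a1_nonneg

theorem kappa_pos (q : CollabParams) : 0 < q.δ + q.lamTot :=
  add_pos q.δ_pos (PeriodControl.lamTot_pos q)

end CollabParams

namespace CurveStrategy

variable {q : CollabParams} (ξ : CurveStrategy q)

/-- The curve `ξ₁`. -/
def side₁ : DecreasingCurve where
  lo := ξ.ubar
  hi := ξ.M₁
  f := ξ.ξ₁
  f' := ξ.dξ₁
  le := ξ.le_M₁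
  hasDeriv := ξ.hasDeriv₁
  contDeriv := ξ.contDeriv₁
  deriv_neg := ξ.deriv_neg₁
  finish := ξ.finish₁

/-- The curve `ξ₂`. -/
def side₂ : DecreasingCurve where
  lo := ξ.vbar
  hi := ξ.M₂
  f := ξ.ξ₂
  f' := ξ.dξ₂
  le := ξ.le_M₂
  hasDeriv := ξ.hasDeriv₂
  contDeriv := ξ.contDeriv₂
  deriv_neg := ξ.deriv_neg₂
  finish := ξ.finish₂

/-- The part of the quadrant below the line through `(x̄, ȳ)` and the curve. -/
def inner₁ : Set (ℝ × ℝ) := ξ.side₁.inner (q.p 0) (q.p 1)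

/-- The part of the quadrant above the line through `(x̄, ȳ)` and below the curve. -/
def inner₂ : Set (ℝ × ℝ) := {z | z.swap ∈ ξ.side₂.inner (q.p 1) (q.p 0)}

@[simp] theorem side₁_lo : ξ.side₁.lo = ξ.ubar := rfl
@[simp] theorem side₂_lo : ξ.side₂.lo = ξ.vbar := rfl
@[simp] theorem side₁_hi : ξ.side₁.hi = ξ.M₁ := rfl
@[simp] theorem side₂_hi : ξ.side₂.hi = ξ.M₂ := rfl
@[simp] theorem side₁_f : ξ.side₁.f = ξ.ξ₁ := rfl
@[simp] theorem side₂_f : ξ.side₂.f = ξ.ξ₂ := rfl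
@[simp] theorem side₁_f' : ξ.side₁.f' = ξ.dξ₁ := rfl
@[simp] theorem side₂_f' : ξ.side₂.f' = ξ.dξ₂ := rfl
@[simp] theorem side₁_g : ξ.side₁.g = ξ.inv₁ := rfl
@[simp] theorem side₂_g : ξ.side₂.g = ξ.inv₂ := rfl

theorem ξ₁_ubar : ξ.ξ₁ ξ.ubar = ξ.ybar := ξ.start₁

theorem ξ₂_vbar : ξ.ξ₂ ξ.vbar = ξ.xbar := ξ.start₂

theorem ubar_add : ξ.ubar + q.p 0 / q.p 1 * ξ.ybar = ξ.xbar := by rw [ubar]; ring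

theorem vbar_add : ξ.vbar + q.p 1 / q.p 0 * ξ.xbar = ξ.ybar := by rw [vbar]; ring

/-- The two distances from the line through `(x̄, ȳ)` are proportional. -/
theorem line_relation (z : ℝ × ℝ) : q.p 1 * (z.1 - q.p 0 / q.p 1 * z.2 - ξ.ubar)
    = -(q.p 0 * (z.2 - q.p 1 / q.p 0 * z.1 - ξ.vbar)) := by
  have h0 := (q.p_pos 0).ne'
  have h1 := (q.p_pos 1).ne'
  rw [ubar, vbar]
  field_simp
  ring

/-- The two sides of the dividing line are described by different intercepts; this translates one
description into the other. -/
theorem ubar_le_iff (z : ℝ × ℝ) : ξ.ubar ≤ z.1 - q.p 0 / q.p 1 * z.2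
    ↔ z.2 - q.p 1 / q.p 0 * z.1 ≤ ξ.vbar := by
  have h0 := q.p_pos 0
  have h1 := q.p_pos 1
  have h := ξ.line_relation z
  constructor
  · intro hu
    by_contra hv
    nlinarith [mul_pos h0 (sub_pos.2 (not_le.1 hv)), mul_nonneg h1.le (sub_nonneg.2 hu)]
  · intro hu
    by_contra hv
    nlinarith [mul_pos h1 (sub_pos.2 (not_le.1 hv)), mul_nonneg h0.le (sub_nonneg.2 hu)]

theorem vbar_le_iff (z : ℝ × ℝ) : ξ.vbar ≤ z.2 - q.p 1 / q.p 0 * z.1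
    ↔ z.1 - q.p 0 / q.p 1 * z.2 ≤ ξ.ubar := by
  have h0 := q.p_pos 0
  have h1 := q.p_pos 1
  have h := ξ.line_relation z
  constructor
  · intro hu
    by_contra hv
    nlinarith [mul_pos h1 (sub_pos.2 (not_le.1 hv)), mul_nonneg h0.le (sub_nonneg.2 hu)]
  · intro hu
    by_contra hv
    nlinarith [mul_pos h0 (sub_pos.2 (not_le.1 hv)), mul_nonneg h1.le (sub_nonneg.2 hu)]

theorem inner₁_subset : ξ.inner₁ ⊆ ξ.O₁ := fun _ hz => ⟨⟨hz.1, hz.2.1⟩, hz.2.2.1.1⟩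

theorem inner₂_subset : ξ.inner₂ ⊆ ξ.O₂ := fun _ hz => ⟨⟨hz.2.1, hz.1⟩, hz.2.2.1.1⟩

theorem y_mem {z : ℝ × ℝ} (hz : z ∈ quadrant) (hy : z.2 ≤ ξ.ybar) :
    z.2 ∈ Icc 0 (ξ.side₁.f ξ.side₁.lo) := ⟨hz.2, by simpa [ξ.ξ₁_ubar] using hy⟩

theorem x_mem {z : ℝ × ℝ} (hz : z ∈ quadrant) (hx : z.1 ≤ ξ.xbar) :
    z.1 ∈ Icc 0 (ξ.side₂.f ξ.side₂.lo) := ⟨hz.1, by simpa [ξ.ξ₂_vbar] using hx⟩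

theorem ubar_le_inv₁ {z : ℝ × ℝ} (hz : z ∈ quadrant) (hy : z.2 ≤ ξ.ybar) :
    ξ.ubar ≤ ξ.inv₁ z.2 := (ξ.side₁.g_mem (ξ.y_mem hz hy)).1

theorem vbar_le_inv₂ {z : ℝ × ℝ} (hz : z ∈ quadrant) (hx : z.1 ≤ ξ.xbar) :
    ξ.vbar ≤ ξ.inv₂ z.1 := (ξ.side₂.g_mem (ξ.x_mem hz hx)).1

theorem inv₁_ybar : ξ.inv₁ ξ.ybar = ξ.ubar := by
  rw [← ξ.ξ₁_ubar]; exact ξ.side₁.g_f ξ.side₁.lo_mem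

theorem inv₂_xbar : ξ.inv₂ ξ.xbar = ξ.vbar := by
  rw [← ξ.ξ₂_vbar]; exact ξ.side₂.g_f ξ.side₂.lo_mem

/-- Being below the curve can be tested along the line of slope `p₂/p₁`, which suits the motion, or
horizontally through the inverse, as the formulas do. Monotonicity of the curve makes the two tests
equivalent. -/
theorem mem_inner₁_iff {z : ℝ × ℝ} (hz : z ∈ ξ.O₁) :
    z ∈ ξ.inner₁ ↔ z.2 ≤ ξ.ybar ∧ z.1 ≤ ξ.inv₁ z.2 + q.p 0 / q.p 1 * z.2 := by
  constructor
  · rintro ⟨h1, h2, h3, h4⟩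
    have hy : z.2 ≤ ξ.ybar := h4.trans ((ξ.side₁.f_mem h3).2.trans ξ.ξ₁_ubar.le)
    refine ⟨hy, ?_⟩
    have := (ξ.side₁.le_g_iff (ξ.y_mem hz.1 hy) h3).2 h4
    simp only [side₁_g] at this
    linarith
  · rintro ⟨hy, hx⟩
    have hg := ξ.side₁.g_mem (ξ.y_mem hz.1 hy)
    have hu : z.1 - q.p 0 / q.p 1 * z.2 ≤ ξ.side₁.g z.2 := by simp only [side₁_g]; linarith
    have hm : z.1 - q.p 0 / q.p 1 * z.2 ∈ Icc ξ.side₁.lo ξ.side₁.hi := ⟨hz.2, hu.trans hg.2⟩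
    exact ⟨hz.1.1, hz.1.2, hm, (ξ.side₁.le_g_iff (ξ.y_mem hz.1 hy) hm).1 hu⟩

theorem mem_inner₂_iff {z : ℝ × ℝ} (hz : z ∈ ξ.O₂) :
    z ∈ ξ.inner₂ ↔ z.1 ≤ ξ.xbar ∧ z.2 ≤ ξ.inv₂ z.1 + q.p 1 / q.p 0 * z.1 := by
  constructor
  · rintro ⟨h1, h2, h3, h4⟩
    have hy : z.1 ≤ ξ.xbar := h4.trans ((ξ.side₂.f_mem h3).2.trans ξ.ξ₂_vbar.le)
    refine ⟨hy, ?_⟩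
    have := (ξ.side₂.le_g_iff (ξ.x_mem hz.1 hy) h3).2 h4
    simp only [side₂_g, Prod.fst_swap, Prod.snd_swap] at this
    linarith
  · rintro ⟨hy, hx⟩
    have hg := ξ.side₂.g_mem (ξ.x_mem hz.1 hy)
    have hu : z.2 - q.p 1 / q.p 0 * z.1 ≤ ξ.side₂.g z.1 := by simp only [side₂_g]; linarith
    have hm : z.2 - q.p 1 / q.p 0 * z.1 ∈ Icc ξ.side₂.lo ξ.side₂.hi := ⟨hz.2, hu.trans hg.2⟩
    exact ⟨hz.1.2, hz.1.1, hm, (ξ.side₂.le_g_iff (ξ.x_mem hz.1 hy) hm).1 hu⟩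

theorem mem_O₁_or_O₂ {z : ℝ × ℝ} (hz : z ∈ quadrant) : z ∈ ξ.O₁ ∨ z ∈ ξ.O₂ := by
  rcases le_total ξ.ubar (z.1 - q.p 0 / q.p 1 * z.2) with h | h
  · exact Or.inl ⟨hz, h⟩
  · exact Or.inr ⟨hz, (ξ.vbar_le_iff z).2 h⟩

/-- The dividing line has positive slope, so a point below it whose second coordinate is at least
`ȳ` has first coordinate at least `x̄`. -/
theorem O₁_cases {z : ℝ × ℝ} (hz : z ∈ ξ.O₁) : z ∈ ξ.inner₁
    ∨ (z.2 ≤ ξ.ybar ∧ ξ.inv₁ z.2 + q.p 0 / q.p 1 * z.2 ≤ z.1)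
    ∨ (ξ.xbar ≤ z.1 ∧ ξ.ybar ≤ z.2) := by
  rw [ξ.mem_inner₁_iff hz]
  rcases le_total z.2 ξ.ybar with hy | hy
  · rcases le_total z.1 (ξ.inv₁ z.2 + q.p 0 / q.p 1 * z.2) with hx | hx
    · exact Or.inl ⟨hy, hx⟩
    · exact Or.inr (Or.inl ⟨hy, hx⟩)
  · refine Or.inr (Or.inr ⟨?_, hy⟩)
    have := mul_le_mul_of_nonneg_left hy (div_pos (q.p_pos 0) (q.p_pos 1)).le
    linarith [hz.2, ξ.ubar_add]

theorem O₂_cases {z : ℝ × ℝ} (hz : z ∈ ξ.O₂) : z ∈ ξ.inner₂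
    ∨ (z.1 ≤ ξ.xbar ∧ ξ.inv₂ z.1 + q.p 1 / q.p 0 * z.1 ≤ z.2)
    ∨ (ξ.xbar ≤ z.1 ∧ ξ.ybar ≤ z.2) := by
  rw [ξ.mem_inner₂_iff hz]
  rcases le_total z.1 ξ.xbar with hy | hy
  · rcases le_total z.2 (ξ.inv₂ z.1 + q.p 1 / q.p 0 * z.1) with hx | hx
    · exact Or.inl ⟨hy, hx⟩
    · exact Or.inr (Or.inl ⟨hy, hx⟩)
  · refine Or.inr (Or.inr ⟨hy, ?_⟩)
    have := mul_le_mul_of_nonneg_left hy (div_pos (q.p_pos 1) (q.p_pos 0)).le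
    linarith [hz.2, ξ.vbar_add]

/-! ### Lump sums -/

theorem ubar_lt_of_mem_B₁ {z : ℝ × ℝ} (h : z ∈ ξ.B₁) : ξ.ubar < z.1 - q.p 0 / q.p 1 * z.2 := by
  linarith [ξ.ubar_le_inv₁ h.1 h.2.1, h.2.2]

theorem vbar_lt_of_mem_B₂ {z : ℝ × ℝ} (h : z ∈ ξ.B₂) : ξ.vbar < z.2 - q.p 1 / q.p 0 * z.1 := by
  linarith [ξ.vbar_le_inv₂ h.1 h.2.1, h.2.2]

/-- The corner itself is not in `B₀`, but there the formula gives zero, which is what is paid. So it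
holds on the whole closed region. -/
theorem lump_corner {z : ℝ × ℝ} (hx : ξ.xbar ≤ z.1) (hy : ξ.ybar ≤ z.2) :
    ξ.lump z = ![z.1 - ξ.xbar, z.2 - ξ.ybar] := by
  unfold lump
  by_cases h0 : z ∈ ξ.B₀
  · rw [if_pos h0]
  · have hz : z = (ξ.xbar, ξ.ybar) := by
      by_contra h
      exact h0 ⟨⟨hx, hy⟩, h⟩
    subst hz
    have h1 : (ξ.xbar, ξ.ybar) ∉ ξ.B₁ := fun h => by
      have := h.2.2; simp only [ξ.inv₁_ybar, ξ.ubar_add] at this; exact this.false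
    have h2 : (ξ.xbar, ξ.ybar) ∉ ξ.B₂ := fun h => by
      have := h.2.2; simp only [ξ.inv₂_xbar, ξ.vbar_add] at this; exact this.false
    rw [if_neg h0, if_neg h1, if_neg h2]
    ext k; fin_cases k <;> simp

/-- `lump` tests the regions in a fixed order although `B₀` and `B₁` share the level `ȳ`. There the
two prescriptions agree, and on the curve the lump sum is zero, so the formula extends to the
closure of the region. -/
theorem lump_outer₁ {z : ℝ × ℝ} (hz : z ∈ quadrant) (hy : z.2 ≤ ξ.ybar)
    (hx : ξ.inv₁ z.2 + q.p 0 / q.p 1 * z.2 ≤ z.1) :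
    ξ.lump z = ![z.1 - q.p 0 / q.p 1 * z.2 - ξ.inv₁ z.2, 0] := by
  unfold lump
  by_cases h0 : z ∈ ξ.B₀
  · have hy' : z.2 = ξ.ybar := le_antisymm hy h0.1.2
    rw [if_pos h0, hy', ξ.inv₁_ybar, ← ξ.ubar_add]
    ext k; fin_cases k <;> simp; ring
  · rw [if_neg h0]
    by_cases h1 : z ∈ ξ.B₁
    · rw [if_pos h1]
    · have hx' : z.1 = ξ.inv₁ z.2 + q.p 0 / q.p 1 * z.2 :=
        le_antisymm (not_lt.1 fun h => h1 ⟨hz, hy, h⟩) hx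
      have h2 : z ∉ ξ.B₂ := fun h => by
        have := (ξ.ubar_le_iff z).1 (by linarith [ξ.ubar_le_inv₁ hz hy])
        linarith [ξ.vbar_lt_of_mem_B₂ h]
      rw [if_neg h1, if_neg h2]
      ext k; fin_cases k
      · simp; linarith
      · simp

theorem lump_outer₂ {z : ℝ × ℝ} (hz : z ∈ quadrant) (hx : z.1 ≤ ξ.xbar)
    (hy : ξ.inv₂ z.1 + q.p 1 / q.p 0 * z.1 ≤ z.2) :
    ξ.lump z = ![0, z.2 - q.p 1 / q.p 0 * z.1 - ξ.inv₂ z.1] := by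
  have hv : ξ.vbar ≤ z.2 - q.p 1 / q.p 0 * z.1 := by linarith [ξ.vbar_le_inv₂ hz hx]
  unfold lump
  by_cases h0 : z ∈ ξ.B₀
  · have hx' : z.1 = ξ.xbar := le_antisymm hx h0.1.1
    rw [if_pos h0, hx', ξ.inv₂_xbar, ← ξ.vbar_add]
    ext k; fin_cases k <;> simp; ring
  · have h1 : z ∉ ξ.B₁ := fun h => by
      linarith [(ξ.vbar_le_iff z).1 hv, ξ.ubar_lt_of_mem_B₁ h]
    rw [if_neg h0, if_neg h1]
    by_cases h2 : z ∈ ξ.B₂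
    · rw [if_pos h2]
    · have hy' : z.2 = ξ.inv₂ z.1 + q.p 1 / q.p 0 * z.1 :=
        le_antisymm (not_lt.1 fun h => h2 ⟨hz, hx, h⟩) hy
      rw [if_neg h2]
      ext k; fin_cases k
      · simp
      · simp; linarith

theorem lump_inner₁ {z : ℝ × ℝ} (hz : z ∈ ξ.inner₁) : ξ.lump z = 0 := by
  have hO := ξ.inner₁_subset hz
  obtain ⟨hy, hx⟩ := (ξ.mem_inner₁_iff hO).1 hz
  have h0 : z ∉ ξ.B₀ := fun h => by
    have hy' : z.2 = ξ.ybar := le_antisymm hy h.1.2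
    rw [hy', ξ.inv₁_ybar, ξ.ubar_add] at hx
    exact h.2 (Prod.ext (le_antisymm hx h.1.1) hy')
  have h1 : z ∉ ξ.B₁ := fun h => h.2.2.not_ge hx
  have h2 : z ∉ ξ.B₂ := fun h => by
    linarith [(ξ.ubar_le_iff z).1 hO.2, ξ.vbar_lt_of_mem_B₂ h]
  rw [lump, if_neg h0, if_neg h1, if_neg h2]

theorem lump_inner₂ {z : ℝ × ℝ} (hz : z ∈ ξ.inner₂) : ξ.lump z = 0 := by
  have hO := ξ.inner₂_subset hz
  obtain ⟨hx, hy⟩ := (ξ.mem_inner₂_iff hO).1 hz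
  have h0 : z ∉ ξ.B₀ := fun h => by
    have hx' : z.1 = ξ.xbar := le_antisymm hx h.1.1
    rw [hx', ξ.inv₂_xbar, ξ.vbar_add] at hy
    exact h.2 (Prod.ext hx' (le_antisymm hy h.1.2))
  have h1 : z ∉ ξ.B₁ := fun h => by
    linarith [(ξ.vbar_le_iff z).1 hO.2, ξ.ubar_lt_of_mem_B₁ h]
  have h2 : z ∉ ξ.B₂ := fun h => h.2.2.not_ge hy
  rw [lump, if_neg h0, if_neg h1, if_neg h2]

theorem land_corner {z : ℝ × ℝ} (hx : ξ.xbar ≤ z.1) (hy : ξ.ybar ≤ z.2) :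
    ξ.land z = (ξ.xbar, ξ.ybar) := by
  simp [land, ξ.lump_corner hx hy]

theorem land_outer₁ {z : ℝ × ℝ} (hz : z ∈ quadrant) (hy : z.2 ≤ ξ.ybar)
    (hx : ξ.inv₁ z.2 + q.p 0 / q.p 1 * z.2 ≤ z.1) :
    ξ.land z = (ξ.inv₁ z.2 + q.p 0 / q.p 1 * z.2, z.2) := by
  rw [land, ξ.lump_outer₁ hz hy hx]
  ext <;> simp
  ring

theorem land_outer₂ {z : ℝ × ℝ} (hz : z ∈ quadrant) (hx : z.1 ≤ ξ.xbar)
    (hy : ξ.inv₂ z.1 + q.p 1 / q.p 0 * z.1 ≤ z.2) :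
    ξ.land z = (z.1, ξ.inv₂ z.1 + q.p 1 / q.p 0 * z.1) := by
  rw [land, ξ.lump_outer₂ hz hx hy]
  ext <;> simp
  ring

theorem land_inner₁ {z : ℝ × ℝ} (hz : z ∈ ξ.inner₁) : ξ.land z = z := by
  simp [land, ξ.lump_inner₁ hz]

theorem land_inner₂ {z : ℝ × ℝ} (hz : z ∈ ξ.inner₂) : ξ.land z = z := by
  simp [land, ξ.lump_inner₂ hz]

theorem curve_mem_inner₁ {t : ℝ} (ht : t ∈ Icc 0 ξ.ybar) :
    (ξ.inv₁ t + q.p 0 / q.p 1 * t, t) ∈ ξ.inner₁ := by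
  rw [← ξ.ξ₁_ubar] at ht
  have hg := ξ.side₁.g_mem ht
  have hf := ξ.side₁.f_g ht
  have hq := ξ.quadrant₁ _ hg
  simp only [side₁_g, side₁_f] at hf hq hg
  rw [hf] at hq
  refine ⟨hq, ht.1, ?_, ?_⟩
  · simpa using hg
  · simp [hf]

theorem curve_mem_inner₂ {t : ℝ} (ht : t ∈ Icc 0 ξ.xbar) :
    (t, ξ.inv₂ t + q.p 1 / q.p 0 * t) ∈ ξ.inner₂ := by
  rw [← ξ.ξ₂_vbar] at ht
  have hg := ξ.side₂.g_mem ht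
  have hf := ξ.side₂.f_g ht
  have hq := ξ.quadrant₂ _ hg
  simp only [side₂_g, side₂_f] at hf hq hg
  rw [hf] at hq
  refine ⟨hq, ht.1, ?_, ?_⟩
  · simpa using hg
  · simp [hf]

theorem corner_mem_inner₁ : (ξ.xbar, ξ.ybar) ∈ ξ.inner₁ := by
  have := ξ.curve_mem_inner₁ (right_mem_Icc.2 ξ.ybar_nonneg)
  rwa [ξ.inv₁_ybar, ξ.ubar_add] at this

theorem corner_mem_inner₂ : (ξ.xbar, ξ.ybar) ∈ ξ.inner₂ := by
  have := ξ.curve_mem_inner₂ (right_mem_Icc.2 ξ.xbar_nonneg)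
  rwa [ξ.inv₂_xbar, ξ.vbar_add] at this

/-- Thanks to this, `flow` need only be understood on the two closed inner regions. -/
theorem land_mem {z : ℝ × ℝ} (hz : z ∈ quadrant) : ξ.land z ∈ ξ.inner₁ ∪ ξ.inner₂ := by
  rcases ξ.mem_O₁_or_O₂ hz with h | h
  · rcases ξ.O₁_cases h with h | h | h
    · rw [ξ.land_inner₁ h]; exact Or.inl h
    · rw [ξ.land_outer₁ hz h.1 h.2]; exact Or.inl (ξ.curve_mem_inner₁ ⟨hz.2, h.1⟩)
    · rw [ξ.land_corner h.1 h.2]; exact Or.inl ξ.corner_mem_inner₁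
  · rcases ξ.O₂_cases h with h | h | h
    · rw [ξ.land_inner₂ h]; exact Or.inr h
    · rw [ξ.land_outer₂ hz h.1 h.2]; exact Or.inr (ξ.curve_mem_inner₂ ⟨hz.1, h.1⟩)
    · rw [ξ.land_corner h.1 h.2]; exact Or.inl ξ.corner_mem_inner₁

theorem lump_nonneg {z : ℝ × ℝ} (hz : z ∈ quadrant) (k : Fin 2) : 0 ≤ ξ.lump z k := by
  rcases ξ.mem_O₁_or_O₂ hz with h | h
  · rcases ξ.O₁_cases h with h | h | h
    · simp [ξ.lump_inner₁ h]
    · rw [ξ.lump_outer₁ hz h.1 h.2]; fin_cases k <;> simp; linarith [h.2]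
    · rw [ξ.lump_corner h.1 h.2]; fin_cases k <;> simp [h]
  · rcases ξ.O₂_cases h with h | h | h
    · simp [ξ.lump_inner₂ h]
    · rw [ξ.lump_outer₂ hz h.1 h.2]; fin_cases k <;> simp; linarith [h.2]
    · rw [ξ.lump_corner h.1 h.2]; fin_cases k <;> simp [h]

/-! ### The flow -/

theorem flow_inner₁ {z : ℝ × ℝ} (hz : z ∈ ξ.inner₁) (t : ℝ) :
    ξ.flow z t = ξ.side₁.path (q.p 0) (q.p 1) z t := by
  rw [flow, if_pos (ξ.inner₁_subset hz), DecreasingCurve.path]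
  simp only [side₁_f, side₁_lo, side₁_g, ξ.ξ₁_ubar, ξ.ubar_add]

/-- `flow` tests `O₁` first, so points on the dividing line take the other branch. From them both
branches run straight to the corner and stay there. -/
theorem flow_inner₂ {z : ℝ × ℝ} (hz : z ∈ ξ.inner₂) (t : ℝ) :
    ξ.flow z t = (ξ.side₂.path (q.p 1) (q.p 0) z.swap t).swap := by
  have h0 := q.p_pos 0
  have h1 := q.p_pos 1
  have hO := ξ.inner₂_subset hz
  have hv := (ξ.vbar_le_iff z).1 hO.2
  by_cases h : z ∈ ξ.O₁
  · have hu : z.1 - q.p 0 / q.p 1 * z.2 = ξ.ubar := le_antisymm hv h.2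
    have hv' : z.2 - q.p 1 / q.p 0 * z.1 = ξ.vbar :=
      le_antisymm ((ξ.ubar_le_iff z).1 h.2) hO.2
    rw [flow, if_pos h, DecreasingCurve.path]
    simp only [side₂_f, side₂_lo, side₂_g, ξ.ξ₂_vbar, ξ.vbar_add, Prod.fst_swap, Prod.snd_swap,
      hu, hv', ξ.ξ₁_ubar]
    have e1 : t ≤ (ξ.ybar - z.2) / q.p 1 ↔ z.2 + q.p 1 * t ≤ ξ.ybar := by
      rw [le_div_iff₀ h1]; constructor <;> intro h <;> linarith
    have e2 : t ≤ (ξ.xbar - z.1) / q.p 0 ↔ z.1 + q.p 0 * t ≤ ξ.xbar := by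
      rw [le_div_iff₀ h0]; constructor <;> intro h <;> linarith
    -- On the dividing line the two coordinates reach those of the corner simultaneously.
    have e3 : (ξ.ybar - z.2) / q.p 1 = (ξ.xbar - z.1) / q.p 0 := by
      rw [ubar] at hu
      rw [div_eq_div_iff h1.ne' h0.ne']
      field_simp at hu
      linarith
    simp only [← e1, ← e2, e3]
    split_ifs <;> rfl
  · rw [flow, if_neg h, DecreasingCurve.path]
    simp only [side₂_f, side₂_lo, side₂_g, ξ.ξ₂_vbar, ξ.vbar_add, Prod.fst_swap, Prod.snd_swap]
    split_ifs <;> rfl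

theorem flow_mem {z : ℝ × ℝ} (hz : z ∈ ξ.inner₁ ∪ ξ.inner₂) {t : ℝ} (ht : 0 ≤ t) :
    ξ.flow z t ∈ quadrant := by
  rcases hz with hz | hz
  · rw [ξ.flow_inner₁ hz]
    exact DecreasingCurve.path_nonneg (q.p_pos 0) (q.p_pos 1) ξ.quadrant₁ hz ht
  · rw [ξ.flow_inner₂ hz]
    exact (DecreasingCurve.path_nonneg (q.p_pos 1) (q.p_pos 0) ξ.quadrant₂ hz ht).symm

theorem exists_flow_le : ∃ B, ∀ z ∈ ξ.inner₁ ∪ ξ.inner₂, ∀ t, 0 ≤ t →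
    (ξ.flow z t).1 ≤ B ∧ (ξ.flow z t).2 ≤ B := by
  refine ⟨max (max (ξ.M₁ + q.p 0 / q.p 1 * ξ.ybar) ξ.ybar)
    (max (ξ.M₂ + q.p 1 / q.p 0 * ξ.xbar) ξ.xbar), fun z hz t ht => ?_⟩
  rcases hz with hz | hz
  · rw [ξ.flow_inner₁ hz]
    have := DecreasingCurve.path_le (q.p_pos 0) (q.p_pos 1) hz ht
    simp only [side₁_f, side₁_lo, side₁_hi, ξ.ξ₁_ubar] at this
    exact ⟨le_max_of_le_left (le_max_of_le_left this.1),
      le_max_of_le_left (le_max_of_le_right this.2)⟩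
  · rw [ξ.flow_inner₂ hz]
    have := DecreasingCurve.path_le (q.p_pos 1) (q.p_pos 0) hz ht
    simp only [side₂_f, side₂_lo, side₂_hi, ξ.ξ₂_vbar] at this
    exact ⟨le_max_of_le_right (le_max_of_le_right this.2),
      le_max_of_le_right (le_max_of_le_left this.1)⟩

/-! ### Rates -/

theorem mem_A₁_iff (z : ℝ × ℝ) : z ∈ ξ.A₁ ↔ z.1 - q.p 0 / q.p 1 * z.2 ∈ Ioc ξ.ubar ξ.M₁
    ∧ z.2 = ξ.ξ₁ (z.1 - q.p 0 / q.p 1 * z.2) := by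
  constructor
  · rintro ⟨u, hu, rfl⟩
    simpa using hu
  · rintro ⟨h1, h2⟩
    refine ⟨_, h1, Prod.ext ?_ ?_⟩
    · simp only; rw [← h2]; ring
    · exact h2.symm

theorem mem_A₂_iff (z : ℝ × ℝ) : z ∈ ξ.A₂ ↔ z.2 - q.p 1 / q.p 0 * z.1 ∈ Ioc ξ.vbar ξ.M₂
    ∧ z.1 = ξ.ξ₂ (z.2 - q.p 1 / q.p 0 * z.1) := by
  constructor
  · rintro ⟨u, hu, rfl⟩
    simpa using hu
  · rintro ⟨h1, h2⟩
    refine ⟨_, h1, Prod.ext ?_ ?_⟩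
    · exact h2.symm
    · simp only; rw [← h2]; ring

theorem rate_straight₁ {z : ℝ × ℝ} (hz : z ∈ ξ.inner₁)
    (h : z.2 < ξ.ξ₁ (z.1 - q.p 0 / q.p 1 * z.2)) : ξ.rate z = 0 := by
  have hO := ξ.inner₁_subset hz
  have hle := (ξ.side₁.f_mem hz.2.2.1).2
  have h0 : z ∉ ξ.A₀ := fun h' => by
    rw [mem_singleton_iff.1 h'] at h hle
    simp only [side₁_f, side₁_lo, ξ.ξ₁_ubar] at hle
    linarith
  have h1 : z ∉ ξ.A₁ := fun h' => h.ne ((ξ.mem_A₁_iff z).1 h').2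
  have h2 : z ∉ ξ.A₂ := fun h' => by
    linarith [((ξ.mem_A₂_iff z).1 h').1.1, (ξ.ubar_le_iff z).1 hO.2]
  rw [rate, if_neg h0, if_neg h1, if_neg h2]

theorem rate_straight₂ {z : ℝ × ℝ} (hz : z ∈ ξ.inner₂)
    (h : z.1 < ξ.ξ₂ (z.2 - q.p 1 / q.p 0 * z.1)) : ξ.rate z = 0 := by
  have hO := ξ.inner₂_subset hz
  have hle := (ξ.side₂.f_mem hz.2.2.1).2
  have h0 : z ∉ ξ.A₀ := fun h' => by
    rw [mem_singleton_iff.1 h'] at h hle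
    simp only [side₂_f, side₂_lo, ξ.ξ₂_vbar, Prod.fst_swap, Prod.snd_swap] at hle
    linarith
  have h1 : z ∉ ξ.A₁ := fun h' => by
    linarith [((ξ.mem_A₁_iff z).1 h').1.1, (ξ.vbar_le_iff z).1 hO.2]
  have h2 : z ∉ ξ.A₂ := fun h' => h.ne ((ξ.mem_A₂_iff z).1 h').2
  rw [rate, if_neg h0, if_neg h1, if_neg h2]

/-- The strict inequality keeps the point away from the corner, where `rate` prescribes the full
premiums instead. -/
theorem rate_curve₁ {t : ℝ} (ht0 : 0 ≤ t) (ht : t < ξ.ybar) :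
    ξ.rate (ξ.inv₁ t + q.p 0 / q.p 1 * t, t) = ![-q.p 1 / ξ.dξ₁ (ξ.inv₁ t), 0] := by
  have hm : t ∈ Icc 0 (ξ.side₁.f ξ.side₁.lo) := ⟨ht0, by simpa [ξ.ξ₁_ubar] using ht.le⟩
  have hg := ξ.side₁.g_mem hm
  have hf := ξ.side₁.f_g hm
  simp only [side₁_g, side₁_f, side₁_lo, side₁_hi] at hg hf
  have hne : ξ.inv₁ t ≠ ξ.ubar := fun h => by rw [h, ξ.ξ₁_ubar] at hf; linarith
  have h0 : (ξ.inv₁ t + q.p 0 / q.p 1 * t, t) ∉ ξ.A₀ := fun h' => by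
    have := congrArg Prod.snd (mem_singleton_iff.1 h'); simp only at this; linarith
  have h1 : (ξ.inv₁ t + q.p 0 / q.p 1 * t, t) ∈ ξ.A₁ := by
    rw [mem_A₁_iff]
    simp only [add_sub_cancel_right]
    exact ⟨⟨lt_of_le_of_ne hg.1 hne.symm, hg.2⟩, hf.symm⟩
  rw [rate, if_neg h0, if_pos h1]
  simp

theorem rate_curve₂ {t : ℝ} (ht0 : 0 ≤ t) (ht : t < ξ.xbar) :
    ξ.rate (t, ξ.inv₂ t + q.p 1 / q.p 0 * t) = ![0, -q.p 0 / ξ.dξ₂ (ξ.inv₂ t)] := by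
  have hm : t ∈ Icc 0 (ξ.side₂.f ξ.side₂.lo) := ⟨ht0, by simpa [ξ.ξ₂_vbar] using ht.le⟩
  have hg := ξ.side₂.g_mem hm
  have hf := ξ.side₂.f_g hm
  simp only [side₂_g, side₂_f, side₂_lo, side₂_hi] at hg hf
  have hne : ξ.inv₂ t ≠ ξ.vbar := fun h => by rw [h, ξ.ξ₂_vbar] at hf; linarith
  have h0 : (t, ξ.inv₂ t + q.p 1 / q.p 0 * t) ∉ ξ.A₀ := fun h' => by
    have := congrArg Prod.fst (mem_singleton_iff.1 h'); simp only at this; linarith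
  have h1 : (t, ξ.inv₂ t + q.p 1 / q.p 0 * t) ∉ ξ.A₁ := fun h' => by
    have h := ((ξ.mem_A₁_iff _).1 h').1.1
    have := (ξ.vbar_le_iff (t, ξ.inv₂ t + q.p 1 / q.p 0 * t)).1 (by simpa using hg.1)
    linarith
  have h2 : (t, ξ.inv₂ t + q.p 1 / q.p 0 * t) ∈ ξ.A₂ := by
    rw [mem_A₂_iff]
    simp only [add_sub_cancel_right]
    exact ⟨⟨lt_of_le_of_ne hg.1 hne.symm, hg.2⟩, hf.symm⟩
  rw [rate, if_neg h0, if_neg h1, if_pos h2]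
  simp

theorem rate_corner : ξ.rate (ξ.xbar, ξ.ybar) = q.p := by
  rw [rate, if_pos (show (ξ.xbar, ξ.ybar) ∈ ξ.A₀ from mem_singleton _)]

theorem exists_rate_mem : ∃ B, ∀ z k, ξ.rate z k ∈ Icc 0 B := by
  obtain ⟨ε₁, he₁, h₁⟩ := ξ.side₁.exists_deriv_le
  obtain ⟨ε₂, he₂, h₂⟩ := ξ.side₂.exists_deriv_le
  have p0 := q.p_pos 0
  have p1 := q.p_pos 1
  have b1 : ∀ u ∈ Ioc ξ.ubar ξ.M₁, -q.p 1 / ξ.dξ₁ u ∈ Icc 0 (q.p 1 / ε₁) := fun u hu => by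
    have := h₁ u (Ioc_subset_Icc_self hu)
    simp only [side₁_f'] at this
    rw [show -q.p 1 / ξ.dξ₁ u = q.p 1 / -ξ.dξ₁ u by rw [div_neg, neg_div]]
    exact ⟨div_nonneg p1.le (by linarith), by gcongr; linarith⟩
  have b2 : ∀ u ∈ Ioc ξ.vbar ξ.M₂, -q.p 0 / ξ.dξ₂ u ∈ Icc 0 (q.p 0 / ε₂) := fun u hu => by
    have := h₂ u (Ioc_subset_Icc_self hu)
    simp only [side₂_f'] at this
    rw [show -q.p 0 / ξ.dξ₂ u = q.p 0 / -ξ.dξ₂ u by rw [div_neg, neg_div]]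
    exact ⟨div_nonneg p0.le (by linarith), by gcongr; linarith⟩
  refine ⟨q.p 0 + q.p 1 + q.p 1 / ε₁ + q.p 0 / ε₂, fun z k => ?_⟩
  have e1 : 0 < q.p 1 / ε₁ := by positivity
  have e2 : 0 < q.p 0 / ε₂ := by positivity
  unfold rate
  split_ifs with h0 h1 h2
  · fin_cases k
    · simp only [Fin.zero_eta, mem_Icc]; constructor <;> linarith
    · simp only [Fin.mk_one, mem_Icc]; constructor <;> linarith
  · have := b1 _ ((ξ.mem_A₁_iff z).1 h1).1
    fin_cases k
    · simp only [Fin.zero_eta, Matrix.cons_val_zero, mem_Icc]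
      exact ⟨this.1, by linarith [this.2]⟩
    · simp only [Fin.mk_one, Matrix.cons_val_one, Matrix.cons_val_fin_one, mem_Icc]
      constructor <;> linarith
  · have := b2 _ ((ξ.mem_A₂_iff z).1 h2).1
    fin_cases k
    · simp only [Fin.zero_eta, Matrix.cons_val_zero, mem_Icc]; constructor <;> linarith
    · simp only [Fin.mk_one, Matrix.cons_val_one, Matrix.cons_val_fin_one, mem_Icc]
      exact ⟨this.1, by linarith [this.2]⟩
  · simp only [Pi.zero_apply, mem_Icc]; constructor <;> linarith

/-! ### Measurability -/

theorem measurableSet_quadrant : MeasurableSet quadrant :=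
  (measurableSet_le measurable_const measurable_fst).inter
    (measurableSet_le measurable_const measurable_snd)

theorem measurable_inv₁ : Measurable ξ.inv₁ := ξ.side₁.measurable_g

theorem measurable_inv₂ : Measurable ξ.inv₂ := ξ.side₂.measurable_g

theorem measurableSet_A₁ : MeasurableSet ξ.A₁ := by
  have h := ξ.side₁.continuous_f_clamp.measurable
  have : ξ.A₁ = {z | z.1 - q.p 0 / q.p 1 * z.2 ∈ Ioc ξ.ubar ξ.M₁}
      ∩ {z | z.2 = ξ.ξ₁ (ξ.side₁.clamp (z.1 - q.p 0 / q.p 1 * z.2))} := by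
    ext z
    rw [mem_A₁_iff]
    refine and_congr_right fun hz => ?_
    simp only [mem_ofPred_eq]
    rw [ξ.side₁.clamp_of_mem (Ioc_subset_Icc_self hz)]
  rw [this]
  refine MeasurableSet.inter ?_ (measurableSet_eq_fun measurable_snd ?_)
  · exact (show Measurable fun z : ℝ × ℝ => z.1 - q.p 0 / q.p 1 * z.2 by fun_prop)
      measurableSet_Ioc
  · exact h.comp (f := fun z : ℝ × ℝ => z.1 - q.p 0 / q.p 1 * z.2) (by fun_prop)

theorem measurableSet_A₂ : MeasurableSet ξ.A₂ := by
  have h := ξ.side₂.continuous_f_clamp.measurable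
  have : ξ.A₂ = {z | z.2 - q.p 1 / q.p 0 * z.1 ∈ Ioc ξ.vbar ξ.M₂}
      ∩ {z | z.1 = ξ.ξ₂ (ξ.side₂.clamp (z.2 - q.p 1 / q.p 0 * z.1))} := by
    ext z
    rw [mem_A₂_iff]
    refine and_congr_right fun hz => ?_
    simp only [mem_ofPred_eq]
    rw [ξ.side₂.clamp_of_mem (Ioc_subset_Icc_self hz)]
  rw [this]
  refine MeasurableSet.inter ?_ (measurableSet_eq_fun measurable_fst ?_)
  · exact (show Measurable fun z : ℝ × ℝ => z.2 - q.p 1 / q.p 0 * z.1 by fun_prop)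
      measurableSet_Ioc
  · exact h.comp (f := fun z : ℝ × ℝ => z.2 - q.p 1 / q.p 0 * z.1) (by fun_prop)

theorem measurable_lump : Measurable ξ.lump := by
  have h1 := ξ.measurable_inv₁
  have h2 := ξ.measurable_inv₂
  have vec (f g : ℝ × ℝ → ℝ) (hf : Measurable f) (hg : Measurable g) :
      Measurable fun z => ![f z, g z] := by
    refine measurable_pi_lambda _ fun k => ?_
    fin_cases k <;> simpa
  unfold lump
  refine Measurable.ite ?_ (vec _ _ (by fun_prop) (by fun_prop)) (Measurable.ite ?_
    (vec _ _ (by fun_prop) (by fun_prop)) (Measurable.ite ?_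
    (vec _ _ (by fun_prop) (by fun_prop)) measurable_const))
  · exact (measurableSet_Ici.prod measurableSet_Ici).diff (measurableSet_singleton _)
  · exact measurableSet_quadrant.inter ((measurableSet_le measurable_snd measurable_const).inter
      (measurableSet_lt (f := fun z : ℝ × ℝ => ξ.inv₁ z.2 + q.p 0 / q.p 1 * z.2) (by fun_prop)
        measurable_fst))
  · exact measurableSet_quadrant.inter ((measurableSet_le measurable_fst measurable_const).inter
      (measurableSet_lt (f := fun z : ℝ × ℝ => ξ.inv₂ z.1 + q.p 1 / q.p 0 * z.1) (by fun_prop)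
        measurable_snd))

theorem measurable_land : Measurable ξ.land := by
  have h (k : Fin 2) : Measurable fun z => ξ.lump z k := (measurable_pi_apply k).comp ξ.measurable_lump
  have h0 := h 0
  have h1 := h 1
  unfold land
  fun_prop

theorem measurable_rate (k : Fin 2) : Measurable fun z => ξ.rate z k := by
  classical
  have h1 : Measurable fun z : ℝ × ℝ =>
      ξ.dξ₁ (ξ.side₁.clamp (z.1 - q.p 0 / q.p 1 * z.2)) :=
    ξ.side₁.continuous_f'_clamp.measurable.comp
      (f := fun z : ℝ × ℝ => z.1 - q.p 0 / q.p 1 * z.2) (by fun_prop)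
  have h2 : Measurable fun z : ℝ × ℝ =>
      ξ.dξ₂ (ξ.side₂.clamp (z.2 - q.p 1 / q.p 0 * z.1)) :=
    ξ.side₂.continuous_f'_clamp.measurable.comp
      (f := fun z : ℝ × ℝ => z.2 - q.p 1 / q.p 0 * z.1) (by fun_prop)
  -- On the curves the clamp changes nothing, and with it the derivatives become measurable
  -- functions on the whole plane.
  have : (fun z => ξ.rate z k) = fun z => if z ∈ ξ.A₀ then q.p k
      else if z ∈ ξ.A₁ then
        (if k = 0 then -q.p 1 / ξ.dξ₁ (ξ.side₁.clamp (z.1 - q.p 0 / q.p 1 * z.2)) else 0)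
      else if z ∈ ξ.A₂ then
        (if k = 0 then 0 else -q.p 0 / ξ.dξ₂ (ξ.side₂.clamp (z.2 - q.p 1 / q.p 0 * z.1)))
      else 0 := by
    funext z
    unfold rate
    by_cases h0 : z ∈ ξ.A₀
    · simp only [h0, if_true]
    by_cases h1 : z ∈ ξ.A₁
    · simp only [h0, h1, if_true, if_false]
      rw [ξ.side₁.clamp_of_mem (Ioc_subset_Icc_self ((ξ.mem_A₁_iff z).1 h1).1)]
      fin_cases k <;> simp
    by_cases h2 : z ∈ ξ.A₂
    · simp only [h0, h1, h2, if_true, if_false]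
      rw [ξ.side₂.clamp_of_mem (Ioc_subset_Icc_self ((ξ.mem_A₂_iff z).1 h2).1)]
      fin_cases k <;> simp
    simp [h0, h1, h2]
  rw [this]
  refine Measurable.ite (measurableSet_singleton _) measurable_const
    (Measurable.ite ξ.measurableSet_A₁ ?_ (Measurable.ite ξ.measurableSet_A₂ ?_ measurable_const))
  · split_ifs <;> fun_prop
  · split_ifs <;> fun_prop

theorem measurableSet_O₁ : MeasurableSet ξ.O₁ :=
  measurableSet_quadrant.inter (measurableSet_le measurable_const
    (g := fun z : ℝ × ℝ => z.1 - q.p 0 / q.p 1 * z.2) (by fun_prop))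

open scoped Classical in
/-- The surplus at time `t` before the next claim, from the surplus `z` just after a claim. -/
def motion (z : ℝ × ℝ) (t : ℝ) : ℝ × ℝ :=
  -- The default value lies in the quadrant, so the motion stays there for all arguments and no side
  -- conditions are needed later.
  if z ∈ quadrant ∧ 0 ≤ t then ξ.flow (ξ.land z) t else 0

theorem motion_mem {z : ℝ × ℝ} (t : ℝ) : ξ.motion z t ∈ quadrant := by
  unfold motion
  split_ifs with h
  · exact ξ.flow_mem (ξ.land_mem h.1) h.2
  · exact ⟨le_rfl, le_rfl⟩

theorem measurable_motion : Measurable fun x : (ℝ × ℝ) × ℝ => ξ.motion x.1 x.2 := by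
  classical
  have hl := ξ.measurable_land
  have hlx : Measurable fun x : (ℝ × ℝ) × ℝ => (ξ.land x.1, x.2) := by fun_prop
  have hls : Measurable fun x : (ℝ × ℝ) × ℝ => ((ξ.land x.1).swap, x.2) := by fun_prop
  have h1 := (ξ.side₁.measurable_path_clamp (q.p 0) (q.p 1)).comp hlx
  have h2 := measurable_swap.comp ((ξ.side₂.measurable_path_clamp (q.p 1) (q.p 0)).comp hls)
  have hq : MeasurableSet {x : (ℝ × ℝ) × ℝ | x.1 ∈ quadrant ∧ 0 ≤ x.2} :=
    (measurable_fst measurableSet_quadrant).inter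
      (measurableSet_le measurable_const measurable_snd)
  have hO : MeasurableSet {x : (ℝ × ℝ) × ℝ | ξ.land x.1 ∈ ξ.O₁} :=
    (hl.comp measurable_fst) ξ.measurableSet_O₁
  have hite : Measurable fun x : (ℝ × ℝ) × ℝ => if x.1 ∈ quadrant ∧ 0 ≤ x.2 then
      (if ξ.land x.1 ∈ ξ.O₁ then _ else _) else (0 : ℝ × ℝ) :=
    Measurable.ite hq (Measurable.ite hO h1 h2) measurable_const
  convert hite using 1
  funext x
  unfold motion
  by_cases h : x.1 ∈ quadrant ∧ 0 ≤ x.2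
  · have hm := ξ.land_mem h.1
    simp only [h, and_self, if_true]
    by_cases hO : ξ.land x.1 ∈ ξ.O₁
    · have hin : ξ.land x.1 ∈ ξ.inner₁ := by
        rcases hm with hm | hm
        · exact hm
        -- A point of `inner₂` that also belongs to `O₁` is on the dividing line, and it lies before
        -- the corner, hence in `inner₁`.
        · rw [ξ.mem_inner₁_iff hO]
          have hO2 := ξ.inner₂_subset hm
          obtain ⟨hx, hy⟩ := (ξ.mem_inner₂_iff hO2).1 hm
          have hu := le_antisymm ((ξ.vbar_le_iff _).1 hO2.2) hO.2
          have hy' : (ξ.land x.1).2 ≤ ξ.ybar := by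
            have hv := (ξ.ubar_le_iff _).1 hO.2
            have := mul_le_mul_of_nonneg_left hx (div_pos (q.p_pos 1) (q.p_pos 0)).le
            linarith [ξ.vbar_add]
          refine ⟨hy', ?_⟩
          linarith [ξ.ubar_le_inv₁ hO.1 hy']
      have hc := ξ.side₁.clamp_of_mem hin.2.2.1
      rw [if_pos hO, ξ.flow_inner₁ hin, DecreasingCurve.path]
      simp only [Function.comp, hc]
    · have hin : ξ.land x.1 ∈ ξ.inner₂ := hm.resolve_left fun h => hO (ξ.inner₁_subset h)
      have hc := ξ.side₂.clamp_of_mem hin.2.2.1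
      rw [if_neg hO, ξ.flow_inner₂ hin, DecreasingCurve.path]
      simp only [Function.comp, hc]
  · simp [h]

end CurveStrategy

/-! ### Almost sure behaviour of the claim arrivals -/

open Filter Topology

namespace ClaimModel

variable {q : CollabParams} {Ω : Type*} [MeasurableSpace Ω] {P : Measure Ω}

theorem ae_T_pos (c : ClaimModel q P) : ∀ᵐ ω ∂P, ∀ k i, 0 < c.T k i ω := by
  rw [ae_all_iff]
  intro k
  rw [ae_all_iff]
  intro i
  have h := expMeasure_ae_pos (q.lam k)
  rw [← (c.law_T k i).map_eq] at h
  exact ae_of_ae_map (c.measurable_T k i).aemeasurable h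

/-- By the second Borel–Cantelli lemma infinitely many of the independent waiting times exceed 1, so
their sum diverges. -/
theorem ae_tendsto_arrival (c : ClaimModel q P) (k : Fin 2) :
    ∀ᵐ ω ∂P, Tendsto (fun i => c.arrival k i ω) atTop atTop := by
  have hP : IsProbabilityMeasure P := c.indep.isProbabilityMeasure
  have hm (i : ℕ) : MeasurableSet (c.T k i ⁻¹' Ioi 1) := c.measurable_T k i measurableSet_Ioi
  have hind : iIndepFun (fun i : ℕ => c.T k i) P :=
    c.indep.precomp (g := fun i : ℕ => Sum.inl (k, i)) fun i j h => by simpa using h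
  have hset : iIndepSet (fun i => c.T k i ⁻¹' Ioi 1) P := by
    rw [iIndepSet_iff_meas_biInter hm]
    intro s
    exact hind.measure_inter_preimage_eq_mul s fun _ _ => measurableSet_Ioi
  have hprob (i : ℕ) : P (c.T k i ⁻¹' Ioi 1) = ENNReal.ofReal (Real.exp (-(q.lam k * 1))) := by
    rw [← Measure.map_apply (c.measurable_T k i) measurableSet_Ioi, (c.law_T k i).map_eq,
      ← lintegral_indicator_one measurableSet_Ioi,
      lintegral_expMeasure _ (measurable_one.indicator measurableSet_Ioi),
      ← lintegral_exp_Ioi (q.lam_pos k), ← lintegral_indicator measurableSet_Ioi,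
      ← lintegral_indicator measurableSet_Ioi]
    refine lintegral_congr fun x => ?_
    by_cases hx : 1 < x
    · have : 0 < x := by linarith
      simp [indicator, hx, this]
    · simp [indicator, hx]
  have hlim := measure_limsup_eq_one hm hset (by
    simp_rw [hprob]
    exact ENNReal.tsum_const_eq_top_of_ne_zero (by simpa using Real.exp_pos _))
  have hae : ∀ᵐ ω ∂P, ω ∈ limsup (fun i => c.T k i ⁻¹' Ioi 1) atTop := by
    rw [← prob_compl_eq_zero_iff (MeasurableSet.measurableSet_limsup hm)] at hlim
    exact hlim
  filter_upwards [hae, c.ae_T_pos] with ω h hpos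
  rw [mem_limsup_iff_frequently_mem] at h
  have hns : ¬ Summable fun i => c.T k i ω := fun hs => by
    have := hs.tendsto_atTop_zero.eventually (gt_mem_nhds (zero_lt_one' ℝ))
    obtain ⟨i, hi1, hi2⟩ := (h.and_eventually this).exists
    exact absurd hi1 (not_lt.2 hi2.le)
  rw [not_summable_iff_tendsto_nat_atTop_of_nonneg fun i => (hpos k i).le] at hns
  exact hns.comp (tendsto_add_atTop_nat 1)

theorem arrival_pos (c : ClaimModel q P) {ω : Ω} (h : ∀ k i, 0 < c.T k i ω) (k : Fin 2) (i : ℕ) :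
    0 < c.arrival k i ω :=
  Finset.sum_pos (fun j _ => h k j) ⟨0, by simp⟩

theorem surplus_le (c : ClaimModel q P) (k : Fin 2) (x : ℝ) (t : ℝ≥0) (ω : Ω) :
    c.surplus k x t ω ≤ x + q.p k * t :=
  sub_le_self _ ENNReal.toReal_nonneg

/-- The free surplus processes for different initial levels generate the same filtration. -/
theorem filtration_eq (c : ClaimModel q P) (k : Fin 2) (x y : ℝ) :
    c.filtration k x = c.filtration k y := by
  have key (x y : ℝ) (t : ℝ≥0) : MeasurableSpace.comap (c.surplus k x t) inferInstance
      ≤ MeasurableSpace.comap (c.surplus k y t) inferInstance := by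
    rw [← measurable_iff_comap_le]
    have : c.surplus k x t = fun ω => c.surplus k y t ω + (x - y) := by
      funext ω; simp only [surplus]; ring
    rw [this]
    exact (comap_measurable _).add_const _
  refine Filtration.ext (funext fun t => ?_)
  exact le_antisymm (iSup₂_mono fun s _ => key x y s) (iSup₂_mono fun s _ => key y x s)

end ClaimModel

/-! ### Finiteness and monotonicity of the stand-alone value functions -/

namespace SoloStrategy

variable {q : CollabParams} {Ω : Type*} [MeasurableSpace Ω] {P : Measure Ω}
  {c : ClaimModel q P} {k : Fin 2} {x : ℝ} (S : SoloStrategy c k x)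

/-- Through `toNNReal` the accumulated dividends are extended by `L 0 = 0` to negative times, so the
Stieltjes measure gives time 0 exactly the lump sum paid immediately after it. -/
theorem leftLim_zero (ω : Ω) : Function.leftLim (S.mono_real ω).stieltjesFunction 0 = 0 := by
  refine leftLim_eq_of_tendsto ?_
  refine tendsto_const_nhds.congr' ?_
  filter_upwards [self_mem_nhdsWithin] with t (ht : t < 0)
  rw [Monotone.stieltjesFunction_eq]
  symm
  refine rightLim_eq_of_tendsto (tendsto_const_nhds.congr' ?_)
  filter_upwards [mem_nhdsWithin_of_mem_nhds (Iio_mem_nhds ht)] with s (hs : s < 0)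
  simp [Real.toNNReal_of_nonpos hs.le, S.L_zero]

/-- Before ruin the accumulated dividends, including those paid right afterwards, are bounded by
the premiums. -/
theorem stieltjes_le {ω : Ω} (hpos : ∀ k i, 0 < c.T k i ω)
    (harr : Tendsto (fun i => c.arrival k i ω) atTop atTop)
    (hle : ∀ t : ℝ≥0, (∀ i, c.arrival k i ω ≤ t → 0 ≤ c.surplus k x (c.arrival k i ω).toNNReal ω
      - S.L (c.arrival k i ω).toNNReal ω) → S.L t ω ≤ c.surplus k x t ω)
    {s : ℝ} (hs : s ∈ S.beforeRuin ω) :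
    (S.mono_real ω).stieltjesFunction s ≤ x + q.p k * s := by
  -- there is no claim shortly after `s`
  have hev : ∀ᶠ r in 𝓝[>] s, ∀ i, c.arrival k i ω ≤ r → c.arrival k i ω ≤ s := by
    -- Arrivals with index at least `N` are later than `s + 1`, so only finitely many have to be
    -- avoided.
    obtain ⟨N, hN⟩ := (harr.eventually (eventually_gt_atTop (s + 1))).exists_forall_of_atTop
    have h1 : ∀ᶠ r in 𝓝[>] s, ∀ i ∈ Finset.range N, c.arrival k i ω ≤ r → c.arrival k i ω ≤ s := by
      rw [eventually_all_finset]
      intro i _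
      by_cases h : c.arrival k i ω ≤ s
      · exact Eventually.of_forall fun _ _ => h
      · filter_upwards [mem_nhdsWithin_of_mem_nhds (Iio_mem_nhds (not_le.1 h))] with r hr hr'
        exact absurd hr' (not_le.2 hr)
    filter_upwards [h1, mem_nhdsWithin_of_mem_nhds (Iio_mem_nhds (lt_add_one s))] with r hr hr1 i hi
    by_cases h : i < N
    · exact hr i (Finset.mem_range.2 h) hi
    · exact absurd (hN i (not_lt.1 h)) (not_lt.2 (hi.trans (le_of_lt hr1)))
  -- The Stieltjes function at `s` is a right limit, hence at most `L r` for `r > s`. For `r` close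
  -- to `s` every claim up to `r` has been survived by time `s`, so admissibility applies at `r`.
  have hbound : ∀ᶠ r in 𝓝[>] s, (S.mono_real ω).stieltjesFunction s ≤ x + q.p k * r := by
    filter_upwards [hev, self_mem_nhdsWithin] with r hr (hsr : s < r)
    have hr0 : 0 ≤ r := hs.1.trans hsr.le
    rw [Monotone.stieltjesFunction_eq]
    refine ((S.mono_real ω).rightLim_le hsr).trans ?_
    have h1 : S.L r.toNNReal ω ≤ c.surplus k x r.toNNReal ω := by
      refine hle _ fun i hi => ?_
      rw [Real.coe_toNNReal _ hr0] at hi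
      refine hs.2 _ ?_
      rw [Real.coe_toNNReal _ (c.arrival_pos hpos k i).le]
      exact hr i hi
    have h2 := c.surplus_le k x r.toNNReal ω
    rw [Real.coe_toNNReal _ hr0] at h2
    exact h1.trans h2
  have hlim : Tendsto (fun r => x + q.p k * r) (𝓝[>] s) (𝓝 (x + q.p k * s)) :=
    (Continuous.tendsto (by fun_prop) s).mono_left nhdsWithin_le_nhds
  exact ge_of_tendsto hlim hbound

theorem mem_beforeRuin_mono {ω : Ω} {r s : ℝ} (hr : 0 ≤ r) (hrs : r ≤ s)
    (hs : s ∈ S.beforeRuin ω) : r ∈ S.beforeRuin ω :=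
  ⟨hr, fun t ht => hs.2 t (ht.trans hrs)⟩

theorem measurableSet_beforeRuin (ω : Ω) : MeasurableSet (S.beforeRuin ω) := by
  refine OrdConnected.measurableSet ⟨fun a ha b hb r hr => ?_⟩
  exact S.mem_beforeRuin_mono (ha.1.trans hr.1) hr.2 hb

/-- The dividends paid before ruin up to time `t` are bounded by the premiums. -/
theorem measure_beforeRuin_le {ω : Ω} (hpos : ∀ k i, 0 < c.T k i ω)
    (harr : Tendsto (fun i => c.arrival k i ω) atTop atTop)
    (hle : ∀ t : ℝ≥0, (∀ i, c.arrival k i ω ≤ t → 0 ≤ c.surplus k x (c.arrival k i ω).toNNReal ω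
      - S.L (c.arrival k i ω).toNNReal ω) → S.L t ω ≤ c.surplus k x t ω) {t : ℝ} :
    (S.mono_real ω).stieltjesFunction.measure (S.beforeRuin ω ∩ Iio t)
      ≤ ENNReal.ofReal (x + q.p k * t) := by
  set g := (S.mono_real ω).stieltjesFunction with hg
  have hp := q.p_pos k
  rcases (S.beforeRuin ω ∩ Iio t).eq_empty_or_nonempty with he | hne
  · simp [he]
  have hbdd : BddAbove (S.beforeRuin ω ∩ Iio t) := ⟨t, fun s hs => le_of_lt hs.2⟩
  set σ := sSup (S.beforeRuin ω ∩ Iio t) with hσ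
  have hσt : σ ≤ t := csSup_le hne fun s hs => le_of_lt hs.2
  -- If the supremum belongs to the set, the mass at `σ` is counted and the bound at `σ` is
  -- available. Otherwise only the left limit matters, and it is bounded through earlier times.
  by_cases hmem : σ ∈ S.beforeRuin ω
  · have hsub : S.beforeRuin ω ∩ Iio t ⊆ Icc 0 σ := fun s hs => ⟨hs.1.1, le_csSup hbdd hs⟩
    refine (measure_mono hsub).trans ?_
    rw [StieltjesFunction.measure_Icc, S.leftLim_zero, sub_zero]
    refine ENNReal.ofReal_le_ofReal ((S.stieltjes_le hpos harr hle hmem).trans ?_)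
    gcongr
  · have hsub : S.beforeRuin ω ∩ Iio t ⊆ Ico 0 σ := fun s hs =>
      ⟨hs.1.1, lt_of_le_of_ne (le_csSup hbdd hs) fun h => hmem (h ▸ hs.1)⟩
    refine (measure_mono hsub).trans ?_
    rw [StieltjesFunction.measure_Ico, S.leftLim_zero, sub_zero]
    refine ENNReal.ofReal_le_ofReal ?_
    refine le_of_tendsto (g.mono.tendsto_leftLim σ) ?_
    filter_upwards [self_mem_nhdsWithin] with r (hr : r < σ)
    obtain ⟨b, hb, hrb⟩ := exists_lt_of_lt_csSup hne hr
    have hbt : b ≤ t := le_of_lt hb.2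
    calc g r ≤ g b := g.mono hrb.le
      _ ≤ x + q.p k * b := S.stieltjes_le hpos harr hle hb.1
      _ ≤ x + q.p k * t := by gcongr

/-- The expected discounted dividends are bounded, uniformly over all strategies. -/
theorem value_le (hx : 0 ≤ x) :
    S.value ≤ ENNReal.ofReal (2 * (x + q.p k * (2 / q.δ))) := by
  have hP : IsProbabilityMeasure P := c.indep.isProbabilityMeasure
  have hδ := q.δ_pos
  have hp := q.p_pos k
  suffices h : ∀ᵐ ω ∂P, ∫⁻ s in S.beforeRuin ω, ENNReal.ofReal (Real.exp (-q.δ * s))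
      ∂(S.mono_real ω).stieltjesFunction.measure ≤ ENNReal.ofReal (2 * (x + q.p k * (2 / q.δ))) by
    refine (lintegral_mono_ae h).trans ?_
    simp
  filter_upwards [c.ae_T_pos, c.ae_tendsto_arrival k, S.le_surplus] with ω hpos harr hle
  set ν := (S.mono_real ω).stieltjesFunction.measure
  have hB := S.measurableSet_beforeRuin ω
  -- Writing the discount as an integral over later times turns discounted dividends into a
  -- discounted integral of accumulated dividends, which the premiums bound.
  have e1 (s : ℝ) (hs : s ∈ S.beforeRuin ω) : ENNReal.ofReal (Real.exp (-q.δ * s))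
      = ∫⁻ t in Ioi 0, (if s < t then ENNReal.ofReal (q.δ * Real.exp (-(q.δ * t))) else 0) := by
    rw [neg_mul, ← lintegral_exp_Ioi hδ, ← lintegral_indicator measurableSet_Ioi,
      ← lintegral_indicator measurableSet_Ioi]
    refine lintegral_congr fun t => ?_
    by_cases h : s < t
    · simp [indicator, h, hs.1.trans_lt h]
    · simp [indicator, h]
  calc _ = ∫⁻ s in S.beforeRuin ω, (∫⁻ t in Ioi 0,
        (if s < t then ENNReal.ofReal (q.δ * Real.exp (-(q.δ * t))) else 0)) ∂ν :=
        setLIntegral_congr_fun hB e1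
    _ = ∫⁻ t in Ioi 0, ∫⁻ s in S.beforeRuin ω,
        (if s < t then ENNReal.ofReal (q.δ * Real.exp (-(q.δ * t))) else 0) ∂ν := by
        rw [lintegral_lintegral_swap]
        refine Measurable.aemeasurable ?_
        exact Measurable.ite (measurableSet_lt (by fun_prop) (by fun_prop)) (by fun_prop)
          measurable_const
    _ ≤ ∫⁻ t in Ioi 0, ENNReal.ofReal (2 * (x + q.p k * (2 / q.δ)))
          * ENNReal.ofReal (q.δ / 2 * Real.exp (-(q.δ / 2 * t))) := by
        refine setLIntegral_mono (by fun_prop) fun t (ht : 0 < t) => ?_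
        have e2 : ∫⁻ s in S.beforeRuin ω,
            (if s < t then ENNReal.ofReal (q.δ * Real.exp (-(q.δ * t))) else 0) ∂ν
            = ENNReal.ofReal (q.δ * Real.exp (-(q.δ * t))) * ν (S.beforeRuin ω ∩ Iio t) := by
          have : (fun s => if s < t then ENNReal.ofReal (q.δ * Real.exp (-(q.δ * t))) else 0)
              = (Iio t).indicator fun _ => ENNReal.ofReal (q.δ * Real.exp (-(q.δ * t))) := by
            funext s; simp [indicator]
          rw [this, lintegral_indicator_const measurableSet_Iio,
            Measure.restrict_apply measurableSet_Iio, inter_comm]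
        rw [e2]
        refine (mul_le_mul_right (S.measure_beforeRuin_le hpos harr hle) _).trans ?_
        rw [← ENNReal.ofReal_mul (by positivity), ← ENNReal.ofReal_mul (by positivity)]
        refine ENNReal.ofReal_le_ofReal ?_
        have hexp : Real.exp (-(q.δ * t))
            = Real.exp (-(q.δ / 2 * t)) * Real.exp (-(q.δ / 2 * t)) := by
          rw [← Real.exp_add]; congr 1; ring
        -- Half of the discount absorbs the linear growth; the other half keeps the integral finite
        -- and accounts for the factor 2.
        have hsmall : (x + q.p k * t) * Real.exp (-(q.δ / 2 * t)) ≤ x + q.p k * (2 / q.δ) := by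
          rw [Real.exp_neg, ← div_eq_mul_inv, div_le_iff₀ (Real.exp_pos _)]
          have h1 := Real.add_one_le_exp (q.δ / 2 * t)
          have h2 : 1 ≤ Real.exp (q.δ / 2 * t) := Real.one_le_exp (by positivity)
          have h3 : q.p k * t ≤ q.p k * (2 / q.δ) * Real.exp (q.δ / 2 * t) := by
            rw [mul_assoc]
            gcongr
            rw [div_mul_eq_mul_div, le_div_iff₀ hδ]
            linarith
          nlinarith
        rw [hexp]
        have := mul_le_mul_of_nonneg_left hsmall
          (mul_nonneg hδ.le (Real.exp_pos (-(q.δ / 2 * t))).le)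
        linarith
    _ = ENNReal.ofReal (2 * (x + q.p k * (2 / q.δ))) := by
        rw [lintegral_const_mul _ (by fun_prop), lintegral_exp_Ioi (by positivity)]
        simp

/-- The strategy that pays the additional initial surplus `d` immediately. -/
def payFirst {d : ℝ} (hd : 0 ≤ d) : SoloStrategy c k (x + d) where
  -- The jump sits just after time 0: the process must be left-continuous and vanish at 0.
  L t ω := S.L t ω + if 0 < t then d else 0
  L_zero ω := by simp [S.L_zero]
  mono ω := by
    intro s t hst
    refine add_le_add (S.mono ω hst) ?_
    by_cases hs : 0 < s
    · simp [hs, hs.trans_le hst]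
    · simp only [hs, if_false]
      split_ifs <;> simp [hd]
  leftCont ω t := by
    refine (S.leftCont ω t).add ?_
    rcases eq_or_lt_of_le (zero_le : 0 ≤ t) with rfl | ht
    · have : Iic (0 : ℝ≥0) = {0} := by ext; simp
      rw [this]
      exact continuousWithinAt_singleton
    · refine ContinuousAt.continuousWithinAt ?_
      refine continuousAt_const.congr (f := fun _ => d) ?_
      filter_upwards [Ioi_mem_nhds ht] with s hs
      simp [show 0 < s from hs]
  predictable := by
    rw [c.filtration_eq k (x + d) x]
    refine StronglyMeasurable.add S.predictable ?_
    have hset : MeasurableSet[(c.filtration k x).predictable] (Ioi (0 : ℝ≥0) ×ˢ (univ : Set Ω)) :=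
      measurableSet_predictable_Ioi_prod MeasurableSet.univ
    have hstep := StronglyMeasurable.indicator (stronglyMeasurable_const (b := d)) hset
    convert hstep using 1
    funext y
    simp [indicator]
  le_surplus := by
    filter_upwards [S.le_surplus, c.ae_T_pos] with ω h hpos t ht
    have hadd (s : ℝ≥0) : c.surplus k (x + d) s ω = c.surplus k x s ω + d := by
      simp only [ClaimModel.surplus]; ring
    -- Claims arrive at positive times, when `d` has already been paid out, so at claim times the
    -- controlled surplus is that of the original strategy.
    have h1 := h t fun i hi => by
      have h2 := ht i hi
      have h3 : 0 < (c.arrival k i ω).toNNReal := Real.toNNReal_pos.2 (c.arrival_pos hpos k i)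
      rw [hadd, if_pos h3] at h2
      linarith
    rw [hadd]
    split_ifs <;> linarith

/-- The additional payment never exceeds the additional surplus, so the times before ruin are kept,
and the dividend measure only gains mass. -/
theorem value_le_payFirst {d : ℝ} (hd : 0 ≤ d) : S.value ≤ (S.payFirst hd).value := by
  refine lintegral_mono fun ω => ?_
  have hadd (s : ℝ≥0) : c.surplus k (x + d) s ω = c.surplus k x s ω + d := by
    simp only [ClaimModel.surplus]; ring
  refine lintegral_mono' (Measure.restrict_mono ?_ ?_) le_rfl
  · rintro s ⟨hs, h⟩
    refine ⟨hs, fun r hr => ?_⟩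
    have := h r hr
    rw [hadd]
    simp only [payFirst]
    split_ifs <;> linarith
  · have hstep : Monotone fun t : ℝ => if 0 < t.toNNReal then d else 0 := by
      intro s t hst
      simp only [Real.toNNReal_pos]
      split_ifs with h1 h2
      · exact le_rfl
      · linarith
      · exact hd
      · exact le_rfl
    have : ((S.payFirst hd).mono_real ω).stieltjesFunction
        = (S.mono_real ω).stieltjesFunction + hstep.stieltjesFunction := by
      ext t
      rw [StieltjesFunction.add_apply]
      simp only [Monotone.stieltjesFunction_eq]
      exact rightLim_eq_of_tendsto
        (((S.mono_real ω).tendsto_rightLim t).add (hstep.tendsto_rightLim t))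
    rw [this, StieltjesFunction.measure_add]
    exact Measure.le_add_right le_rfl

end SoloStrategy

section SoloValue

variable {q : CollabParams} {Ω : Type*} [MeasurableSpace Ω] {P : Measure Ω}
  (c : ClaimModel q P) (k : Fin 2)

theorem iSup_value_lt_top {x : ℝ} (hx : 0 ≤ x) : ⨆ S : SoloStrategy c k x, S.value < ∞ :=
  lt_of_le_of_lt (iSup_le fun S => S.value_le hx) ENNReal.ofReal_lt_top

theorem soloValue_nonneg (x : ℝ) : 0 ≤ soloValue c k x := by
  unfold soloValue
  split_ifs
  · exact le_rfl
  · exact ENNReal.toReal_nonneg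

theorem soloValue_of_neg {x : ℝ} (hx : x < 0) : soloValue c k x = 0 := if_pos hx

/-- Monotonicity is the only regularity of the stand-alone value used later: it yields
measurability, local bounds and at most countably many discontinuities. The finiteness of the
supremum is needed for `toReal` to preserve the order. -/
theorem monotone_soloValue : Monotone (soloValue c k) := by
  intro x y hxy
  by_cases hx : x < 0
  · rw [soloValue_of_neg c k hx]; exact soloValue_nonneg c k y
  have hx0 := not_lt.1 hx
  rw [soloValue, soloValue, if_neg hx, if_neg (not_lt.2 (hx0.trans hxy))]
  refine ENNReal.toReal_mono (iSup_value_lt_top c k (hx0.trans hxy)).ne (iSup_le fun S => ?_)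
  obtain ⟨d, rfl⟩ : ∃ d, y = x + d := ⟨y - x, by ring⟩
  have hd : 0 ≤ d := by linarith
  exact (S.value_le_payFirst hd).trans (le_iSup (fun S : SoloStrategy c k (x + d) => S.value) _)

theorem measurable_soloValue : Measurable (soloValue c k) := (monotone_soloValue c k).measurable

end SoloValue

/-! ### The pathwise payoff of the curve strategy and its expectation -/

theorem cover_sum (z : ℝ × ℝ) : (cover z).1 + (cover z).2 = z.1 + z.2 := by
  unfold cover
  split_ifs <;> simp

theorem cover_mem {z : ℝ × ℝ} (hz : 0 ≤ z.1 + z.2) : cover z ∈ CurveStrategy.quadrant := by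
  unfold cover
  rw [if_neg (not_lt.2 hz)]
  split_ifs with h1 h2
  · exact ⟨le_rfl, hz⟩
  · exact ⟨hz, le_rfl⟩
  · exact ⟨not_lt.1 h1, not_lt.1 h2⟩

/-- Transfers conserve the total surplus, so survival may be tested after the transfer, and then
both companies are solvent. -/
theorem claimPos_mem {k : Fin 2} {z : ℝ × ℝ} {α : ℝ}
    (h : 0 ≤ (claimPos k z α).1 + (claimPos k z α).2) :
    claimPos k z α ∈ CurveStrategy.quadrant := by
  rw [claimPos, cover_sum] at h
  exact cover_mem h

namespace CurveStrategy

variable {q : CollabParams} {Ω : Type*} [MeasurableSpace Ω] {P : Measure Ω}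
  (ξ : CurveStrategy q) (c : ClaimModel q P)

/-- The dynamics between two claims under the curve strategy. -/
def control : PeriodControl where
  Z := ξ.motion
  ℓ z := ∑ k, ENNReal.ofReal (q.a k) * ENNReal.ofReal (ξ.lump z k)
  ρ z s := ∑ k, ENNReal.ofReal (q.a k) * ENNReal.ofReal (ξ.rate (ξ.motion z s) k)
  R z := ∑ k, ENNReal.ofReal (q.a k) * ENNReal.ofReal (soloValue c k (![z.1, z.2] k))
  measurable_Z := ξ.measurable_motion
  measurable_ℓ := Finset.measurable_sum _ fun k _ =>
    (((measurable_pi_apply k).comp ξ.measurable_lump).ennreal_ofReal).const_mul _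
  measurable_ρ := Finset.measurable_sum _ fun k _ =>
    (((ξ.measurable_rate k).comp ξ.measurable_motion).ennreal_ofReal).const_mul _
  measurable_R := by
    refine Finset.measurable_sum _ fun k _ => Measurable.const_mul ?_ _
    refine ((measurable_soloValue c k).comp ?_).ennreal_ofReal
    fin_cases k
    · exact measurable_fst
    · exact measurable_snd

/-- The claim data seen from the situation `s`. -/
def dataAt (ω : Ω) (s : ClaimState) : ClaimData :=
  Sum.elim (fun j => if j.2 = 0 then c.arrival j.1 (s.count j.1) ω - s.time
      else c.T j.1 (s.count j.1 + j.2) ω)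
    (fun j => c.U j.1 (s.count j.1 + j.2) ω)

variable {ξ c}

theorem nextTime_eq (ω : Ω) (s : ClaimState) :
    nextTime c ω s = s.time + (dataAt c ω s).firstTime := by
  simp only [nextTime, dataAt, ClaimData.firstTime, Sum.elim_inl, if_true]
  rw [min_sub_sub_right]
  ring

theorem first_dataAt (ω : Ω) (s : ClaimState) : (dataAt c ω s).first
    = if c.arrival 0 (s.count 0) ω ≤ c.arrival 1 (s.count 1) ω then 0 else 1 := by
  simp [dataAt, ClaimData.first]

theorem nextState_time {ω : Ω} {s : ClaimState} (hs : 0 ≤ s.pos.1 + s.pos.2) :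
    (ξ.nextState c ω s).time = s.time + (dataAt c ω s).firstTime := by
  rw [nextState, if_neg (not_lt.2 hs), ← nextTime_eq]
  split_ifs <;> rfl

theorem nextState_pos {ω : Ω} {s : ClaimState} (hs : 0 ≤ s.pos.1 + s.pos.2) :
    (ξ.nextState c ω s).pos = claimPos (dataAt c ω s).first
      (ξ.flow (ξ.land s.pos) (dataAt c ω s).firstTime)
      (dataAt c ω s (.inr ((dataAt c ω s).first, 0))) := by
  have hb : ξ.between s (nextTime c ω s) = ξ.flow (ξ.land s.pos) (dataAt c ω s).firstTime := by
    rw [between, nextTime_eq, add_sub_cancel_left]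
  rw [nextState, if_neg (not_lt.2 hs), first_dataAt, hb]
  split_ifs <;> simp [claimPos, dataAt]

/-- The clock of the claiming company restarts with a fresh waiting time, while the residual time of
the other one drops by the elapsed time. This identifies the path recursion with the recursion in
`payoff`. -/
theorem nextState_data {ω : Ω} {s : ClaimState} (hs : 0 ≤ s.pos.1 + s.pos.2) :
    dataAt c ω (ξ.nextState c ω s) = ClaimData.shift (dataAt c ω s).first (dataAt c ω s) := by
  have arr (k : Fin 2) (n : ℕ) : c.arrival k (n + 1) ω = c.arrival k n ω + c.T k (n + 1) ω := by
    rw [ClaimModel.arrival, Finset.sum_range_succ]; rfl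
  rw [nextState, if_neg (not_lt.2 hs), first_dataAt]
  split_ifs with h
  · funext i
    rcases i with ⟨i, j⟩ | ⟨i, j⟩ <;> fin_cases i <;> rcases j with _ | j <;>
      simp [dataAt, ClaimData.shift, ClaimData.shiftIndex, nextTime, h, arr, Function.update,
        add_assoc, add_comm 1]
  · have h' := (not_le.1 h).le
    funext i
    rcases i with ⟨i, j⟩ | ⟨i, j⟩ <;> fin_cases i <;> rcases j with _ | j <;>
      simp [dataAt, ClaimData.shift, ClaimData.shiftIndex, nextTime, h', arr, Function.update,
        add_assoc, add_comm 1]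

/-- The facts about the situation after each claim that hold along almost every path. -/
theorem state_spec {ω : Ω} (hpos : ∀ k i, 0 < c.T k i ω) {z : ℝ × ℝ} (hz : z ∈ quadrant) (n : ℕ) :
    (ξ.alive c z ω n → (ξ.state c z ω n).pos ∈ quadrant)
      ∧ ∀ k, (ξ.state c z ω n).time ≤ c.arrival k ((ξ.state c z ω n).count k) ω := by
  have arr (k : Fin 2) (n : ℕ) : c.arrival k (n + 1) ω = c.arrival k n ω + c.T k (n + 1) ω := by
    rw [ClaimModel.arrival, Finset.sum_range_succ]; rfl
  induction n with
  | zero => exact ⟨fun _ => hz, fun k => (c.arrival_pos hpos k _).le⟩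
  | succ n ih =>
    set s := ξ.state c z ω n with hs
    have hstep : ξ.state c z ω (n + 1) = ξ.nextState c ω s := rfl
    by_cases ha : 0 ≤ s.pos.1 + s.pos.2
    · refine ⟨fun h => ?_, fun k => ?_⟩
      · rw [alive, hstep, nextState_pos ha] at h
        rw [hstep, nextState_pos ha]
        exact claimPos_mem h
      · rw [hstep, nextState, if_neg (not_lt.2 ha)]
        split_ifs with h
        · fin_cases k
          · simp only [nextTime, h, min_eq_left, Fin.zero_eta, Matrix.cons_val_zero, arr]
            linarith [hpos 0 (s.count 0 + 1)]
          · simp [nextTime, h]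
        · fin_cases k
          · simp [nextTime, (not_le.1 h).le]
          · simp only [nextTime, (not_le.1 h).le, min_eq_right, Fin.mk_one, Matrix.cons_val_one,
              Matrix.cons_val_fin_one, arr]
            linarith [hpos 1 (s.count 1 + 1)]
    · rw [hstep, nextState, if_pos (not_le.1 ha)]
      refine ⟨fun h => ?_, ih.2⟩
      rw [alive, hstep, nextState, if_pos (not_le.1 ha)] at h
      exact absurd h ha

theorem firstTime_nonneg {ω : Ω} (hpos : ∀ k i, 0 < c.T k i ω) {z : ℝ × ℝ} (hz : z ∈ quadrant)
    (n : ℕ) : 0 ≤ (dataAt c ω (ξ.state c z ω n)).firstTime := by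
  have h := (state_spec (ξ := ξ) hpos hz n).2
  simp only [dataAt, ClaimData.firstTime, Sum.elim_inl, if_true, le_min_iff, sub_nonneg]
  exact ⟨h 0, h 1⟩

open scoped Classical in
variable (ξ c) in
/-- The discounted payoff of company `k` in the period between the claims `n` and `n + 1`,
including the terminal payoff in case of ruin at the end of the period. -/
def periodPayoff (z : ℝ × ℝ) (ω : Ω) (k : Fin 2) (n : ℕ) : ℝ≥0∞ :=
  (if ξ.alive c z ω n then
    ENNReal.ofReal (ξ.lump (ξ.state c z ω n).pos k)
        * ENNReal.ofReal (Real.exp (-q.δ * (ξ.state c z ω n).time))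
      + ∫⁻ s in Ico (ξ.state c z ω n).time (ξ.state c z ω (n + 1)).time,
          ENNReal.ofReal (Real.exp (-q.δ * s))
            * ENNReal.ofReal (ξ.rate (ξ.between (ξ.state c z ω n) s) k)
    else 0)
  + if ξ.alive c z ω n ∧ ¬ ξ.alive c z ω (n + 1) then
      ENNReal.ofReal (Real.exp (-q.δ * (ξ.state c z ω (n + 1)).time)
        * soloValue c k (![(ξ.state c z ω (n + 1)).pos.1, (ξ.state c z ω (n + 1)).pos.2] k))
    else 0

theorem between_eq_motion {z : ℝ × ℝ} {ω : Ω} {n : ℕ} (hq : (ξ.state c z ω n).pos ∈ quadrant)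
    {s : ℝ} (hs : (ξ.state c z ω n).time ≤ s) :
    ξ.between (ξ.state c z ω n) s
      = ξ.motion (ξ.state c z ω n).pos (s - (ξ.state c z ω n).time) := by
  rw [between, motion, if_pos ⟨hq, by linarith⟩]

theorem lintegral_dividends_add_terminal {ω : Ω} (hpos : ∀ k i, 0 < c.T k i ω) {z : ℝ × ℝ}
    (hz : z ∈ quadrant) (k : Fin 2) :
    ∫⁻ s, ENNReal.ofReal (Real.exp (-q.δ * s)) ∂(ξ.dividends c z k ω) + ξ.terminal c z k ω
      = ∑' n, ξ.periodPayoff c z ω k n := by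
  simp only [periodPayoff]
  rw [ENNReal.tsum_add, dividends, terminal, lintegral_sum_measure]
  congr 1
  refine tsum_congr fun n => ?_
  by_cases h : ξ.alive c z ω n
  · have hq := (state_spec (ξ := ξ) hpos hz n).1 h
    rw [if_pos h, if_pos h, lintegral_add_measure, lintegral_smul_measure, lintegral_dirac,
      smul_eq_mul]
    congr 1
    rw [lintegral_withDensity_eq_lintegral_mul₀ _ (by fun_prop)]
    · refine lintegral_congr fun s => ?_
      rw [Pi.mul_apply, mul_comm]
    -- Measurability is available for `motion`; the density coincides with it only on the period
    -- itself, which suffices almost everywhere.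
    · have hm : Measurable fun s => ENNReal.ofReal (ξ.rate
          (ξ.motion (ξ.state c z ω n).pos (s - (ξ.state c z ω n).time)) k) := by
        refine ((ξ.measurable_rate k).comp ?_).ennreal_ofReal
        exact ξ.measurable_motion.comp (measurable_const.prodMk (by fun_prop))
      refine hm.aemeasurable.congr ?_
      filter_upwards [ae_restrict_mem measurableSet_Ico] with s hs
      rw [between_eq_motion hq hs.1]
  · rw [if_neg h, if_neg h, lintegral_zero_measure]

theorem alive_of_alive_succ {z : ℝ × ℝ} {ω : Ω} {n : ℕ} (h : ξ.alive c z ω (n + 1)) :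
    ξ.alive c z ω n := by
  by_contra h'
  have : ξ.state c z ω (n + 1) = ξ.state c z ω n := by
    rw [state, nextState, if_pos (not_le.1 h')]
  rw [alive, this] at h
  exact h' h

open scoped Classical in
-- The starting claim `m` is kept general because the induction on `N` moves it by one. Everything
-- after claim `m` is seen through the surplus and the data at that moment, up to the discount
-- accumulated so far.
theorem sum_periodPayoff {ω : Ω} (hpos : ∀ k i, 0 < c.T k i ω) {z : ℝ × ℝ}
    (hz : z ∈ quadrant) (N m : ℕ) :
    ∑ n ∈ Finset.range N, ∑ k, ENNReal.ofReal (q.a k) * ξ.periodPayoff c z ω k (m + n)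
      = if ξ.alive c z ω m then ENNReal.ofReal (Real.exp (-q.δ * (ξ.state c z ω m).time))
          * (ξ.control c).payoff q N (ξ.state c z ω m).pos (dataAt c ω (ξ.state c z ω m))
        else 0 := by
  induction N generalizing m with
  | zero => simp [PeriodControl.payoff]
  | succ N ih =>
    -- The first period is split off, not the last, to match the recursion of `payoff`.
    rw [Finset.sum_range_succ']
    rw [Finset.sum_congr rfl fun n _ => by rw [show m + (n + 1) = m + 1 + n by ring], ih (m + 1),
      add_zero]
    by_cases h : ξ.alive c z ω m
    swap
    · have h' : ¬ ξ.alive c z ω (m + 1) := fun h' => h (alive_of_alive_succ h')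
      simp [periodPayoff, h, h']
    have hq := (state_spec (ξ := ξ) hpos hz m).1 h
    have hτ := firstTime_nonneg (ξ := ξ) hpos hz m
    set s := ξ.state c z ω m with hs
    set d := dataAt c ω s with hd
    have hs' : ξ.state c z ω (m + 1) = ξ.nextState c ω s := rfl
    have ht : (ξ.nextState c ω s).time = s.time + d.firstTime := nextState_time h
    have hdat : dataAt c ω (ξ.nextState c ω s) = ClaimData.shift d.first d := nextState_data h
    have hp : (ξ.nextState c ω s).pos
        = claimPos d.first (ξ.motion s.pos d.firstTime) (d (.inr (d.first, 0))) := by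
      rw [nextState_pos h, motion, if_pos ⟨hq, hτ⟩]
    have hmul (x y : ℝ) : ENNReal.ofReal (Real.exp (-q.δ * (x + y)))
        = ENNReal.ofReal (Real.exp (-q.δ * x)) * ENNReal.ofReal (Real.exp (-q.δ * y)) := by
      rw [← ENNReal.ofReal_mul (Real.exp_pos _).le, ← Real.exp_add]; congr 2; ring
    have hmul' : ENNReal.ofReal (Real.exp (-q.δ * s.time + -q.δ * d.firstTime))
        = ENNReal.ofReal (Real.exp (-q.δ * s.time))
          * ENNReal.ofReal (Real.exp (-q.δ * d.firstTime)) := by rw [← mul_add, hmul]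
    -- Counting time from the current claim pulls the discount up to that claim out of the integral.
    have hint : ∑ k, ENNReal.ofReal (q.a k) * ∫⁻ r in Ico s.time (s.time + d.firstTime),
          ENNReal.ofReal (Real.exp (-q.δ * r)) * ENNReal.ofReal (ξ.rate (ξ.between s r) k)
        = ENNReal.ofReal (Real.exp (-q.δ * s.time)) * ∫⁻ r in Ico 0 d.firstTime,
          ENNReal.ofReal (Real.exp (-q.δ * r)) * (ξ.control c).ρ s.pos r := by
      have hm (k : Fin 2) : Measurable fun r => ENNReal.ofReal (Real.exp (-q.δ * r))
          * ENNReal.ofReal (ξ.rate (ξ.motion s.pos r) k) := by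
        refine Measurable.mul (by fun_prop) ((ξ.measurable_rate k).comp ?_).ennreal_ofReal
        exact ξ.measurable_motion.comp (measurable_const.prodMk measurable_id)
      have h1 (k : Fin 2) : ∫⁻ r in Ico s.time (s.time + d.firstTime),
          ENNReal.ofReal (Real.exp (-q.δ * r)) * ENNReal.ofReal (ξ.rate (ξ.between s r) k)
          = ENNReal.ofReal (Real.exp (-q.δ * s.time)) * ∫⁻ r in Ico 0 d.firstTime,
            ENNReal.ofReal (Real.exp (-q.δ * r))
              * ENNReal.ofReal (ξ.rate (ξ.motion s.pos r) k) := by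
        rw [← lintegral_const_mul _ (hm k), ← lintegral_indicator measurableSet_Ico,
          ← lintegral_indicator measurableSet_Ico, ← lintegral_add_right_eq_self _ s.time]
        refine lintegral_congr fun r => ?_
        by_cases hr : r ∈ Ico 0 d.firstTime
        · have hr' : r + s.time ∈ Ico s.time (s.time + d.firstTime) :=
            ⟨by linarith [hr.1], by linarith [hr.2]⟩
          rw [indicator_of_mem hr, indicator_of_mem hr', between_eq_motion hq hr'.1,
            add_sub_cancel_right, add_comm r, hmul, mul_assoc]
        · have hr' : r + s.time ∉ Ico s.time (s.time + d.firstTime) := fun hr' =>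
            hr ⟨by linarith [hr'.1], by linarith [hr'.2]⟩
          rw [indicator_of_notMem hr, indicator_of_notMem hr']
      simp_rw [h1]
      simp only [control, Finset.mul_sum]
      rw [lintegral_finsetSum _ fun k _ => by
        have := hm k
        simp_rw [mul_left_comm]
        exact this.const_mul _]
      simp_rw [mul_left_comm _ (ENNReal.ofReal (q.a _))]
      simp_rw [fun k => lintegral_const_mul (μ := volume.restrict (Ico 0 d.firstTime))
        (ENNReal.ofReal (q.a k)) (hm k)]
      rw [Finset.mul_sum]
      refine Finset.sum_congr rfl fun k _ => ?_
      ring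
    have hal : ξ.alive c z ω (m + 1) ↔ 0 ≤ (claimPos d.first (ξ.motion s.pos d.firstTime)
        (d (.inr (d.first, 0)))).1 + (claimPos d.first (ξ.motion s.pos d.firstTime)
        (d (.inr (d.first, 0)))).2 := by
      rw [alive, hs', hp]
    rw [if_pos h, PeriodControl.payoff]
    simp only [periodPayoff, h, if_true, true_and, ← hs, hs', ht, hp, hdat]
    simp only [mul_add, Finset.sum_add_distrib, hint]
    rw [PeriodControl.settle]
    have hl : ∑ k, ENNReal.ofReal (q.a k) * (ENNReal.ofReal (ξ.lump s.pos k)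
        * ENNReal.ofReal (Real.exp (-q.δ * s.time)))
        = ENNReal.ofReal (Real.exp (-q.δ * s.time)) * (ξ.control c).ℓ s.pos := by
      simp only [control, Finset.mul_sum]
      exact Finset.sum_congr rfl fun k _ => by ring
    rw [hl]
    -- On survival the terminal term vanishes and the induction hypothesis supplies the rest; at
    -- ruin the later periods contribute nothing and the terminal term is the payoff `R`.
    by_cases ha : ξ.alive c z ω (m + 1)
    · have ha' := hal.1 ha
      simp only [ha, not_true_eq_false, if_true, if_false, mul_zero, Finset.sum_const_zero,
        add_zero]
      rw [show (ξ.control c).Z = ξ.motion from rfl, if_pos ha', hmul']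
      ring
    · have ha' := fun h' => ha (hal.2 h')
      simp only [ha, not_false_eq_true, if_true, if_false]
      rw [show (ξ.control c).Z = ξ.motion from rfl, if_neg ha', zero_add, ← add_assoc]
      congr 1
      simp only [control, Finset.mul_sum]
      refine Finset.sum_congr rfl fun k _ => ?_
      rw [ENNReal.ofReal_mul (Real.exp_pos _).le, hmul']
      ring

/-- At time 0 the first arrival is the first waiting time, so the data are the primitive variables
themselves, and mutual independence makes their joint law a product. -/
theorem map_dataAt_zero (ξ : CurveStrategy q) (c : ClaimModel q P) (z : ℝ × ℝ) :
    P.map (fun ω => dataAt c ω (ξ.state c z ω 0)) = ClaimData.law q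
      ∧ Measurable fun ω => dataAt c ω (ξ.state c z ω 0) := by
  have heq : (fun ω => dataAt c ω (ξ.state c z ω 0)) = fun ω i =>
      Sum.elim (fun j : Fin 2 × ℕ => c.T j.1 j.2) (fun j : Fin 2 × ℕ => c.U j.1 j.2) i ω := by
    funext ω i
    rcases i with ⟨i, j⟩ | ⟨i, j⟩
    · rcases j with _ | j <;> simp [dataAt, state, ClaimModel.arrival]
    · simp [dataAt, state]
  have hm (i : (Fin 2 × ℕ) ⊕ (Fin 2 × ℕ)) : Measurable
      (Sum.elim (fun j : Fin 2 × ℕ => c.T j.1 j.2) (fun j : Fin 2 × ℕ => c.U j.1 j.2) i) := by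
    rcases i with i | i
    · exact c.measurable_T _ _
    · exact c.measurable_U _ _
  rw [heq]
  refine ⟨?_, measurable_pi_lambda _ hm⟩
  rw [c.indep.map_fun_eq_infinitePi_map hm, ClaimData.law]
  congr 1
  funext i
  rcases i with i | i
  · exact (c.law_T _ _).map_eq
  · exact (c.law_U _ _).map_eq

variable (ξ c) in
/-- The payoff is the supremum of the iterates of the dynamic programming operator. -/
theorem expectedPayoff_eq {z : ℝ × ℝ} (hz : z ∈ quadrant) :
    ξ.expectedPayoff c z = ⨆ N, (((ξ.control c).opT q)^[N] 0) z := by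
  classical
  obtain ⟨hlaw, hmeas⟩ := map_dataAt_zero ξ c z
  have hm (N : ℕ) : Measurable fun d => (ξ.control c).payoff q N z d :=
    (PeriodControl.measurable_payoff N).comp (measurable_const.prodMk measurable_id)
  have key : ∀ᵐ ω ∂P, (∑ k : Fin 2, ENNReal.ofReal (q.a k) *
      (∫⁻ s, ENNReal.ofReal (Real.exp (-q.δ * s)) ∂(ξ.dividends c z k ω) + ξ.terminal c z k ω))
      = ⨆ N, (ξ.control c).payoff q N z (dataAt c ω (ξ.state c z ω 0)) := by
    filter_upwards [c.ae_T_pos] with ω hpos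
    simp_rw [lintegral_dividends_add_terminal hpos hz, ← ENNReal.tsum_mul_left]
    rw [← Summable.tsum_finsetSum fun k _ => ENNReal.summable, ENNReal.tsum_eq_iSup_nat]
    refine iSup_congr fun N => ?_
    have := sum_periodPayoff (ξ := ξ) hpos hz N 0
    simp only [zero_add] at this
    rw [this, if_pos (show ξ.alive c z ω 0 from add_nonneg hz.1 hz.2)]
    simp [state]
  -- As partial sums of a non-negative series the truncated payoffs increase, so monotone
  -- convergence applies.
  have hmono : ∀ᵐ ω ∂P, Monotone fun N =>
      (ξ.control c).payoff q N z (dataAt c ω (ξ.state c z ω 0)) := by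
    filter_upwards [c.ae_T_pos] with ω hpos
    refine monotone_nat_of_le_succ fun N => ?_
    have h (N : ℕ) := sum_periodPayoff (ξ := ξ) hpos hz N 0
    simp only [zero_add, if_pos (show ξ.alive c z ω 0 from add_nonneg hz.1 hz.2)] at h
    have h' (N : ℕ) : (ξ.control c).payoff q N z (dataAt c ω (ξ.state c z ω 0))
        = ∑ n ∈ Finset.range N, ∑ k, ENNReal.ofReal (q.a k) * ξ.periodPayoff c z ω k n := by
      rw [h]; simp [state]
    rw [h', h', Finset.sum_range_succ]
    exact le_self_add
  rw [expectedPayoff, lintegral_congr_ae key]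
  refine (lintegral_iSup' (f := fun N ω => (ξ.control c).payoff q N z (dataAt c ω (ξ.state c z ω 0)))
    (fun N => ((hm N).comp hmeas).aemeasurable) hmono).trans ?_
  refine iSup_congr fun N => ?_
  rw [← PeriodControl.lintegral_payoff, ← hlaw, lintegral_map (hm N) hmeas]

end CurveStrategy

/-! ### Contraction and fixed point of the dynamic programming operator -/

namespace CollabParams

variable (q : CollabParams)

/-- The weighted surplus `a₁ x + a₂ y`. -/
def weight (z : ℝ × ℝ) : ℝ := q.a 0 * z.1 + q.a 1 * z.2

theorem a_add : q.a 0 + q.a 1 = 1 := by simp [a]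

theorem weight_nonneg {z : ℝ × ℝ} (hz : z ∈ CurveStrategy.quadrant) : 0 ≤ q.weight z :=
  add_nonneg (mul_nonneg (q.a_nonneg 0) hz.1) (mul_nonneg (q.a_nonneg 1) hz.2)

theorem weight_le {z : ℝ × ℝ} {B : ℝ} (h1 : z.1 ≤ B) (h2 : z.2 ≤ B) : q.weight z ≤ B := by
  have := mul_le_mul_of_nonneg_left h1 (q.a_nonneg 0)
  have := mul_le_mul_of_nonneg_left h2 (q.a_nonneg 1)
  have : q.a 0 * B + q.a 1 * B = B := by rw [← add_mul, q.a_add, one_mul]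
  unfold weight
  linarith

theorem lintegral_exp_kappa :
    ∫⁻ s in Ioi 0, ENNReal.ofReal (Real.exp (-(q.δ + q.lamTot) * s))
      = ENNReal.ofReal (q.δ + q.lamTot)⁻¹ := by
  have hκ := q.kappa_pos
  have h := lintegral_exp_Ioi hκ 0
  simp only [mul_zero, neg_zero, Real.exp_zero] at h
  simp_rw [ENNReal.ofReal_mul hκ.le] at h
  rw [lintegral_const_mul _ (by fun_prop)] at h
  rw [ENNReal.ofReal_inv_of_pos hκ, ← one_mul (ENNReal.ofReal _)⁻¹, ← div_eq_mul_inv,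
    ENNReal.eq_div_iff (by simpa using hκ) ENNReal.ofReal_ne_top]
  simpa only [neg_mul, ENNReal.ofReal_one] using h

end CollabParams

namespace PeriodControl

theorem measurable_integrand {q : CollabParams} (S : PeriodControl) {W : ℝ × ℝ → ℝ≥0∞}
    (hW : Measurable W) (z : ℝ × ℝ) : Measurable fun s : ℝ =>
      ENNReal.ofReal (Real.exp (-(q.δ + q.lamTot) * s)) * (S.ρ z s + S.opHE q W (S.Z z s)) := by
  refine Measurable.mul (by fun_prop) (Measurable.add (f := fun s => S.ρ z s) ?_ ?_)
  · exact S.measurable_ρ.comp (measurable_const.prodMk measurable_id)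
  · exact (measurable_opHE hW).comp (S.measurable_Z.comp (measurable_const.prodMk measurable_id))

end PeriodControl

namespace CurveStrategy

variable {q : CollabParams} {Ω : Type*} [MeasurableSpace Ω] {P : Measure Ω}
  {ξ : CurveStrategy q} {c : ClaimModel q P}

/-- The error enters only if the claim is survived, and the claim laws have total weight `lamTot`.
Stating it as a one-sided bound avoids subtraction in `[0, ∞]`; `ε = 0` gives monotonicity. -/
theorem opHE_add_const {W W' : ℝ × ℝ → ℝ≥0∞} {ε : ℝ≥0∞} (h : ∀ z ∈ quadrant, W z ≤ W' z + ε)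
    (z : ℝ × ℝ) : (ξ.control c).opHE q W z
      ≤ (ξ.control c).opHE q W' z + ENNReal.ofReal q.lamTot * ε := by
  have := q.F_prob
  have hk (k : Fin 2) : ∫⁻ α, (ξ.control c).settle W (claimPos k z α) ∂(q.F k)
      ≤ (∫⁻ α, (ξ.control c).settle W' (claimPos k z α) ∂(q.F k)) + ε := by
    calc _ ≤ ∫⁻ α, ((ξ.control c).settle W' (claimPos k z α) + ε) ∂(q.F k) := by
          refine lintegral_mono fun α => ?_
          simp only [PeriodControl.settle]
          split_ifs with hα
          · exact h _ (claimPos_mem hα)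
          · exact le_self_add
      _ = _ := by rw [lintegral_add_right _ measurable_const, lintegral_const, measure_univ, mul_one]
  calc _ ≤ ∑ k, ENNReal.ofReal (q.lam k)
        * ((∫⁻ α, (ξ.control c).settle W' (claimPos k z α) ∂(q.F k)) + ε) :=
        Finset.sum_le_sum fun k _ => by gcongr; exact hk k
    _ = _ := by
      simp only [mul_add, Finset.sum_add_distrib, PeriodControl.opHE]
      rw [← Finset.sum_mul, Fin.sum_univ_two (f := fun k => ENNReal.ofReal (q.lam k)),
        ← ENNReal.ofReal_add (q.lam_pos 0).le (q.lam_pos 1).le]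
      rfl

/-- The contraction factor `λ / (δ + λ)`. -/
def contractionFactor (q : CollabParams) : ℝ := q.lamTot / (q.δ + q.lamTot)

theorem contractionFactor_nonneg (q : CollabParams) : 0 ≤ contractionFactor q :=
  div_nonneg (PeriodControl.lamTot_pos q).le q.kappa_pos.le

theorem contractionFactor_lt_one (q : CollabParams) : contractionFactor q < 1 := by
  rw [contractionFactor, div_lt_one q.kappa_pos]
  linarith [q.δ_pos]

/-- Lump sums and rates are common to both sides, and discounting an error `lamTot * ε` at the rate
`δ + lamTot` leaves the factor λ/(δ+λ). -/
theorem opT_add_const {W W' : ℝ × ℝ → ℝ≥0∞} {ε : ℝ≥0∞} (h : ∀ z ∈ quadrant, W z ≤ W' z + ε)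
    (z : ℝ × ℝ) : (ξ.control c).opT q W z
      ≤ (ξ.control c).opT q W' z + ENNReal.ofReal (contractionFactor q) * ε := by
  rw [PeriodControl.opT, PeriodControl.opT, add_assoc]
  gcongr
  calc _ ≤ ∫⁻ s in Ioi 0, (ENNReal.ofReal (Real.exp (-(q.δ + q.lamTot) * s))
        * ((ξ.control c).ρ z s + (ξ.control c).opHE q W' ((ξ.control c).Z z s))
        + ENNReal.ofReal (Real.exp (-(q.δ + q.lamTot) * s)) * (ENNReal.ofReal q.lamTot * ε)) := by
        refine lintegral_mono fun s => ?_
        simp only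
        rw [← mul_add, add_assoc]
        gcongr
        exact opHE_add_const h _
    _ = _ := by
      rw [lintegral_add_right _ (by fun_prop), lintegral_mul_const _ (by fun_prop),
        q.lintegral_exp_kappa, ← mul_assoc, ← ENNReal.ofReal_mul (inv_nonneg.2 q.kappa_pos.le),
        mul_comm _ q.lamTot, ← div_eq_mul_inv]
      rfl

theorem opT_le_of_le {W W' : ℝ × ℝ → ℝ≥0∞} (h : ∀ z ∈ quadrant, W z ≤ W' z) (z : ℝ × ℝ) :
    (ξ.control c).opT q W z ≤ (ξ.control c).opT q W' z := by
  simpa using opT_add_const (ε := 0) (by simpa using h) z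

theorem opT_congr {W W' : ℝ × ℝ → ℝ≥0∞} (h : EqOn W W' quadrant) :
    (ξ.control c).opT q W = (ξ.control c).opT q W' :=
  funext fun z => le_antisymm (opT_le_of_le (fun _ hz => (h hz).le) z)
    (opT_le_of_le (fun _ hz => (h hz).ge) z)

theorem monotone_iterate : Monotone fun N => ((ξ.control c).opT q)^[N] 0 :=
  Monotone.monotone_iterate_of_le_map (fun _ _ h z => opT_le_of_le (fun z _ => h z) z)
    fun _ => zero_le

/-- The operator commutes with suprema of increasing sequences, by monotone convergence in the claim
size and in time, so the limit of the iterates from zero is a fixed point. -/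
theorem iSup_iterate_eq : (ξ.control c).opT q (fun z => ⨆ N, (((ξ.control c).opT q)^[N] 0) z)
    = fun z => ⨆ N, (((ξ.control c).opT q)^[N] 0) z := by
  set S := ξ.control c
  set W := fun N => (S.opT q)^[N] 0 with hW
  have hmono : Monotone W := monotone_iterate
  have hWm (N : ℕ) : Measurable (W N) := PeriodControl.measurable_iterate N
  have hset (k : Fin 2) (z : ℝ × ℝ) : ∫⁻ α, S.settle (fun z => ⨆ N, W N z) (claimPos k z α) ∂(q.F k)
      = ⨆ N, ∫⁻ α, S.settle (W N) (claimPos k z α) ∂(q.F k) := by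
    rw [← lintegral_iSup]
    · refine lintegral_congr fun α => ?_
      unfold PeriodControl.settle
      split_ifs
      · rfl
      · rw [ciSup_const]
    · exact fun N => (PeriodControl.measurable_settle' (hWm N)).comp
        ((measurable_claimPos k).comp (measurable_const.prodMk measurable_id))
    · intro N N' h α
      unfold PeriodControl.settle
      dsimp only
      split_ifs
      · exact hmono h _
      · exact le_rfl
  have hHm (z : ℝ × ℝ) : Monotone fun N => S.opHE q (W N) z := fun N N' h => by
    simpa using opHE_add_const (ξ := ξ) (c := c) (ε := 0) (fun z _ => by simpa using hmono h z) z
  have hH (z : ℝ × ℝ) : S.opHE q (fun z => ⨆ N, W N z) z = ⨆ N, S.opHE q (W N) z := by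
    simp only [PeriodControl.opHE, hset, ENNReal.mul_iSup]
    rw [ENNReal.finsetSum_iSup_of_monotone]
    intro k N N' h
    dsimp only
    refine mul_le_mul_right (lintegral_mono fun α => ?_) _
    unfold PeriodControl.settle
    dsimp only
    split_ifs
    · exact hmono h _
    · exact le_rfl
  funext z
  have hT : S.opT q (fun z => ⨆ N, W N z) z = ⨆ N, W (N + 1) z := by
    have hstep (N : ℕ) : W (N + 1) = S.opT q (W N) := Function.iterate_succ_apply' _ _ _
    simp only [hstep, PeriodControl.opT, hH, ENNReal.add_iSup, ENNReal.mul_iSup]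
    rw [lintegral_iSup, ENNReal.add_iSup]
    · exact fun N => S.measurable_integrand (hWm N) z
    · intro N N' h s
      dsimp only
      gcongr
      exact hHm _ h
  rw [hT]
  exact Monotone.iSup_nat_add (fun N N' h => hmono h z) 1

/-! ### Growth -/

theorem control_ℓ {z : ℝ × ℝ} (hz : z ∈ quadrant) : (ξ.control c).ℓ z
    = ENNReal.ofReal (q.a 0 * ξ.lump z 0 + q.a 1 * ξ.lump z 1) := by
  rw [ENNReal.ofReal_add (mul_nonneg (q.a_nonneg 0) (ξ.lump_nonneg hz 0))
    (mul_nonneg (q.a_nonneg 1) (ξ.lump_nonneg hz 1)), ENNReal.ofReal_mul (q.a_nonneg 0),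
    ENNReal.ofReal_mul (q.a_nonneg 1)]
  simp [control]

theorem exists_motion_le (ξ : CurveStrategy q) :
    ∃ B, 0 ≤ B ∧ ∀ z t, (ξ.motion z t).1 ≤ B ∧ (ξ.motion z t).2 ≤ B := by
  obtain ⟨B, hB⟩ := ξ.exists_flow_le
  refine ⟨max B 0, le_max_right _ _, fun z t => ?_⟩
  unfold motion
  split_ifs with h
  · have := hB _ (ξ.land_mem h.1) t h.2
    exact ⟨le_max_of_le_left this.1, le_max_of_le_left this.2⟩
  · exact ⟨le_max_right _ _, le_max_right _ _⟩

theorem exists_land_le (ξ : CurveStrategy q) :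
    ∃ B, ∀ z ∈ quadrant, (ξ.land z).1 ≤ B ∧ (ξ.land z).2 ≤ B := by
  obtain ⟨B, hB⟩ := ξ.exists_flow_le
  refine ⟨B, fun z hz => ?_⟩
  have hm := ξ.land_mem hz
  have h := hB _ hm 0 le_rfl
  have h0 : ξ.flow (ξ.land z) 0 = ξ.land z := by
    rcases hm with hm | hm
    · rw [ξ.flow_inner₁ hm, DecreasingCurve.path, if_pos]
      · simp
      · exact div_nonneg (by linarith [hm.2.2.2]) (q.p_pos 1).le
    · rw [ξ.flow_inner₂ hm, DecreasingCurve.path, if_pos]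
      · simp
      · exact div_nonneg (by linarith [hm.2.2.2]) (q.p_pos 0).le
  rwa [h0] at h

theorem land_quadrant {z : ℝ × ℝ} (hz : z ∈ quadrant) : ξ.land z ∈ quadrant := by
  rcases ξ.land_mem hz with h | h
  · exact (ξ.inner₁_subset h).1
  · exact (ξ.inner₂_subset h).1

theorem cover_le {z : ℝ × ℝ} {B : ℝ} (h1 : z.1 ≤ B) (h2 : z.2 ≤ B) :
    (cover z).1 ≤ 2 * max B 0 ∧ (cover z).2 ≤ 2 * max B 0 := by
  have hB := le_max_left B 0
  have hB' := le_max_right B 0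
  unfold cover
  split_ifs <;> constructor <;> (try dsimp only) <;> linarith

variable (ξ c) in
/-- The value just after a claim is bounded on bounded sets, with an explicit dependence on the
function. -/
theorem exists_settle_le (B : ℝ) : ∃ C, 0 ≤ C ∧ ∀ K, 0 ≤ K → ∀ W : ℝ × ℝ → ℝ≥0∞,
    (∀ z ∈ quadrant, W z ≤ ENNReal.ofReal (q.weight z + K)) → ∀ z : ℝ × ℝ, z.1 ≤ B → z.2 ≤ B →
    ∀ k, ∀ᵐ α ∂(q.F k), (ξ.control c).settle W (claimPos k z α) ≤ ENNReal.ofReal (C + K) := by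
  set B' := 2 * max B 0 with hB'
  set r := soloValue c 0 B' + soloValue c 1 B' with hr
  have hr0 : 0 ≤ r := add_nonneg (soloValue_nonneg _ _ _) (soloValue_nonneg _ _ _)
  have hB0 : 0 ≤ B' := by positivity
  refine ⟨B' + r, by positivity, fun K hK W hW z h1 h2 k => ?_⟩
  have hpos : ∀ᵐ α ∂(q.F k), 0 ≤ α := by
    rw [ae_iff]
    convert q.F_nonneg k using 2
    ext x
    simp
  filter_upwards [hpos] with α hα
  have hle : (claimPos k z α).1 ≤ B' ∧ (claimPos k z α).2 ≤ B' := by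
    unfold claimPos
    split_ifs <;> exact cover_le (by linarith) (by linarith)
  unfold PeriodControl.settle
  split_ifs with hα
  · refine (hW _ (claimPos_mem hα)).trans (ENNReal.ofReal_le_ofReal ?_)
    linarith [q.weight_le hle.1 hle.2]
  · have hR : (ξ.control c).R (claimPos k z α) ≤ ENNReal.ofReal r := by
      rw [hr, ENNReal.ofReal_add (soloValue_nonneg _ _ _) (soloValue_nonneg _ _ _)]
      simp only [control, Fin.sum_univ_two, Matrix.cons_val_zero, Matrix.cons_val_one,
        Matrix.cons_val_fin_one]
      have ha (k : Fin 2) : ENNReal.ofReal (q.a k) ≤ 1 := by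
        rw [← ENNReal.ofReal_one]; exact ENNReal.ofReal_le_ofReal (q.a_le_one k)
      refine add_le_add (mul_le_of_le_one_of_le (ha 0) ?_)
        (mul_le_of_le_one_of_le (ha 1) ?_)
      · exact ENNReal.ofReal_le_ofReal (monotone_soloValue c 0 hle.1)
      · exact ENNReal.ofReal_le_ofReal (monotone_soloValue c 1 hle.2)
    exact hR.trans (ENNReal.ofReal_le_ofReal (by linarith))

variable (ξ c) in
/-- The operator `H` is bounded on bounded sets, with an explicit dependence on the function. -/
theorem exists_opHE_le (B : ℝ) : ∃ C, 0 ≤ C ∧ ∀ K, 0 ≤ K → ∀ W : ℝ × ℝ → ℝ≥0∞,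
    (∀ z ∈ quadrant, W z ≤ ENNReal.ofReal (q.weight z + K)) → ∀ z : ℝ × ℝ, z.1 ≤ B → z.2 ≤ B →
    (ξ.control c).opHE q W z ≤ ENNReal.ofReal (C + q.lamTot * K) := by
  have := q.F_prob
  obtain ⟨C, hC0, hC⟩ := exists_settle_le ξ c B
  refine ⟨q.lamTot * C, mul_nonneg (PeriodControl.lamTot_pos q).le hC0,
    fun K hK W hW z h1 h2 => ?_⟩
  have hk (k : Fin 2) : ∫⁻ α, (ξ.control c).settle W (claimPos k z α) ∂(q.F k)
      ≤ ENNReal.ofReal (C + K) := by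
    refine (lintegral_mono_ae (hC K hK W hW z h1 h2 k)).trans ?_
    rw [lintegral_const, measure_univ, mul_one]
  calc _ ≤ ∑ k, ENNReal.ofReal (q.lam k) * ENNReal.ofReal (C + K) :=
        Finset.sum_le_sum fun k _ => by gcongr; exact hk k
    _ = _ := by
      rw [Fin.sum_univ_two, ← add_mul, ← ENNReal.ofReal_add (q.lam_pos 0).le (q.lam_pos 1).le,
        ← ENNReal.ofReal_mul (add_pos (q.lam_pos 0) (q.lam_pos 1)).le, mul_add]
      rfl

variable (ξ c) in
-- The motion stays in one bounded set whatever the initial surplus, so linear growth of `W` is felt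
-- only through a constant.
theorem exists_integrand_le : ∃ C, 0 ≤ C ∧ ∀ K, 0 ≤ K → ∀ W : ℝ × ℝ → ℝ≥0∞,
    (∀ z ∈ quadrant, W z ≤ ENNReal.ofReal (q.weight z + K)) → ∀ z s,
    (ξ.control c).ρ z s + (ξ.control c).opHE q W (ξ.motion z s)
      ≤ ENNReal.ofReal (C + q.lamTot * K) := by
  obtain ⟨B, -, hB⟩ := ξ.exists_motion_le
  obtain ⟨C, hC0, hC⟩ := exists_opHE_le ξ c B
  obtain ⟨r, hr⟩ := ξ.exists_rate_mem
  have hr0 : 0 ≤ r := (hr 0 0).1.trans (hr 0 0).2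
  refine ⟨r + C, by positivity, fun K hK W hW z s => ?_⟩
  rw [add_assoc, ENNReal.ofReal_add hr0
    (add_nonneg hC0 (mul_nonneg (PeriodControl.lamTot_pos q).le hK))]
  refine add_le_add ?_ (hC K hK W hW _ (hB z s).1 (hB z s).2)
  simp only [control, Fin.sum_univ_two]
  rw [← ENNReal.ofReal_mul (q.a_nonneg 0), ← ENNReal.ofReal_mul (q.a_nonneg 1),
    ← ENNReal.ofReal_add (mul_nonneg (q.a_nonneg 0) (hr _ _).1)
      (mul_nonneg (q.a_nonneg 1) (hr _ _).1)]
  exact ENNReal.ofReal_le_ofReal (q.weight_le (z := (_, _)) (hr _ 0).2 (hr _ 1).2)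

variable (ξ c) in
-- The lump sum cannot exceed the surplus, which gives the weight; the rest is a bounded rate
-- discounted at `δ + lamTot`.
theorem exists_opT_le : ∃ C, 0 ≤ C ∧ ∀ K, 0 ≤ K → ∀ W : ℝ × ℝ → ℝ≥0∞,
    (∀ z ∈ quadrant, W z ≤ ENNReal.ofReal (q.weight z + K)) → ∀ z ∈ quadrant,
    (ξ.control c).opT q W z
      ≤ ENNReal.ofReal (q.weight z + (C + q.lamTot * K) / (q.δ + q.lamTot)) := by
  obtain ⟨C, hC0, hC⟩ := exists_integrand_le ξ c
  refine ⟨C, hC0, fun K hK W hW z hz => ?_⟩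
  have hb : 0 ≤ C + q.lamTot * K := add_nonneg hC0 (mul_nonneg (PeriodControl.lamTot_pos q).le hK)
  have hl := ξ.land_quadrant hz
  rw [ENNReal.ofReal_add (q.weight_nonneg hz) (div_nonneg hb q.kappa_pos.le)]
  refine add_le_add ?_ ?_
  · rw [control_ℓ hz]
    refine ENNReal.ofReal_le_ofReal (add_le_add
      (mul_le_mul_of_nonneg_left ?_ (q.a_nonneg 0)) (mul_le_mul_of_nonneg_left ?_ (q.a_nonneg 1)))
    · have : 0 ≤ z.1 - ξ.lump z 0 := hl.1
      linarith
    · have : 0 ≤ z.2 - ξ.lump z 1 := hl.2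
      linarith
  · calc _ ≤ ∫⁻ s in Ioi 0, ENNReal.ofReal (Real.exp (-(q.δ + q.lamTot) * s))
          * ENNReal.ofReal (C + q.lamTot * K) :=
          lintegral_mono fun s => by dsimp only; gcongr; exact hC K hK W hW z s
      _ = _ := by
        rw [lintegral_mul_const _ (by fun_prop), q.lintegral_exp_kappa,
          ← ENNReal.ofReal_mul (inv_nonneg.2 q.kappa_pos.le), mul_comm, div_eq_mul_inv]

variable (ξ c) in
theorem exists_iSup_iterate_le : ∃ K, 0 ≤ K ∧ ∀ z ∈ quadrant,
    ⨆ N, (((ξ.control c).opT q)^[N] 0) z ≤ ENNReal.ofReal (q.weight z + K) := by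
  obtain ⟨C, hC0, hC⟩ := exists_opT_le ξ c
  have hK : 0 ≤ C / q.δ := div_nonneg hC0 q.δ_pos.le
  -- `C / δ` is the fixed point of `K ↦ (C + λ K) / (δ + λ)`, so the bound reproduces itself along
  -- the iteration.
  refine ⟨C / q.δ, hK, fun z hz => iSup_le fun N => ?_⟩
  induction N generalizing z with
  | zero => exact zero_le
  | succ N ih =>
    rw [Function.iterate_succ_apply']
    refine (hC _ hK _ ih z hz).trans (ENNReal.ofReal_le_ofReal ?_)
    have : (C + q.lamTot * (C / q.δ)) / (q.δ + q.lamTot) = C / q.δ := by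
      have := q.δ_pos.ne'
      have := q.kappa_pos.ne'
      field_simp
    rw [this]

variable (ξ) in
-- What remains after the lump sum lies in a bounded set. This is the source of the lower growth
-- bounds in the class M.
theorem exists_le_lump : ∃ K, ∀ z ∈ quadrant,
    q.weight z ≤ q.a 0 * ξ.lump z 0 + q.a 1 * ξ.lump z 1 + K := by
  obtain ⟨B, hB⟩ := ξ.exists_land_le
  refine ⟨B, fun z hz => ?_⟩
  have h := q.weight_le (hB z hz).1 (hB z hz).2
  simp only [CollabParams.weight, land] at h ⊢
  linarith

end CurveStrategy

/-! ### The operator on real functions and the explicit formulas -/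

/-- The integral of a function given piecewise on `[0, x]`, `(x, s]` and `(s, ∞)`. -/
theorem lintegral_three_pieces {μ : Measure ℝ} [IsFiniteMeasure μ] (hμ : μ (Iio 0) = 0) {x s r : ℝ}
    (hx : 0 ≤ x) (hs : x ≤ s) (hr : 0 ≤ r) {φ : ℝ → ℝ≥0∞} {f g : ℝ → ℝ}
    (hf : ContinuousOn f (Icc 0 x)) (hf0 : ∀ α ∈ Icc 0 x, 0 ≤ f α)
    (hg : ContinuousOn g (Icc x s)) (hg0 : ∀ α ∈ Ioc x s, 0 ≤ g α)
    (h1 : ∀ α ∈ Icc 0 x, φ α = ENNReal.ofReal (f α))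
    (h2 : ∀ α ∈ Ioc x s, φ α = ENNReal.ofReal (g α))
    (h3 : ∀ α ∈ Ioi s, φ α = ENNReal.ofReal r) :
    ∫⁻ α, φ α ∂μ
      = ENNReal.ofReal ((∫ α in Icc 0 x, f α ∂μ) + (∫ α in Ioc x s, g α ∂μ) + r * μ.real (Ioi s)) := by
  have e0 : ∫⁻ α, φ α ∂μ = ∫⁻ α in Ici 0, φ α ∂μ := by
    rw [← lintegral_add_compl φ (measurableSet_Ici (a := (0 : ℝ))), compl_Ici,
      setLIntegral_measure_zero _ _ hμ, add_zero]
  have u1 : (Ici 0 : Set ℝ) = Icc 0 s ∪ Ioi s := (Icc_union_Ioi_eq_Ici (hx.trans hs)).symm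
  have u2 : Icc 0 s = Icc 0 x ∪ Ioc x s := (Icc_union_Ioc_eq_Icc hx hs).symm
  have d1 : Disjoint (Icc 0 s) (Ioi s) := Set.disjoint_left.2 fun α h h' => not_lt.2 h.2 h'
  have d2 : Disjoint (Icc 0 x) (Ioc x s) := Set.disjoint_left.2 fun α h h' => not_lt.2 h.2 h'.1
  have n1 : 0 ≤ ∫ α in Icc 0 x, f α ∂μ := setIntegral_nonneg measurableSet_Icc hf0
  have n2 : 0 ≤ ∫ α in Ioc x s, g α ∂μ := setIntegral_nonneg measurableSet_Ioc hg0
  rw [e0, u1, lintegral_union measurableSet_Ioi d1, u2, lintegral_union measurableSet_Ioc d2,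
    setLIntegral_congr_fun measurableSet_Icc h1, setLIntegral_congr_fun measurableSet_Ioc h2,
    setLIntegral_congr_fun measurableSet_Ioi h3, lintegral_const,
    ← ofReal_integral_eq_lintegral_ofReal hf.integrableOn_Icc
      ((ae_restrict_mem measurableSet_Icc).mono hf0),
    ← ofReal_integral_eq_lintegral_ofReal (hg.integrableOn_Icc.mono_set Ioc_subset_Icc_self)
      ((ae_restrict_mem measurableSet_Ioc).mono hg0),
    Measure.restrict_apply_univ, ENNReal.ofReal_add (add_nonneg n1 n2)
      (mul_nonneg hr measureReal_nonneg), ENNReal.ofReal_add n1 n2, ENNReal.ofReal_mul hr,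
    ofReal_measureReal]

namespace CurveStrategy

variable {q : CollabParams} {Ω : Type*} [MeasurableSpace Ω] {P : Measure Ω}
  {ξ : CurveStrategy q} {c : ClaimModel q P} {w : ℝ × ℝ → ℝ}

/-- The extension of a function on the quadrant by zero. -/
def extend (w : ℝ × ℝ → ℝ) : ℝ × ℝ → ℝ≥0∞ := quadrant.indicator fun z => ENNReal.ofReal (w z)

theorem extend_of_mem {z : ℝ × ℝ} (hz : z ∈ quadrant) : extend w z = ENNReal.ofReal (w z) :=
  indicator_of_mem hz _

theorem measurable_extend (hw : ContinuousOn w quadrant) : Measurable (extend w) := by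
  classical
  have := ContinuousOn.measurable_piecewise (f := fun z => ENNReal.ofReal (w z)) (g := 0)
    (ENNReal.continuous_ofReal.comp_continuousOn hw) continuousOn_const measurableSet_quadrant
  rwa [piecewise_eq_indicator] at this

theorem exists_extend_le (hw : w ∈ classM q) : ∃ K, 0 ≤ K ∧ ∀ z ∈ quadrant,
    extend w z ≤ ENNReal.ofReal (q.weight z + K) := by
  obtain ⟨K, hK⟩ := hw.2.2
  refine ⟨max K 0, le_max_right _ _, fun z hz => ?_⟩
  rw [extend_of_mem hz]
  refine ENNReal.ofReal_le_ofReal ?_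
  have := (abs_le.1 (hK z hz)).2
  have := le_max_left K 0
  unfold CollabParams.weight
  linarith

theorem continuousOn_claim₁ (hw : ContinuousOn w quadrant) {z : ℝ × ℝ} (hz : z ∈ quadrant) :
    ContinuousOn (fun α => w (z.1 - α, z.2)) (Icc 0 z.1) :=
  hw.comp (by fun_prop) fun _ hα => ⟨sub_nonneg.2 hα.2, hz.2⟩

theorem continuousOn_transfer₁ (hw : ContinuousOn w quadrant) {z : ℝ × ℝ} :
    ContinuousOn (fun α => w (0, z.1 + z.2 - α)) (Icc z.1 (z.1 + z.2)) :=
  hw.comp (by fun_prop) fun _ hα => ⟨le_rfl, sub_nonneg.2 hα.2⟩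

theorem continuousOn_claim₂ (hw : ContinuousOn w quadrant) {z : ℝ × ℝ} (hz : z ∈ quadrant) :
    ContinuousOn (fun α => w (z.1, z.2 - α)) (Icc 0 z.2) :=
  hw.comp (by fun_prop) fun _ hα => ⟨hz.1, sub_nonneg.2 hα.2⟩

theorem continuousOn_transfer₂ (hw : ContinuousOn w quadrant) {z : ℝ × ℝ} :
    ContinuousOn (fun α => w (z.1 + z.2 - α, 0)) (Icc z.2 (z.1 + z.2)) :=
  hw.comp (by fun_prop) fun _ hα => ⟨sub_nonneg.2 hα.2, le_rfl⟩

theorem opH_nonneg (hw : ∀ z ∈ quadrant, 0 ≤ w z) {z : ℝ × ℝ} (hz : z ∈ quadrant) :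
    0 ≤ opH c w z := by
  have h0 := (q.lam_pos 0).le
  have h1 := (q.lam_pos 1).le
  have a0 := q.a_nonneg 0
  have a1 := q.a_nonneg 1
  have s0 := soloValue_nonneg c 0 z.1
  have s1 := soloValue_nonneg c 1 z.2
  have i1 : 0 ≤ ∫ α in Icc 0 z.1, w (z.1 - α, z.2) ∂(q.F 0) :=
    setIntegral_nonneg measurableSet_Icc fun α hα => hw _ ⟨sub_nonneg.2 hα.2, hz.2⟩
  have i2 : 0 ≤ ∫ α in Ioc z.1 (z.1 + z.2), w (0, z.1 + z.2 - α) ∂(q.F 0) :=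
    setIntegral_nonneg measurableSet_Ioc fun α hα => hw _ ⟨le_rfl, sub_nonneg.2 hα.2⟩
  have i3 : 0 ≤ ∫ α in Icc 0 z.2, w (z.1, z.2 - α) ∂(q.F 1) :=
    setIntegral_nonneg measurableSet_Icc fun α hα => hw _ ⟨hz.1, sub_nonneg.2 hα.2⟩
  have i4 : 0 ≤ ∫ α in Ioc z.2 (z.1 + z.2), w (z.1 + z.2 - α, 0) ∂(q.F 1) :=
    setIntegral_nonneg measurableSet_Ioc fun α hα => hw _ ⟨sub_nonneg.2 hα.2, le_rfl⟩
  unfold opH opI opU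
  positivity

/-- The two versions of the operator `H` agree. -/
theorem opHE_extend (hw : ∀ z ∈ quadrant, 0 ≤ w z) (hc : ContinuousOn w quadrant) {z : ℝ × ℝ}
    (hz : z ∈ quadrant) :
    (ξ.control c).opHE q (extend w) z = ENNReal.ofReal (opH c w z) := by
  have := q.F_prob
  have s0 := soloValue_nonneg c 0 z.1
  have s1 := soloValue_nonneg c 1 z.2
  have hz1 : 0 ≤ z.1 := hz.1
  have hz2 : 0 ≤ z.2 := hz.2
  have e0 : ∫⁻ α, (ξ.control c).settle (extend w) (claimPos 0 z α) ∂(q.F 0)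
      = ENNReal.ofReal ((∫ α in Icc 0 z.1, w (z.1 - α, z.2) ∂(q.F 0))
        + (∫ α in Ioc z.1 (z.1 + z.2), w (0, z.1 + z.2 - α) ∂(q.F 0))
        + q.a 1 * soloValue c 1 z.2 * (q.F 0).real (Ioi (z.1 + z.2))) := by
    refine lintegral_three_pieces (q.F_nonneg 0) hz1 (by linarith) (mul_nonneg (q.a_nonneg 1) s1)
      (continuousOn_claim₁ hc hz) (fun α hα => hw _ ⟨sub_nonneg.2 hα.2, hz.2⟩)
      (continuousOn_transfer₁ hc) (fun α hα => hw _ ⟨le_rfl, sub_nonneg.2 hα.2⟩)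
      (fun α hα => ?_) (fun α hα => ?_) (fun α hα => ?_)
    · have hq : ((z.1 - α, z.2) : ℝ × ℝ) ∈ quadrant := ⟨sub_nonneg.2 hα.2, hz.2⟩
      have hp : claimPos 0 z α = (z.1 - α, z.2) := by
        rw [claimPos, if_pos rfl, cover, if_neg (not_lt.2 (add_nonneg hq.1 hq.2)),
          if_neg (not_lt.2 hq.1), if_neg (not_lt.2 hq.2)]
      rw [PeriodControl.settle, hp, if_pos (add_nonneg hq.1 hq.2), extend_of_mem hq]
    · have hq : ((0, z.1 + z.2 - α) : ℝ × ℝ) ∈ quadrant := ⟨le_rfl, sub_nonneg.2 hα.2⟩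
      have hp : claimPos 0 z α = (0, z.1 + z.2 - α) := by
        rw [claimPos, if_pos rfl, cover, if_neg, if_pos]
        · dsimp only; congr 1; ring
        · dsimp only; linarith [hα.1]
        · dsimp only; linarith [hα.2]
      rw [PeriodControl.settle, hp, if_pos (add_nonneg hq.1 hq.2), extend_of_mem hq]
    -- At ruin the claiming company has a negative surplus, where its stand-alone value vanishes;
    -- only the other company contributes, as in `opU`.
    · rw [mem_Ioi] at hα
      have hlt : (z.1 - α) + z.2 < 0 := by linarith
      have hp : claimPos 0 z α = (z.1 - α, z.2) := by
        rw [claimPos, if_pos rfl, cover, if_pos hlt]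
      rw [PeriodControl.settle, hp, if_neg (not_le.2 hlt), ENNReal.ofReal_mul (q.a_nonneg 1)]
      simp [control, soloValue_of_neg c 0 (show z.1 - α < 0 by linarith)]
  have e1 : ∫⁻ α, (ξ.control c).settle (extend w) (claimPos 1 z α) ∂(q.F 1)
      = ENNReal.ofReal ((∫ α in Icc 0 z.2, w (z.1, z.2 - α) ∂(q.F 1))
        + (∫ α in Ioc z.2 (z.1 + z.2), w (z.1 + z.2 - α, 0) ∂(q.F 1))
        + q.a 0 * soloValue c 0 z.1 * (q.F 1).real (Ioi (z.1 + z.2))) := by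
    refine lintegral_three_pieces (q.F_nonneg 1) hz2 (by linarith) (mul_nonneg (q.a_nonneg 0) s0)
      (continuousOn_claim₂ hc hz) (fun α hα => hw _ ⟨hz.1, sub_nonneg.2 hα.2⟩)
      (continuousOn_transfer₂ hc) (fun α hα => hw _ ⟨sub_nonneg.2 hα.2, le_rfl⟩)
      (fun α hα => ?_) (fun α hα => ?_) (fun α hα => ?_)
    · have hq : ((z.1, z.2 - α) : ℝ × ℝ) ∈ quadrant := ⟨hz.1, sub_nonneg.2 hα.2⟩
      have hp : claimPos 1 z α = (z.1, z.2 - α) := by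
        rw [claimPos, if_neg one_ne_zero, cover, if_neg (not_lt.2 (add_nonneg hq.1 hq.2)),
          if_neg (not_lt.2 hq.1), if_neg (not_lt.2 hq.2)]
      rw [PeriodControl.settle, hp, if_pos (add_nonneg hq.1 hq.2), extend_of_mem hq]
    · have hq : ((z.1 + z.2 - α, 0) : ℝ × ℝ) ∈ quadrant := ⟨sub_nonneg.2 hα.2, le_rfl⟩
      have hp : claimPos 1 z α = (z.1 + z.2 - α, 0) := by
        rw [claimPos, if_neg one_ne_zero, cover, if_neg, if_neg (not_lt.2 hz1), if_pos]
        · dsimp only; congr 1; ring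
        · dsimp only; linarith [hα.1]
        · dsimp only; linarith [hα.2]
      rw [PeriodControl.settle, hp, if_pos (add_nonneg hq.1 hq.2), extend_of_mem hq]
    · rw [mem_Ioi] at hα
      have hlt : z.1 + (z.2 - α) < 0 := by linarith
      have hp : claimPos 1 z α = (z.1, z.2 - α) := by
        rw [claimPos, if_neg one_ne_zero, cover, if_pos hlt]
      rw [PeriodControl.settle, hp, if_neg (not_le.2 hlt), ENNReal.ofReal_mul (q.a_nonneg 0)]
      simp [control, soloValue_of_neg c 1 (show z.2 - α < 0 by linarith)]
  have i1 : 0 ≤ ∫ α in Icc 0 z.1, w (z.1 - α, z.2) ∂(q.F 0) :=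
    setIntegral_nonneg measurableSet_Icc fun α hα => hw _ ⟨sub_nonneg.2 hα.2, hz.2⟩
  have i2 : 0 ≤ ∫ α in Ioc z.1 (z.1 + z.2), w (0, z.1 + z.2 - α) ∂(q.F 0) :=
    setIntegral_nonneg measurableSet_Ioc fun α hα => hw _ ⟨le_rfl, sub_nonneg.2 hα.2⟩
  have i3 : 0 ≤ ∫ α in Icc 0 z.2, w (z.1, z.2 - α) ∂(q.F 1) :=
    setIntegral_nonneg measurableSet_Icc fun α hα => hw _ ⟨hz.1, sub_nonneg.2 hα.2⟩
  have i4 : 0 ≤ ∫ α in Ioc z.2 (z.1 + z.2), w (z.1 + z.2 - α, 0) ∂(q.F 1) :=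
    setIntegral_nonneg measurableSet_Ioc fun α hα => hw _ ⟨sub_nonneg.2 hα.2, le_rfl⟩
  have h0 := (q.lam_pos 0).le
  have h1 := (q.lam_pos 1).le
  have a0 := q.a_nonneg 0
  have a1 := q.a_nonneg 1
  rw [PeriodControl.opHE, Fin.sum_univ_two, e0, e1, ← ENNReal.ofReal_mul h0,
    ← ENNReal.ofReal_mul h1, ← ENNReal.ofReal_add (by positivity) (by positivity)]
  congr 1
  unfold opH opI opU
  ring

variable (ξ c) in
/-- The dynamic programming operator for real-valued functions on the quadrant. -/
def opReal (w : ℝ × ℝ → ℝ) (z : ℝ × ℝ) : ℝ := ((ξ.control c).opT q (extend w) z).toReal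

theorem opT_extend_ne_top (hw : w ∈ classM q) {z : ℝ × ℝ} (hz : z ∈ quadrant) :
    (ξ.control c).opT q (extend w) z ≠ ∞ := by
  obtain ⟨K, hK0, hK⟩ := exists_extend_le hw
  obtain ⟨C, -, hC⟩ := exists_opT_le ξ c
  exact ((hC K hK0 _ hK z hz).trans_lt ENNReal.ofReal_lt_top).ne

variable (ξ c w) in
/-- The total reward rate along the motion from `z`. -/
def rewardRate (z : ℝ × ℝ) (s : ℝ) : ℝ :=
  q.a 0 * ξ.rate (ξ.motion z s) 0 + q.a 1 * ξ.rate (ξ.motion z s) 1 + opH c w (ξ.motion z s)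

theorem rewardRate_nonneg (hw : w ∈ classM q) (z : ℝ × ℝ) (s : ℝ) :
    0 ≤ rewardRate ξ c w z s := by
  obtain ⟨r, hr⟩ := ξ.exists_rate_mem
  exact add_nonneg (add_nonneg (mul_nonneg (q.a_nonneg 0) (hr _ _).1)
    (mul_nonneg (q.a_nonneg 1) (hr _ _).1)) (opH_nonneg hw.1 (ξ.motion_mem s))

theorem integrand_eq (hw : w ∈ classM q) (z : ℝ × ℝ) (s : ℝ) :
    (ξ.control c).ρ z s + (ξ.control c).opHE q (extend w) (ξ.motion z s)
      = ENNReal.ofReal (rewardRate ξ c w z s) := by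
  obtain ⟨r, hr⟩ := ξ.exists_rate_mem
  have h0 := mul_nonneg (q.a_nonneg 0) (hr (ξ.motion z s) 0).1
  have h1 := mul_nonneg (q.a_nonneg 1) (hr (ξ.motion z s) 1).1
  rw [opHE_extend hw.1 hw.2.1 (ξ.motion_mem s), rewardRate,
    ENNReal.ofReal_add (add_nonneg h0 h1) (opH_nonneg hw.1 (ξ.motion_mem s)),
    ENNReal.ofReal_add h0 h1, ENNReal.ofReal_mul (q.a_nonneg 0), ENNReal.ofReal_mul (q.a_nonneg 1)]
  simp [control]

theorem exp_mul_rewardRate (hw : w ∈ classM q) (z : ℝ × ℝ) (s : ℝ) :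
    Real.exp (-(q.δ + q.lamTot) * s) * rewardRate ξ c w z s
      = (ENNReal.ofReal (Real.exp (-(q.δ + q.lamTot) * s))
        * ((ξ.control c).ρ z s + (ξ.control c).opHE q (extend w) (ξ.motion z s))).toReal := by
  rw [integrand_eq hw, ENNReal.toReal_mul, ENNReal.toReal_ofReal (Real.exp_pos _).le,
    ENNReal.toReal_ofReal (rewardRate_nonneg hw z s)]

/-- Integrability comes from the finiteness of `opT`, so no regularity of `opH` along the motion has
to be known. -/
theorem integrableOn_rewardRate (hw : w ∈ classM q) {z : ℝ × ℝ} (hz : z ∈ quadrant) :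
    IntegrableOn (fun s => Real.exp (-(q.δ + q.lamTot) * s) * rewardRate ξ c w z s) (Ioi 0) := by
  simp_rw [exp_mul_rewardRate hw]
  refine integrable_toReal_of_lintegral_ne_top ?_ ?_
  · exact ((ξ.control c).measurable_integrand (measurable_extend hw.2.1) z).aemeasurable
  · have := opT_extend_ne_top (ξ := ξ) (c := c) hw hz
    rw [PeriodControl.opT] at this
    exact (ENNReal.add_ne_top.1 this).2

theorem opReal_eq (hw : w ∈ classM q) {z : ℝ × ℝ} (hz : z ∈ quadrant) :
    opReal ξ c w z = q.a 0 * ξ.lump z 0 + q.a 1 * ξ.lump z 1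
      + ∫ s in Ioi 0, Real.exp (-(q.δ + q.lamTot) * s) * rewardRate ξ c w z s := by
  have h := opT_extend_ne_top (ξ := ξ) (c := c) hw hz
  have hl : 0 ≤ q.a 0 * ξ.lump z 0 + q.a 1 * ξ.lump z 1 :=
    add_nonneg (mul_nonneg (q.a_nonneg 0) (ξ.lump_nonneg hz 0))
      (mul_nonneg (q.a_nonneg 1) (ξ.lump_nonneg hz 1))
  rw [opReal]
  rw [PeriodControl.opT] at h ⊢
  obtain ⟨h1, h2⟩ := ENNReal.add_ne_top.1 h
  rw [ENNReal.toReal_add h1 h2, control_ℓ hz, ENNReal.toReal_ofReal hl]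
  congr 1
  simp_rw [exp_mul_rewardRate hw]
  have hm := (ξ.control c).measurable_integrand (q := q) (measurable_extend hw.2.1) z
  exact (integral_toReal hm.aemeasurable (ae_lt_top hm h2)).symm

/-- The three phases of the motion are those of `integral_path`: no dividends on the line, dividends
of Company One on the curve, and both premiums at the corner. -/
theorem opReal_of_land_inner₁ (hw : w ∈ classM q) {z : ℝ × ℝ} (hz : z ∈ quadrant) {z' : ℝ × ℝ}
    (hl : ξ.land z = z') (hz' : z' ∈ ξ.inner₁) :
    opReal ξ c w z = q.a 0 * ξ.lump z 0 + q.a 1 * ξ.lump z 1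
      + (Real.exp (-(q.δ + q.lamTot) * ((ξ.ξ₁ (z'.1 - q.p 0 / q.p 1 * z'.2) - z'.2) / q.p 1))
        * ξ.k₁ c w (z'.1 - q.p 0 / q.p 1 * z'.2)
      + ∫ s in 0..(ξ.ξ₁ (z'.1 - q.p 0 / q.p 1 * z'.2) - z'.2) / q.p 1,
          Real.exp (-(q.δ + q.lamTot) * s) * opH c w (z'.1 + q.p 0 * s, z'.2 + q.p 1 * s)) := by
  have hp := q.p_pos 1
  have hκ := q.kappa_pos
  have hθ : 0 ≤ (ξ.ξ₁ (z'.1 - q.p 0 / q.p 1 * z'.2) - z'.2) / q.p 1 :=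
    div_nonneg (sub_nonneg.2 hz'.2.2.2) hp.le
  have hmot (s : ℝ) (hs : 0 ≤ s) : ξ.motion z s = ξ.side₁.path (q.p 0) (q.p 1) z' s := by
    rw [motion, if_pos ⟨hz, hs⟩, hl, ξ.flow_inner₁ hz']
  have hu := ξ.side₁.f_mem hz'.2.2.1
  simp only [side₁_f, side₁_lo, ξ.ξ₁_ubar] at hu
  rw [opReal_eq hw hz]
  congr 1
  -- The constant `c` is the value of receiving `pTot + H` at the corner forever, discounted at `δ +
  -- lamTot`.
  refine ξ.side₁.integral_path (a := q.a 0) (c := q.pTot / (q.δ + q.lamTot) + 1 / (q.δ + q.lamTot)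
          * opH c w (ξ.ubar + q.p 0 / q.p 1 * ξ.ξ₁ ξ.ubar, ξ.ξ₁ ξ.ubar)) hp hκ hz'
    (h := opH c w) (F := rewardRate ξ c w z) ?_ ?_ ?_ (integrableOn_rewardRate hw hz)
  · intro s hs hsθ
    have hlt : s * q.p 1 < ξ.ξ₁ (z'.1 - q.p 0 / q.p 1 * z'.2) - z'.2 := (lt_div_iff₀ hp).1 hsθ
    have hm : ξ.motion z s = (z'.1 + q.p 0 * s, z'.2 + q.p 1 * s) := by
      rw [hmot s hs.le, DecreasingCurve.path, if_pos hsθ.le]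
    have hline : z'.1 + q.p 0 * s - q.p 0 / q.p 1 * (z'.2 + q.p 1 * s)
        = z'.1 - q.p 0 / q.p 1 * z'.2 := by field_simp; ring
    have hlt' : z'.2 + q.p 1 * s < ξ.ξ₁ (z'.1 - q.p 0 / q.p 1 * z'.2) := by linarith
    have hin : (z'.1 + q.p 0 * s, z'.2 + q.p 1 * s) ∈ ξ.inner₁ := by
      have h1 := mul_pos (q.p_pos 0) hs
      have h2 := mul_pos (q.p_pos 1) hs
      refine ⟨by dsimp only; linarith [hz'.1], by dsimp only; linarith [hz'.2.1], ?_, ?_⟩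
      · dsimp only; rw [hline]; exact hz'.2.2.1
      · dsimp only; rw [hline]; exact hlt'.le
    have hr := ξ.rate_straight₁ hin (by dsimp only; rw [hline]; exact hlt')
    simp [rewardRate, hm, hr]
  · intro s hsθ hs
    simp only [side₁_f, side₁_lo, ξ.ξ₁_ubar] at hs hsθ
    have hs0 : 0 ≤ s := hθ.trans hsθ.le
    have hm : ξ.motion z s
        = (ξ.inv₁ (z'.2 + q.p 1 * s) + q.p 0 / q.p 1 * (z'.2 + q.p 1 * s), z'.2 + q.p 1 * s) := by
      rw [hmot s hs0, DecreasingCurve.path, if_neg (by simpa using hsθ),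
        if_pos (by simpa [ξ.ξ₁_ubar] using hs.le)]
      rfl
    have hr := ξ.rate_curve₁ (t := z'.2 + q.p 1 * s)
      (add_nonneg hz'.2.1 (mul_nonneg hp.le hs0)) hs
    simp [rewardRate, hm, hr]
  · intro s hs
    simp only [side₁_f, side₁_lo, ξ.ξ₁_ubar] at hs
    have hsθ : (ξ.ξ₁ (z'.1 - q.p 0 / q.p 1 * z'.2) - z'.2) / q.p 1 < s := by
      rw [div_lt_iff₀ hp]; linarith [hu.2]
    have hm : ξ.motion z s = (ξ.xbar, ξ.ybar) := by
      rw [hmot s (hθ.trans hsθ.le), DecreasingCurve.path, if_neg (by simpa using hsθ),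
        if_neg (by simpa [ξ.ξ₁_ubar] using hs)]
      simp only [side₁_f, side₁_lo, ξ.ξ₁_ubar, ξ.ubar_add]
    rw [rewardRate, hm, ξ.rate_corner, ξ.ξ₁_ubar, ξ.ubar_add, CollabParams.pTot]
    field_simp

/-- The same computation after exchanging the coordinates; `opH` is not symmetric, so it enters
composed with `Prod.swap`. -/
theorem opReal_of_land_inner₂ (hw : w ∈ classM q) {z : ℝ × ℝ} (hz : z ∈ quadrant) {z' : ℝ × ℝ}
    (hl : ξ.land z = z') (hz' : z' ∈ ξ.inner₂) :
    opReal ξ c w z = q.a 0 * ξ.lump z 0 + q.a 1 * ξ.lump z 1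
      + (Real.exp (-(q.δ + q.lamTot) * ((ξ.ξ₂ (z'.2 - q.p 1 / q.p 0 * z'.1) - z'.1) / q.p 0))
        * ξ.k₂ c w (z'.2 - q.p 1 / q.p 0 * z'.1)
      + ∫ s in 0..(ξ.ξ₂ (z'.2 - q.p 1 / q.p 0 * z'.1) - z'.1) / q.p 0,
          Real.exp (-(q.δ + q.lamTot) * s) * opH c w (z'.1 + q.p 0 * s, z'.2 + q.p 1 * s)) := by
  have hp := q.p_pos 0
  have hκ := q.kappa_pos
  have hθ : 0 ≤ (ξ.ξ₂ (z'.2 - q.p 1 / q.p 0 * z'.1) - z'.1) / q.p 0 :=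
    div_nonneg (sub_nonneg.2 hz'.2.2.2) hp.le
  have hmot (s : ℝ) (hs : 0 ≤ s) :
      ξ.motion z s = (ξ.side₂.path (q.p 1) (q.p 0) z'.swap s).swap := by
    rw [motion, if_pos ⟨hz, hs⟩, hl, ξ.flow_inner₂ hz']
  have hu := ξ.side₂.f_mem hz'.2.2.1
  simp only [side₂_f, side₂_lo, ξ.ξ₂_vbar, Prod.fst_swap, Prod.snd_swap] at hu
  rw [opReal_eq hw hz]
  congr 1
  refine ξ.side₂.integral_path (a := q.a 1) (c := q.pTot / (q.δ + q.lamTot) + 1 / (q.δ + q.lamTot)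
          * opH c w (ξ.ξ₂ ξ.vbar, ξ.vbar + q.p 1 / q.p 0 * ξ.ξ₂ ξ.vbar)) hp hκ hz'
    (h := fun z => opH c w z.swap) (F := rewardRate ξ c w z) ?_ ?_ ?_
    (integrableOn_rewardRate hw hz)
  · intro s hs hsθ
    simp only [side₂_f, Prod.fst_swap, Prod.snd_swap] at hsθ
    have hlt : s * q.p 0 < ξ.ξ₂ (z'.2 - q.p 1 / q.p 0 * z'.1) - z'.1 := (lt_div_iff₀ hp).1 hsθ
    have hm : ξ.motion z s = (z'.1 + q.p 0 * s, z'.2 + q.p 1 * s) := by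
      rw [hmot s hs.le, DecreasingCurve.path, if_pos (by simpa using hsθ.le)]
      rfl
    have hline : z'.2 + q.p 1 * s - q.p 1 / q.p 0 * (z'.1 + q.p 0 * s)
        = z'.2 - q.p 1 / q.p 0 * z'.1 := by field_simp; ring
    have hlt' : z'.1 + q.p 0 * s < ξ.ξ₂ (z'.2 - q.p 1 / q.p 0 * z'.1) := by linarith
    have hin : (z'.1 + q.p 0 * s, z'.2 + q.p 1 * s) ∈ ξ.inner₂ := by
      have h1 := mul_pos (q.p_pos 0) hs
      have h2 := mul_pos (q.p_pos 1) hs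
      have hz1 : 0 ≤ z'.1 := hz'.2.1
      have hz2 : 0 ≤ z'.2 := hz'.1
      refine ⟨by simp only [Prod.fst_swap]; linarith, by simp only [Prod.snd_swap]; linarith, ?_, ?_⟩
      · simp only [Prod.fst_swap, Prod.snd_swap]; rw [hline]; exact hz'.2.2.1
      · simp only [Prod.fst_swap, Prod.snd_swap]; rw [hline]; exact hlt'.le
    have hr := ξ.rate_straight₂ hin (by dsimp only; rw [hline]; exact hlt')
    simp [rewardRate, hm, hr]
  · intro s hsθ hs
    simp only [side₂_f, side₂_lo, ξ.ξ₂_vbar, Prod.fst_swap, Prod.snd_swap] at hs hsθ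
    have hs0 : 0 ≤ s := hθ.trans hsθ.le
    have hm : ξ.motion z s
        = (z'.1 + q.p 0 * s, ξ.inv₂ (z'.1 + q.p 0 * s) + q.p 1 / q.p 0 * (z'.1 + q.p 0 * s)) := by
      rw [hmot s hs0, DecreasingCurve.path, if_neg (by simpa using hsθ),
        if_pos (by simpa [ξ.ξ₂_vbar] using hs.le)]
      rfl
    have hr := ξ.rate_curve₂ (t := z'.1 + q.p 0 * s)
      (add_nonneg hz'.2.1 (mul_nonneg hp.le hs0)) hs
    simp [rewardRate, hm, hr]
  · intro s hs
    simp only [side₂_f, side₂_lo, ξ.ξ₂_vbar, Prod.snd_swap] at hs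
    have hsθ : (ξ.ξ₂ (z'.2 - q.p 1 / q.p 0 * z'.1) - z'.1) / q.p 0 < s := by
      rw [div_lt_iff₀ hp]; linarith [hu.2]
    have hm : ξ.motion z s = (ξ.xbar, ξ.ybar) := by
      rw [hmot s (hθ.trans hsθ.le), DecreasingCurve.path, if_neg (by simpa using hsθ),
        if_neg (by simpa [ξ.ξ₂_vbar] using hs)]
      simp only [side₂_f, side₂_lo, ξ.ξ₂_vbar, ξ.vbar_add, Prod.swap_prod_mk]
    rw [rewardRate, hm, ξ.rate_corner, ξ.ξ₂_vbar, ξ.vbar_add, CollabParams.pTot]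
    field_simp

variable (ξ c) in
/-- The dynamic programming operator is given by the explicit formulas. -/
theorem formulas_opReal (hw : w ∈ classM q) : ξ.Formulas c w (opReal ξ c w) where
  below_inner z hz hy hx := by
    have hin := (ξ.mem_inner₁_iff hz).2 ⟨hy, hx⟩
    rw [opReal_of_land_inner₁ hw hz.1 (ξ.land_inner₁ hin) hin, ξ.lump_inner₁ hin]
    simp
  below_outer z hz hy hx := by
    have hm := ξ.y_mem hz.1 hy
    have hg := ξ.side₁.f_g hm
    simp only [side₁_f, side₁_g] at hg
    rw [opReal_of_land_inner₁ hw hz.1 (ξ.land_outer₁ hz.1 hy hx)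
      (ξ.curve_mem_inner₁ ⟨hz.1.2, hy⟩), ξ.lump_outer₁ hz.1 hy hx]
    -- The landing point is on the curve, so the hitting time is zero and only `k₁` survives.
    simp only [add_sub_cancel_right, hg, sub_self, zero_div, mul_zero, Real.exp_zero, one_mul,
      intervalIntegral.integral_same, add_zero, Matrix.cons_val_zero, Matrix.cons_val_one,
      Matrix.cons_val_fin_one]
    ring
  below_corner z hz hx hy := by
    have hu : ξ.ξ₁ (ξ.xbar - q.p 0 / q.p 1 * ξ.ybar) = ξ.ybar := ξ.start₁
    rw [opReal_of_land_inner₁ hw hz.1 (ξ.land_corner hx hy) ξ.corner_mem_inner₁,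
      ξ.lump_corner hx hy]
    simp [hu]
  above_inner z hz hx hy := by
    have hin := (ξ.mem_inner₂_iff hz).2 ⟨hx, hy⟩
    rw [opReal_of_land_inner₂ hw hz.1 (ξ.land_inner₂ hin) hin, ξ.lump_inner₂ hin]
    simp
  above_outer z hz hx hy := by
    have hm := ξ.x_mem hz.1 hx
    have hg := ξ.side₂.f_g hm
    simp only [side₂_f, side₂_g] at hg
    rw [opReal_of_land_inner₂ hw hz.1 (ξ.land_outer₂ hz.1 hx hy)
      (ξ.curve_mem_inner₂ ⟨hz.1.1, hx⟩), ξ.lump_outer₂ hz.1 hx hy]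
    simp only [add_sub_cancel_right, hg, sub_self, zero_div, mul_zero, Real.exp_zero, one_mul,
      intervalIntegral.integral_same, add_zero, Matrix.cons_val_zero, Matrix.cons_val_one,
      Matrix.cons_val_fin_one]
    ring
  above_corner z hz hx hy := by
    have hu : ξ.ξ₂ (ξ.ybar - q.p 1 / q.p 0 * ξ.xbar) = ξ.xbar := ξ.start₂
    rw [opReal_of_land_inner₂ hw hz.1 (ξ.land_corner hx hy) ξ.corner_mem_inner₂,
      ξ.lump_corner hx hy]
    simp [hu]

/-- The formulas determine the values on the quadrant. -/
theorem Formulas.eqOn {W₀ W W' : ℝ × ℝ → ℝ} (h : ξ.Formulas c W₀ W) (h' : ξ.Formulas c W₀ W') :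
    EqOn W W' quadrant := by
  intro z hz
  rcases ξ.mem_O₁_or_O₂ hz with hO | hO
  · rcases ξ.O₁_cases hO with hc | hc | hc
    · have hm := (ξ.mem_inner₁_iff hO).1 hc
      rw [h.below_inner z hO hm.1 hm.2, h'.below_inner z hO hm.1 hm.2]
    · rw [h.below_outer z hO hc.1 hc.2, h'.below_outer z hO hc.1 hc.2]
    · rw [h.below_corner z hO hc.1 hc.2, h'.below_corner z hO hc.1 hc.2]
  · rcases ξ.O₂_cases hO with hc | hc | hc
    · have hm := (ξ.mem_inner₂_iff hO).1 hc
      rw [h.above_inner z hO hm.1 hm.2, h'.above_inner z hO hm.1 hm.2]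
    · rw [h.above_outer z hO hc.1 hc.2, h'.above_outer z hO hc.1 hc.2]
    · rw [h.above_corner z hO hc.1 hc.2, h'.above_corner z hO hc.1 hc.2]

end CurveStrategy

/-! ### Continuity of the operator H and of reward integrals -/

open Filter Topology

/-- Away from ruin the case distinction collapses to an expression that is continuous on the whole
plane. -/
theorem cover_eq {z : ℝ × ℝ} (hz : 0 ≤ z.1 + z.2) :
    cover z = (max 0 (z.1 + min 0 z.2), max 0 (z.2 + min 0 z.1)) := by
  unfold cover
  rw [if_neg (not_lt.2 hz)]
  split_ifs with h1 h2
  · have h2 : 0 ≤ z.2 := by linarith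
    rw [min_eq_left h2, min_eq_right h1.le, add_zero, max_eq_left h1.le, add_comm z.2,
      max_eq_right hz]
  · have h1 := not_lt.1 h1
    rw [min_eq_right h2.le, min_eq_left h1, add_zero, max_eq_left h2.le, max_eq_right hz]
  · have h1 := not_lt.1 h1
    have h2 := not_lt.1 h2
    rw [min_eq_left h1, min_eq_left h2, add_zero, add_zero, max_eq_right h1, max_eq_right h2]

namespace DecreasingCurve

variable (C : DecreasingCurve) (m n : ℝ)

theorem isClosed_inner : IsClosed (C.inner m n) := by
  have hb : IsClosed {z : ℝ × ℝ | 0 ≤ z.1 ∧ 0 ≤ z.2 ∧ z.1 - m / n * z.2 ∈ Icc C.lo C.hi} := by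
    refine (isClosed_le continuous_const continuous_fst).inter
      ((isClosed_le continuous_const continuous_snd).inter (isClosed_Icc.preimage ?_))
    fun_prop
  have hf : ContinuousOn (fun z : ℝ × ℝ => C.f (z.1 - m / n * z.2) - z.2)
      {z : ℝ × ℝ | 0 ≤ z.1 ∧ 0 ≤ z.2 ∧ z.1 - m / n * z.2 ∈ Icc C.lo C.hi} :=
    (C.continuousOn_f.comp (by fun_prop) fun z hz => hz.2.2).sub continuousOn_snd
  have := hf.preimage_isClosed_of_isClosed hb (isClosed_Ici (a := (0 : ℝ)))
  convert this using 1
  ext z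
  simp only [inner, mem_inter_iff, mem_preimage, mem_Ici, mem_ofPred_eq, sub_nonneg]
  tauto

theorem isClosed_outer : IsClosed {z : ℝ × ℝ | 0 ≤ z.1 ∧ z.2 ∈ Icc 0 (C.f C.lo)
    ∧ C.g z.2 + m / n * z.2 ≤ z.1} := by
  have hb : IsClosed {z : ℝ × ℝ | 0 ≤ z.1 ∧ z.2 ∈ Icc 0 (C.f C.lo)} :=
    (isClosed_le continuous_const continuous_fst).inter (isClosed_Icc.preimage continuous_snd)
  have hf : ContinuousOn (fun z : ℝ × ℝ => z.1 - (C.g z.2 + m / n * z.2))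
      {z : ℝ × ℝ | 0 ≤ z.1 ∧ z.2 ∈ Icc 0 (C.f C.lo)} := by
    refine continuousOn_fst.sub (ContinuousOn.add ?_ (by fun_prop))
    exact C.continuousOn_g.comp continuousOn_snd fun z hz => hz.2
  have := hf.preimage_isClosed_of_isClosed hb (isClosed_Ici (a := (0 : ℝ)))
  convert this using 1
  ext z
  simp only [mem_inter_iff, mem_preimage, mem_Ici, mem_ofPred_eq, sub_nonneg]
  tauto

variable {m n}

/-- Integrability of `h` along the curve is enough, since `h` enters only through an integral with a
moving end point. -/
theorem continuousOn_curveValue (κ a c : ℝ) {h : ℝ × ℝ → ℝ}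
    (hh : IntegrableOn (fun t => h (C.g t + m / n * t, t)) (Icc 0 (C.f C.lo))) :
    ContinuousOn (C.curveValue m n κ a c h) (Icc C.lo C.hi) := by
  have hf := C.continuousOn_f
  have e (b : ℝ) : ContinuousOn (fun u => Real.exp (κ * ((C.f u - b) / n))) (Icc C.lo C.hi) :=
    (show Continuous fun t : ℝ => Real.exp (κ * ((t - b) / n)) by fun_prop).comp_continuousOn hf
  have e0 := e 0
  simp only [sub_zero] at e0
  have em : ContinuousOn (fun u => Real.exp (-κ * (C.f u / n))) (Icc C.lo C.hi) :=
    (show Continuous fun t : ℝ => Real.exp (-κ * (t / n)) by fun_prop).comp_continuousOn hf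
  have i1 : ContinuousOn (fun u => ∫ s in C.lo..u, Real.exp (-κ * (C.f s / n)))
      (Icc C.lo C.hi) := by
    have := intervalIntegral.continuousOn_primitive_interval (μ := volume) (a := C.lo) (b := C.hi)
      (f := fun s => Real.exp (-κ * (C.f s / n)))
      (by rw [uIcc_of_le C.le]; exact em.integrableOn_Icc)
    rwa [uIcc_of_le C.le] at this
  have i2 : ContinuousOn (fun u => ∫ t in C.f u..C.f C.lo,
      h (C.g t + m / n * t, t) * Real.exp (-κ * (t / n))) (Icc C.lo C.hi) := by
    have := intervalIntegral.continuousOn_primitive_interval_left (μ := volume) (a := 0)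
      (b := C.f C.lo) (f := fun t => h (C.g t + m / n * t, t) * Real.exp (-κ * (t / n)))
      (by
        rw [uIcc_of_le C.top_nonneg]
        exact hh.mul_continuousOn (by fun_prop) isCompact_Icc)
    rw [uIcc_of_le C.top_nonneg] at this
    exact this.comp hf fun u hu => C.f_mem hu
  unfold curveValue
  exact (((e _).mul continuousOn_const).add ((e0.mul continuousOn_const).mul i1)).add
    ((e0.div_const n).mul i2)

end DecreasingCurve

namespace CurveStrategy

variable {q : CollabParams} {Ω : Type*} [MeasurableSpace Ω] {P : Measure Ω}
  {ξ : CurveStrategy q} {c : ClaimModel q P} {w : ℝ × ℝ → ℝ}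

/-- The value just after a claim of a given size is continuous in the surplus before the claim, off
the borderline of ruin and the discontinuities of the terminal payoff. -/
theorem continuousWithinAt_settle (hw : ContinuousOn w quadrant) {z₀ : ℝ × ℝ}
    (h0 : ContinuousAt (soloValue c 0) z₀.1) (h1 : ContinuousAt (soloValue c 1) z₀.2) (k : Fin 2)
    {α : ℝ} (hα : α ≠ z₀.1 + z₀.2) :
    ContinuousWithinAt (fun z => (ξ.control c).settle (extend w) (claimPos k z α)) quadrant z₀ := by
  have hsum (z : ℝ × ℝ) : (claimPos k z α).1 + (claimPos k z α).2 = z.1 + z.2 - α := by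
    rw [claimPos, cover_sum]
    split_ifs <;> ring
  have hcont : ContinuousWithinAt (fun z : ℝ × ℝ => z.1 + z.2) quadrant z₀ := by fun_prop
  rcases hα.lt_or_gt with hα | hα
  -- The claim is survived from all nearby surplus levels, and the new surplus depends continuously
  -- on the old one.
  · set pre : ℝ × ℝ → ℝ × ℝ := fun z => if k = 0 then (z.1 - α, z.2) else (z.1, z.2 - α) with hpre
    have hprec : Continuous pre := by
      rw [hpre]; split_ifs <;> fun_prop
    set C : ℝ × ℝ → ℝ × ℝ := fun z => (max 0 (z.1 + min 0 z.2), max 0 (z.2 + min 0 z.1)) with hC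
    have hCm (z : ℝ × ℝ) : C z ∈ quadrant := ⟨le_max_left _ _, le_max_left _ _⟩
    have hlim : ContinuousWithinAt (fun z => ENNReal.ofReal (w (C (pre z)))) quadrant z₀ := by
      refine ENNReal.continuous_ofReal.continuousAt.comp_continuousWithinAt ?_
      refine (hw (C (pre z₀)) (hCm _)).comp (f := fun z => C (pre z)) ?_ fun z _ => hCm _
      exact Continuous.continuousWithinAt (by fun_prop)
    have heq (z : ℝ × ℝ) (hz : α < z.1 + z.2) : (ξ.control c).settle (extend w) (claimPos k z α)
        = ENNReal.ofReal (w (C (pre z))) := by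
      have hs := hsum z
      have hle : 0 ≤ (claimPos k z α).1 + (claimPos k z α).2 := by rw [hs]; linarith
      rw [PeriodControl.settle, if_pos hle, extend_of_mem (claimPos_mem hle)]
      rw [claimPos, cover_sum] at hle
      rw [claimPos, cover_eq hle]
    refine hlim.congr_of_eventuallyEq ?_ (heq z₀ hα)
    filter_upwards [hcont.eventually (eventually_gt_nhds hα)] with z hz
    exact heq z hz
  · have hlim0 : ContinuousWithinAt (fun z : ℝ × ℝ => ENNReal.ofReal (q.a 1)
        * ENNReal.ofReal (soloValue c 1 z.2)) quadrant z₀ := by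
      refine ENNReal.Tendsto.const_mul ?_ (Or.inr ENNReal.ofReal_ne_top)
      refine (ENNReal.continuous_ofReal.tendsto _).comp ?_
      exact (h1.tendsto.comp continuous_snd.continuousAt).mono_left nhdsWithin_le_nhds
    have hlim1 : ContinuousWithinAt (fun z : ℝ × ℝ => ENNReal.ofReal (q.a 0)
        * ENNReal.ofReal (soloValue c 0 z.1)) quadrant z₀ := by
      refine ENNReal.Tendsto.const_mul ?_ (Or.inr ENNReal.ofReal_ne_top)
      refine (ENNReal.continuous_ofReal.tendsto _).comp ?_
      exact (h0.tendsto.comp continuous_fst.continuousAt).mono_left nhdsWithin_le_nhds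
    have hneg (z : ℝ × ℝ) (hz : z.1 + z.2 < α) :
        ¬ 0 ≤ (claimPos k z α).1 + (claimPos k z α).2 := by rw [hsum]; linarith
    have hev : ∀ᶠ z in 𝓝[quadrant] z₀, z ∈ quadrant ∧ z.1 + z.2 < α :=
      (eventually_mem_nhdsWithin).and (hcont.eventually (eventually_lt_nhds hα))
    by_cases hz₀ : z₀ ∈ quadrant
    swap
    -- Off the closed quadrant the statement is vacuous.
    · refine continuousWithinAt_of_notMem_closure ?_
      have hcl : IsClosed quadrant :=
        (isClosed_le continuous_const continuous_fst).inter
          (isClosed_le continuous_const continuous_snd)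
      rwa [hcl.closure_eq]
    have hk : k = 0 ∨ k = 1 := by fin_cases k <;> simp
    rcases hk with rfl | rfl
    · have heq (z : ℝ × ℝ) (hz : z ∈ quadrant ∧ z.1 + z.2 < α) :
          (ξ.control c).settle (extend w) (claimPos 0 z α)
          = ENNReal.ofReal (q.a 1) * ENNReal.ofReal (soloValue c 1 z.2) := by
        rw [PeriodControl.settle, if_neg (hneg z hz.2), claimPos, if_pos rfl, cover,
          if_pos (by dsimp only; linarith [hz.2])]
        simp [control, soloValue_of_neg c 0 (show z.1 - α < 0 by linarith [hz.1.2, hz.2])]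
      exact hlim0.congr_of_eventuallyEq (hev.mono heq) (heq z₀ ⟨hz₀, hα⟩)
    · have heq (z : ℝ × ℝ) (hz : z ∈ quadrant ∧ z.1 + z.2 < α) :
          (ξ.control c).settle (extend w) (claimPos 1 z α)
          = ENNReal.ofReal (q.a 0) * ENNReal.ofReal (soloValue c 0 z.1) := by
        rw [PeriodControl.settle, if_neg (hneg z hz.2), claimPos, if_neg one_ne_zero, cover,
          if_pos (by dsimp only; linarith [hz.2])]
        simp [control, soloValue_of_neg c 1 (show z.2 - α < 0 by linarith [hz.1.1, hz.2])]
      exact hlim1.congr_of_eventuallyEq (hev.mono heq) (heq z₀ ⟨hz₀, hα⟩)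

theorem exists_opH_le (ξ : CurveStrategy q) (c : ClaimModel q P) (hw : w ∈ classM q) (B : ℝ) :
    ∃ C, 0 ≤ C ∧ ∀ z ∈ quadrant, z.1 ≤ B → z.2 ≤ B → opH c w z ≤ C := by
  obtain ⟨K, hK0, hK⟩ := exists_extend_le hw
  obtain ⟨C, hC0, hC⟩ := exists_opHE_le ξ c B
  have hb : 0 ≤ C + q.lamTot * K := add_nonneg hC0 (mul_nonneg (PeriodControl.lamTot_pos q).le hK0)
  refine ⟨_, hb, fun z hz h1 h2 => ?_⟩
  have := hC K hK0 _ hK z h1 h2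
  rwa [opHE_extend hw.1 hw.2.1 hz, ENNReal.ofReal_le_ofReal_iff hb] at this

theorem opH_eq_toReal (ξ : CurveStrategy q) (c : ClaimModel q P) (hw : w ∈ classM q) :
    EqOn (opH c w) (fun z => ((ξ.control c).opHE q (extend w) z).toReal) quadrant := by
  intro z hz
  dsimp only
  rw [opHE_extend hw.1 hw.2.1 hz, ENNReal.toReal_ofReal (opH_nonneg hw.1 hz)]

/-- Dominated convergence in the claim size. The only bad size is the total surplus, at the edge of
ruin, and it is negligible because the claim laws have no atoms. -/
theorem continuousWithinAt_opH (ξ : CurveStrategy q) (c : ClaimModel q P) (hw : w ∈ classM q)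
    {z₀ : ℝ × ℝ} (hz : z₀ ∈ quadrant) (h0 : ContinuousAt (soloValue c 0) z₀.1)
    (h1 : ContinuousAt (soloValue c 1) z₀.2) : ContinuousWithinAt (opH c w) quadrant z₀ := by
  have := q.F_prob
  have := q.F_noAtoms
  obtain ⟨K, hK0, hK⟩ := exists_extend_le hw
  obtain ⟨C, hC0, hC⟩ := exists_settle_le ξ c (max (z₀.1 + 1) (z₀.2 + 1))
  have hE : ContinuousWithinAt ((ξ.control c).opHE q (extend w)) quadrant z₀ := by
    refine tendsto_finsetSum _ fun k _ => ENNReal.Tendsto.const_mul ?_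
      (Or.inr ENNReal.ofReal_ne_top)
    refine tendsto_lintegral_filter_of_dominated_convergence
      (fun _ => ENNReal.ofReal (C + K)) ?_ ?_ ?_ ?_
    · exact Eventually.of_forall fun z =>
        (PeriodControl.measurable_settle' (measurable_extend hw.2.1)).comp
          ((measurable_claimPos k).comp (measurable_const.prodMk measurable_id))
    · have e1 : ∀ᶠ z : ℝ × ℝ in 𝓝[quadrant] z₀, z.1 < z₀.1 + 1 :=
        (continuous_fst.continuousWithinAt (x := z₀)).eventually (eventually_lt_nhds (by simp))
      have e2 : ∀ᶠ z : ℝ × ℝ in 𝓝[quadrant] z₀, z.2 < z₀.2 + 1 :=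
        (continuous_snd.continuousWithinAt (x := z₀)).eventually (eventually_lt_nhds (by simp))
      filter_upwards [e1, e2] with z hz1 hz2
      exact hC K hK0 _ hK z (hz1.le.trans (le_max_left _ _)) (hz2.le.trans (le_max_right _ _)) k
    · rw [lintegral_const, measure_univ, mul_one]
      exact ENNReal.ofReal_ne_top
    · have : ∀ᵐ α ∂(q.F k), α ≠ z₀.1 + z₀.2 := by
        rw [ae_iff]
        simp
      filter_upwards [this] with α hα
      exact continuousWithinAt_settle hw.2.1 h0 h1 k hα
  have hne : (ξ.control c).opHE q (extend w) z₀ ≠ ∞ := by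
    rw [opHE_extend hw.1 hw.2.1 hz]; exact ENNReal.ofReal_ne_top
  refine ContinuousWithinAt.congr (f := fun z => ((ξ.control c).opHE q (extend w) z).toReal) ?_
    (fun z hz => opH_eq_toReal ξ c hw hz) (opH_eq_toReal ξ c hw hz)
  exact (ENNReal.tendsto_toReal hne).comp hE

theorem measurable_indicator_opH (ξ : CurveStrategy q) (c : ClaimModel q P) (hw : w ∈ classM q) :
    Measurable (quadrant.indicator (opH c w)) := by
  rw [indicator_congr fun z hz => opH_eq_toReal ξ c hw hz]
  exact (PeriodControl.measurable_opHE (measurable_extend hw.2.1)).ennreal_toReal.indicator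
    measurableSet_quadrant

/-- The reward on the lines before the curve is reached is continuous. -/
theorem continuousOn_line (ξ : CurveStrategy q) (c : ClaimModel q P) (hw : w ∈ classM q)
    {A : Set (ℝ × ℝ)} (hA : A ⊆ quadrant) {θ : ℝ × ℝ → ℝ} (hθ : ContinuousOn θ A)
    (hθ0 : ∀ z ∈ A, 0 ≤ θ z) :
    ContinuousOn (fun z => ∫ s in 0..θ z, Real.exp (-(q.δ + q.lamTot) * s)
      * opH c w (z.1 + q.p 0 * s, z.2 + q.p 1 * s)) A := by
  have p0 := q.p_pos 0
  have p1 := q.p_pos 1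
  have hκ := q.kappa_pos
  have hq (z : ℝ × ℝ) (hz : z ∈ A) (s : ℝ) (hs : 0 ≤ s) :
      (z.1 + q.p 0 * s, z.2 + q.p 1 * s) ∈ quadrant :=
    ⟨add_nonneg (hA hz).1 (mul_nonneg p0.le hs), add_nonneg (hA hz).2 (mul_nonneg p1.le hs)⟩
  -- The moving upper limit becomes an indicator, so that dominated convergence can be used on a
  -- fixed half-line.
  set G : ℝ × ℝ → ℝ → ℝ := fun z s => (Iio (θ z)).indicator (fun s =>
    Real.exp (-(q.δ + q.lamTot) * s)
      * quadrant.indicator (opH c w) (z.1 + q.p 0 * s, z.2 + q.p 1 * s)) s with hG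
  have heq : EqOn (fun z => ∫ s in 0..θ z, Real.exp (-(q.δ + q.lamTot) * s)
      * opH c w (z.1 + q.p 0 * s, z.2 + q.p 1 * s)) (fun z => ∫ s in Ioi 0, G z s) A := by
    intro z hz
    simp only [hG]
    rw [setIntegral_indicator measurableSet_Iio, Ioi_inter_Iio, ← integral_Ioc_eq_integral_Ioo,
      intervalIntegral.integral_of_le (hθ0 z hz)]
    refine setIntegral_congr_fun measurableSet_Ioc fun s hs => ?_
    simp only [indicator_of_mem (hq z hz s hs.1.le)]
  refine ContinuousOn.congr (fun z₀ hz₀ => ?_) heq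
  have hT : 0 ≤ θ z₀ + 1 := by linarith [hθ0 z₀ hz₀]
  obtain ⟨C, hC0, hC⟩ := exists_opH_le ξ c hw
    (max (z₀.1 + 1 + q.p 0 * (θ z₀ + 1)) (z₀.2 + 1 + q.p 1 * (θ z₀ + 1)))
  refine continuousWithinAt_of_dominated (bound := fun s => Real.exp (-(q.δ + q.lamTot) * s) * C)
    ?_ ?_ ?_ ?_
  · refine Eventually.of_forall fun z => Measurable.aestronglyMeasurable ?_
    refine Measurable.indicator (Measurable.mul (by fun_prop) ?_) measurableSet_Iio
    exact (measurable_indicator_opH ξ c hw).comp (by fun_prop)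
  · have e1 : ∀ᶠ z : ℝ × ℝ in 𝓝[A] z₀, z.1 < z₀.1 + 1 :=
      (continuous_fst.continuousWithinAt (x := z₀)).eventually (eventually_lt_nhds (by simp))
    have e2 : ∀ᶠ z : ℝ × ℝ in 𝓝[A] z₀, z.2 < z₀.2 + 1 :=
      (continuous_snd.continuousWithinAt (x := z₀)).eventually (eventually_lt_nhds (by simp))
    have e3 : ∀ᶠ z : ℝ × ℝ in 𝓝[A] z₀, θ z < θ z₀ + 1 :=
      (hθ z₀ hz₀).eventually (eventually_lt_nhds (by simp))
    filter_upwards [e1, e2, e3, eventually_mem_nhdsWithin] with z h1 h2 h3 hz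
    filter_upwards [ae_restrict_mem measurableSet_Ioi] with s hs
    have hs0 : 0 ≤ s := le_of_lt hs
    simp only [hG]
    by_cases hsθ : s ∈ Iio (θ z)
    · rw [indicator_of_mem hsθ, indicator_of_mem (hq z hz s hs0), Real.norm_eq_abs,
        abs_of_nonneg (mul_nonneg (Real.exp_pos _).le (opH_nonneg hw.1 (hq z hz s hs0)))]
      refine mul_le_mul_of_nonneg_left (hC _ (hq z hz s hs0) ?_ ?_) (Real.exp_pos _).le
      · refine le_max_of_le_left ?_
        have : q.p 0 * s ≤ q.p 0 * (θ z₀ + 1) :=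
          mul_le_mul_of_nonneg_left (le_of_lt (lt_trans hsθ h3)) p0.le
        dsimp only
        linarith
      · refine le_max_of_le_right ?_
        have : q.p 1 * s ≤ q.p 1 * (θ z₀ + 1) :=
          mul_le_mul_of_nonneg_left (le_of_lt (lt_trans hsθ h3)) p1.le
        dsimp only
        linarith
    · rw [indicator_of_notMem hsθ, norm_zero]
      exact mul_nonneg (Real.exp_pos _).le hC0
  · exact (integrableOn_exp_mul_Ioi (by linarith) 0).mul_const C
  -- Both coordinates increase strictly along the line, so each of the countably many
  -- discontinuities of the stand-alone values is met at most once. These times and `θ z₀` form a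
  -- null set.
  · have d0 := (monotone_soloValue c 0).countable_not_continuousAt.preimage
      (f := fun s => z₀.1 + q.p 0 * s) fun s t h => mul_left_cancel₀ p0.ne' (add_left_cancel h)
    have d1 := (monotone_soloValue c 1).countable_not_continuousAt.preimage
      (f := fun s => z₀.2 + q.p 1 * s) fun s t h => mul_left_cancel₀ p1.ne' (add_left_cancel h)
    filter_upwards [ae_restrict_mem measurableSet_Ioi, ae_restrict_of_ae (d0.ae_notMem volume),
      ae_restrict_of_ae (d1.ae_notMem volume),
      ae_restrict_of_ae ((countable_singleton (θ z₀)).ae_notMem volume)] with s hs hd0 hd1 hne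
    have hs0 : 0 ≤ s := le_of_lt hs
    have c0 : ContinuousAt (soloValue c 0) (z₀.1 + q.p 0 * s) := by simpa using hd0
    have c1 : ContinuousAt (soloValue c 1) (z₀.2 + q.p 1 * s) := by simpa using hd1
    rcases lt_or_gt_of_ne (show s ≠ θ z₀ from hne) with hlt | hgt
    · have hcw : ContinuousWithinAt (fun z : ℝ × ℝ => Real.exp (-(q.δ + q.lamTot) * s)
          * opH c w (z.1 + q.p 0 * s, z.2 + q.p 1 * s)) A z₀ := by
        refine ContinuousWithinAt.mul continuousWithinAt_const ?_
        refine (continuousWithinAt_opH ξ c hw (hq z₀ hz₀ s hs0) c0 c1).comp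
          (f := fun z : ℝ × ℝ => (z.1 + q.p 0 * s, z.2 + q.p 1 * s)) ?_ fun z hz => hq z hz s hs0
        exact Continuous.continuousWithinAt (by fun_prop)
      have hval (z : ℝ × ℝ) (hz : z ∈ A) (h : s < θ z) : G z s
          = Real.exp (-(q.δ + q.lamTot) * s) * opH c w (z.1 + q.p 0 * s, z.2 + q.p 1 * s) := by
        simp only [hG]
        rw [indicator_of_mem (show s ∈ Iio (θ z) from h), indicator_of_mem (hq z hz s hs0)]
      refine hcw.congr_of_eventuallyEq ?_ (hval z₀ hz₀ hlt)
      filter_upwards [(hθ z₀ hz₀).eventually (eventually_gt_nhds hlt), eventually_mem_nhdsWithin]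
        with z h hz
      exact hval z hz h
    · have hval (z : ℝ × ℝ) (h : θ z < s) : G z s = 0 := by
        simp only [hG]
        rw [indicator_of_notMem (show s ∉ Iio (θ z) from not_lt.2 h.le)]
      refine (continuousWithinAt_const (b := (0 : ℝ))).congr_of_eventuallyEq ?_ (hval z₀ hgt)
      filter_upwards [(hθ z₀ hz₀).eventually (eventually_lt_nhds hgt)] with z h
      exact hval z h

/-- Boundedness and measurability suffice here; unlike on lines, nothing is claimed about continuity
of `opH` along the curve. -/
theorem integrableOn_opH_curve (ξ : CurveStrategy q) (c : ClaimModel q P) (hw : w ∈ classM q)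
    {γ : ℝ → ℝ × ℝ} {T : ℝ} (hγ : ContinuousOn γ (Icc 0 T)) (hγm : Measurable γ)
    (hq : ∀ t ∈ Icc 0 T, γ t ∈ quadrant) : IntegrableOn (fun t => opH c w (γ t)) (Icc 0 T) := by
  obtain ⟨B, hB⟩ := isCompact_Icc.exists_bound_of_continuousOn hγ
  obtain ⟨C, hC0, hC⟩ := exists_opH_le ξ c hw B
  have hm : Measurable fun t => quadrant.indicator (opH c w) (γ t) :=
    (measurable_indicator_opH ξ c hw).comp hγm
  have hi : IntegrableOn (fun t => quadrant.indicator (opH c w) (γ t)) (Icc 0 T) := by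
    refine Measure.integrableOn_of_bounded (M := C) (by simp) hm.aestronglyMeasurable ?_
    filter_upwards [ae_restrict_mem measurableSet_Icc] with t ht
    have h1 := hB t ht
    rw [indicator_of_mem (hq t ht), Real.norm_eq_abs, abs_of_nonneg (opH_nonneg hw.1 (hq t ht))]
    exact hC _ (hq t ht) ((le_abs_self _).trans ((norm_fst_le _).trans h1))
      ((le_abs_self _).trans ((norm_snd_le _).trans h1))
  refine hi.congr_fun (fun t ht => ?_) measurableSet_Icc
  exact indicator_of_mem (hq t ht) _

end CurveStrategy

/-! ### Invariance of the class M under the operator -/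

namespace CurveStrategy

variable {q : CollabParams} {Ω : Type*} [MeasurableSpace Ω] {P : Measure Ω}
  {ξ : CurveStrategy q} {c : ClaimModel q P} {w : ℝ × ℝ → ℝ}

theorem continuousOn_k₁ (hw : w ∈ classM q) :
    ContinuousOn (ξ.k₁ c w) (Icc ξ.ubar ξ.M₁) := by
  have hsub : Icc 0 (ξ.side₁.f ξ.side₁.lo) ⊆ Icc 0 ξ.ybar := by
    simp only [side₁_f, side₁_lo, ξ.ξ₁_ubar]; exact Subset.rfl
  -- `k₁` unfolds definitionally to a `curveValue`.
  refine ξ.side₁.continuousOn_curveValue (m := q.p 0) (n := q.p 1) (q.δ + q.lamTot) (q.a 0)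
    (q.pTot / (q.δ + q.lamTot) + 1 / (q.δ + q.lamTot)
      * opH c w (ξ.ubar + q.p 0 / q.p 1 * ξ.ξ₁ ξ.ubar, ξ.ξ₁ ξ.ubar)) (h := opH c w) ?_
  have hg := ξ.side₁.continuousOn_g
  have hm := ξ.side₁.measurable_g
  exact integrableOn_opH_curve ξ c hw (by fun_prop) (by fun_prop)
    fun t ht => (ξ.inner₁_subset (ξ.curve_mem_inner₁ (hsub ht))).1

theorem continuousOn_k₂ (hw : w ∈ classM q) :
    ContinuousOn (ξ.k₂ c w) (Icc ξ.vbar ξ.M₂) := by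
  have hsub : Icc 0 (ξ.side₂.f ξ.side₂.lo) ⊆ Icc 0 ξ.xbar := by
    simp only [side₂_f, side₂_lo, ξ.ξ₂_vbar]; exact Subset.rfl
  refine ξ.side₂.continuousOn_curveValue (m := q.p 1) (n := q.p 0) (q.δ + q.lamTot) (q.a 1)
    (q.pTot / (q.δ + q.lamTot) + 1 / (q.δ + q.lamTot)
      * opH c w (ξ.ξ₂ ξ.vbar, ξ.vbar + q.p 1 / q.p 0 * ξ.ξ₂ ξ.vbar))
    (h := fun z => opH c w z.swap) ?_
  have hg := ξ.side₂.continuousOn_g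
  have hm := ξ.side₂.measurable_g
  exact integrableOn_opH_curve ξ c hw
    (γ := fun t => (t, ξ.side₂.g t + q.p 1 / q.p 0 * t)) (by fun_prop) (by fun_prop)
    fun t ht => (ξ.inner₂_subset (ξ.curve_mem_inner₂ (hsub ht))).1

theorem isClosed_inner₁ : IsClosed ξ.inner₁ := ξ.side₁.isClosed_inner _ _

theorem isClosed_inner₂ : IsClosed ξ.inner₂ :=
  (ξ.side₂.isClosed_inner _ _).preimage continuous_swap

variable (ξ) in
/-- The closure of the region below the line in which only Company One pays a lump sum. -/
def outer₁ : Set (ℝ × ℝ) :=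
  {z | 0 ≤ z.1 ∧ z.2 ∈ Icc 0 ξ.ybar ∧ ξ.inv₁ z.2 + q.p 0 / q.p 1 * z.2 ≤ z.1}

variable (ξ) in
/-- The closure of the region above the line in which only Company Two pays a lump sum. -/
def outer₂ : Set (ℝ × ℝ) :=
  {z | 0 ≤ z.2 ∧ z.1 ∈ Icc 0 ξ.xbar ∧ ξ.inv₂ z.1 + q.p 1 / q.p 0 * z.1 ≤ z.2}

theorem isClosed_outer₁ : IsClosed ξ.outer₁ := by
  have := ξ.side₁.isClosed_outer (q.p 0) (q.p 1)
  rwa [side₁_f, side₁_lo, ξ.ξ₁_ubar] at this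

theorem isClosed_outer₂ : IsClosed ξ.outer₂ := by
  have := (ξ.side₂.isClosed_outer (q.p 1) (q.p 0)).preimage continuous_swap
  rwa [side₂_f, side₂_lo, ξ.ξ₂_vbar] at this

theorem outer₁_subset : ξ.outer₁ ⊆ ξ.O₁ := fun z hz => by
  have hq : z ∈ quadrant := ⟨hz.1, hz.2.1.1⟩
  exact ⟨hq, by linarith [ξ.ubar_le_inv₁ hq hz.2.1.2, hz.2.2]⟩

theorem outer₂_subset : ξ.outer₂ ⊆ ξ.O₂ := fun z hz => by
  have hq : z ∈ quadrant := ⟨hz.2.1.1, hz.1⟩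
  exact ⟨hq, by linarith [ξ.vbar_le_inv₂ hq hz.2.1.2, hz.2.2]⟩

variable (ξ) in
-- A finite closed cover, so continuity on each piece gives continuity on the quadrant.
theorem quadrant_eq :
    quadrant = (ξ.inner₁ ∪ ξ.inner₂) ∪ (ξ.outer₁ ∪ ξ.outer₂) ∪ Ici ξ.xbar ×ˢ Ici ξ.ybar := by
  ext z
  constructor
  · intro hz
    rcases ξ.mem_O₁_or_O₂ hz with hO | hO
    · rcases ξ.O₁_cases hO with h | h | h
      · exact Or.inl (Or.inl (Or.inl h))
      · exact Or.inl (Or.inr (Or.inl ⟨hz.1, ⟨hz.2, h.1⟩, h.2⟩))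
      · exact Or.inr h
    · rcases ξ.O₂_cases hO with h | h | h
      · exact Or.inl (Or.inl (Or.inr h))
      · exact Or.inl (Or.inr (Or.inr ⟨hz.2, ⟨hz.1, h.1⟩, h.2⟩))
      · exact Or.inr h
  · rintro (((h | h) | (h | h)) | h)
    · exact (ξ.inner₁_subset h).1
    · exact (ξ.inner₂_subset h).1
    · exact (outer₁_subset h).1
    · exact (outer₂_subset h).1
    · exact ⟨ξ.xbar_nonneg.trans h.1, ξ.ybar_nonneg.trans h.2⟩

theorem continuousOn_opReal_inner₁ (hw : w ∈ classM q) :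
    ContinuousOn (opReal ξ c w) ξ.inner₁ := by
  have hu : ContinuousOn (fun z : ℝ × ℝ => z.1 - q.p 0 / q.p 1 * z.2) ξ.inner₁ := by fun_prop
  have hθ : ContinuousOn (fun z : ℝ × ℝ => (ξ.ξ₁ (z.1 - q.p 0 / q.p 1 * z.2) - z.2) / q.p 1)
      ξ.inner₁ :=
    ((ξ.side₁.continuousOn_f.comp hu fun z hz => hz.2.2.1).sub continuousOn_snd).div_const _
  have hk : ContinuousOn (fun z : ℝ × ℝ => ξ.k₁ c w (z.1 - q.p 0 / q.p 1 * z.2)) ξ.inner₁ :=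
    (continuousOn_k₁ hw).comp hu fun z hz => hz.2.2.1
  have hline := continuousOn_line ξ c hw (fun z hz => (ξ.inner₁_subset hz).1) hθ
    fun z hz => div_nonneg (sub_nonneg.2 hz.2.2.2) (q.p_pos 1).le
  refine (((Real.continuous_exp.comp_continuousOn ((continuousOn_const (c := -(q.δ + q.lamTot))).mul hθ)).mul hk).add
    hline).congr fun z hz => ?_
  have hO := ξ.inner₁_subset hz
  obtain ⟨hy, hx⟩ := (ξ.mem_inner₁_iff hO).1 hz
  exact (formulas_opReal ξ c hw).below_inner z hO hy hx

theorem continuousOn_opReal_inner₂ (hw : w ∈ classM q) :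
    ContinuousOn (opReal ξ c w) ξ.inner₂ := by
  have hu : ContinuousOn (fun z : ℝ × ℝ => z.2 - q.p 1 / q.p 0 * z.1) ξ.inner₂ := by fun_prop
  have hθ : ContinuousOn (fun z : ℝ × ℝ => (ξ.ξ₂ (z.2 - q.p 1 / q.p 0 * z.1) - z.1) / q.p 0)
      ξ.inner₂ :=
    ((ξ.side₂.continuousOn_f.comp hu fun z hz => hz.2.2.1).sub continuousOn_fst).div_const _
  have hk : ContinuousOn (fun z : ℝ × ℝ => ξ.k₂ c w (z.2 - q.p 1 / q.p 0 * z.1)) ξ.inner₂ :=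
    (continuousOn_k₂ hw).comp hu fun z hz => hz.2.2.1
  have hline := continuousOn_line ξ c hw (fun z hz => (ξ.inner₂_subset hz).1) hθ
    fun z hz => div_nonneg (sub_nonneg.2 hz.2.2.2) (q.p_pos 0).le
  refine (((Real.continuous_exp.comp_continuousOn ((continuousOn_const (c := -(q.δ + q.lamTot))).mul hθ)).mul hk).add
    hline).congr fun z hz => ?_
  have hO := ξ.inner₂_subset hz
  obtain ⟨hx, hy⟩ := (ξ.mem_inner₂_iff hO).1 hz
  exact (formulas_opReal ξ c hw).above_inner z hO hx hy

theorem continuousOn_opReal_outer₁ (hw : w ∈ classM q) :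
    ContinuousOn (opReal ξ c w) ξ.outer₁ := by
  have hm : ∀ z ∈ ξ.outer₁, z.2 ∈ Icc 0 (ξ.side₁.f ξ.side₁.lo) := fun z hz => by
    rw [side₁_f, side₁_lo, ξ.ξ₁_ubar]; exact hz.2.1
  have hg : ContinuousOn (fun z : ℝ × ℝ => ξ.inv₁ z.2) ξ.outer₁ :=
    ξ.side₁.continuousOn_g.comp continuousOn_snd hm
  have hk : ContinuousOn (fun z : ℝ × ℝ => ξ.k₁ c w (ξ.inv₁ z.2)) ξ.outer₁ :=
    (continuousOn_k₁ hw).comp hg fun z hz => ξ.side₁.g_mem (hm z hz)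
  refine ContinuousOn.congr (f := fun z => q.a 0 * (z.1 - ξ.inv₁ z.2 - q.p 0 / q.p 1 * z.2)
    + ξ.k₁ c w (ξ.inv₁ z.2)) (by fun_prop) fun z hz => ?_
  exact (formulas_opReal ξ c hw).below_outer z (outer₁_subset hz) hz.2.1.2 hz.2.2

theorem continuousOn_opReal_outer₂ (hw : w ∈ classM q) :
    ContinuousOn (opReal ξ c w) ξ.outer₂ := by
  have hm : ∀ z ∈ ξ.outer₂, z.1 ∈ Icc 0 (ξ.side₂.f ξ.side₂.lo) := fun z hz => by
    rw [side₂_f, side₂_lo, ξ.ξ₂_vbar]; exact hz.2.1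
  have hg : ContinuousOn (fun z : ℝ × ℝ => ξ.inv₂ z.1) ξ.outer₂ :=
    ξ.side₂.continuousOn_g.comp continuousOn_fst hm
  have hk : ContinuousOn (fun z : ℝ × ℝ => ξ.k₂ c w (ξ.inv₂ z.1)) ξ.outer₂ :=
    (continuousOn_k₂ hw).comp hg fun z hz => ξ.side₂.g_mem (hm z hz)
  refine ContinuousOn.congr (f := fun z => q.a 1 * (z.2 - ξ.inv₂ z.1 - q.p 1 / q.p 0 * z.1)
    + ξ.k₂ c w (ξ.inv₂ z.1)) (by fun_prop) fun z hz => ?_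
  exact (formulas_opReal ξ c hw).above_outer z (outer₂_subset hz) hz.2.1.2 hz.2.2

theorem continuousOn_opReal_corner (hw : w ∈ classM q) :
    ContinuousOn (opReal ξ c w) (Ici ξ.xbar ×ˢ Ici ξ.ybar) := by
  have hc : ∀ z ∈ Ici ξ.xbar ×ˢ Ici ξ.ybar, opReal ξ c w z = q.a 0 * (z.1 - ξ.xbar)
      + q.a 1 * (z.2 - ξ.ybar) + opReal ξ c w (ξ.xbar, ξ.ybar) := by
    intro z hz
    have hq : z ∈ quadrant := ⟨ξ.xbar_nonneg.trans hz.1, ξ.ybar_nonneg.trans hz.2⟩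
    rw [opReal_of_land_inner₁ hw hq (ξ.land_corner hz.1 hz.2) ξ.corner_mem_inner₁,
      opReal_of_land_inner₁ hw ⟨ξ.xbar_nonneg, ξ.ybar_nonneg⟩ (ξ.land_corner le_rfl le_rfl)
        ξ.corner_mem_inner₁, ξ.lump_corner hz.1 hz.2, ξ.lump_corner le_rfl le_rfl]
    simp
  exact ContinuousOn.congr (by fun_prop) hc

/-- Each piece of the closed cover has its own continuous formula, and on overlaps all of them
compute the same function. The growth bound is `exists_opT_le` from above and the lump sum alone
from below. -/
theorem opReal_mem_classM (hw : w ∈ classM q) : opReal ξ c w ∈ classM q := by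
  refine ⟨fun z _ => ENNReal.toReal_nonneg, ?_, ?_⟩
  · rw [quadrant_eq ξ]
    exact (((continuousOn_opReal_inner₁ hw).union_of_isClosed (continuousOn_opReal_inner₂ hw)
      isClosed_inner₁ isClosed_inner₂).union_of_isClosed
      ((continuousOn_opReal_outer₁ hw).union_of_isClosed (continuousOn_opReal_outer₂ hw)
      isClosed_outer₁ isClosed_outer₂) (isClosed_inner₁.union isClosed_inner₂)
      (isClosed_outer₁.union isClosed_outer₂)).union_of_isClosed (continuousOn_opReal_corner hw)
      ((isClosed_inner₁.union isClosed_inner₂).union (isClosed_outer₁.union isClosed_outer₂))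
      (isClosed_Ici.prod isClosed_Ici)
  · obtain ⟨K, hK0, hK⟩ := exists_extend_le hw
    obtain ⟨C, hC0, hC⟩ := exists_opT_le ξ c
    obtain ⟨B, hB⟩ := exists_le_lump ξ
    refine ⟨max ((C + q.lamTot * K) / (q.δ + q.lamTot)) B, fun z hz => ?_⟩
    have hb : 0 ≤ (C + q.lamTot * K) / (q.δ + q.lamTot) := div_nonneg
      (add_nonneg hC0 (mul_nonneg (PeriodControl.lamTot_pos q).le hK0)) q.kappa_pos.le
    have h1 : opReal ξ c w z ≤ q.weight z + (C + q.lamTot * K) / (q.δ + q.lamTot) :=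
      ENNReal.toReal_le_of_le_ofReal (add_nonneg (q.weight_nonneg hz) hb) (hC K hK0 _ hK z hz)
    have h2 : q.weight z ≤ opReal ξ c w z + B := by
      refine (hB z hz).trans (add_le_add_left ?_ _)
      rw [opReal_eq hw hz]
      refine le_add_of_nonneg_right (integral_nonneg fun s => ?_)
      exact mul_nonneg (Real.exp_pos _).le (rewardRate_nonneg hw z s)
    rw [CollabParams.weight] at h1 h2
    rw [abs_le]
    have m1 := le_max_left ((C + q.lamTot * K) / (q.δ + q.lamTot)) B
    have m2 := le_max_right ((C + q.lamTot * K) / (q.δ + q.lamTot)) B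
    constructor <;> linarith

/-! ### The value function -/

theorem exists_expectedPayoff_le (ξ : CurveStrategy q) (c : ClaimModel q P) : ∃ K, 0 ≤ K ∧
    ∀ z ∈ quadrant, ξ.expectedPayoff c z ≤ ENNReal.ofReal (q.weight z + K) := by
  obtain ⟨K, hK0, hK⟩ := exists_iSup_iterate_le ξ c
  exact ⟨K, hK0, fun z hz => (expectedPayoff_eq ξ c hz).trans_le (hK z hz)⟩

theorem expectedPayoff_ne_top {z : ℝ × ℝ} (hz : z ∈ quadrant) : ξ.expectedPayoff c z ≠ ∞ := by
  obtain ⟨K, -, hK⟩ := exists_expectedPayoff_le ξ c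
  exact ((hK z hz).trans_lt ENNReal.ofReal_lt_top).ne

/-- The dynamic programming equation. -/
theorem opT_expectedPayoff {z : ℝ × ℝ} (hz : z ∈ quadrant) :
    (ξ.control c).opT q (ξ.expectedPayoff c) z = ξ.expectedPayoff c z := by
  rw [opT_congr (W' := fun z => ⨆ N, (((ξ.control c).opT q)^[N] 0) z)
    fun z hz => expectedPayoff_eq ξ c hz, iSup_iterate_eq, expectedPayoff_eq ξ c hz]

theorem ofReal_value {z : ℝ × ℝ} (hz : z ∈ quadrant) :
    ENNReal.ofReal (ξ.value c z) = ξ.expectedPayoff c z :=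
  ENNReal.ofReal_toReal (expectedPayoff_ne_top hz)

theorem value_nonneg (z : ℝ × ℝ) : 0 ≤ ξ.value c z := ENNReal.toReal_nonneg

theorem exists_value_bound (ξ : CurveStrategy q) (c : ClaimModel q P) :
    ∃ K, ∀ z ∈ quadrant, |ξ.value c z - q.a 0 * z.1 - q.a 1 * z.2| ≤ K := by
  obtain ⟨K, hK0, hK⟩ := exists_expectedPayoff_le ξ c
  obtain ⟨B, hB⟩ := exists_le_lump ξ
  refine ⟨max K B, fun z hz => ?_⟩
  have h1 : ξ.value c z ≤ q.weight z + K :=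
    ENNReal.toReal_le_of_le_ofReal (add_nonneg (q.weight_nonneg hz) hK0) (hK z hz)
  have h2 : q.weight z ≤ ξ.value c z + B := by
    refine (hB z hz).trans (add_le_add_left ?_ _)
    -- By the dynamic programming equation the value is at least the initial lump sum.
    refine (ENNReal.ofReal_le_ofReal_iff (value_nonneg z)).1 ?_
    rw [ofReal_value hz, ← opT_expectedPayoff hz, ← control_ℓ (c := c) hz]
    exact le_self_add
  rw [CollabParams.weight] at h1 h2
  rw [abs_le]
  have m1 := le_max_left K B
  have m2 := le_max_right K B
  constructor <;> linarith

/-- The operator is a contraction towards the value function. -/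
theorem abs_opReal_sub_value_le (hw : w ∈ classM q) {ε : ℝ}
    (h : ∀ z ∈ quadrant, |w z - ξ.value c z| ≤ ε) {z : ℝ × ℝ} (hz : z ∈ quadrant) :
    |opReal ξ c w z - ξ.value c z| ≤ contractionFactor q * ε := by
  have hε : 0 ≤ ε := (abs_nonneg _).trans (h z hz)
  have hr := contractionFactor_nonneg q
  have hop : ENNReal.ofReal (opReal ξ c w z) = (ξ.control c).opT q (extend w) z :=
    ENNReal.ofReal_toReal (opT_extend_ne_top hw hz)
  have hop0 : 0 ≤ opReal ξ c w z := ENNReal.toReal_nonneg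
  -- The two halves of the estimate are obtained separately in `[0, ∞]`, where the operator is
  -- defined, and then carried over to real numbers.
  have h1 : (ξ.control c).opT q (extend w) z ≤ (ξ.control c).opT q (ξ.expectedPayoff c) z
      + ENNReal.ofReal (contractionFactor q) * ENNReal.ofReal ε := by
    refine opT_add_const (fun z hz => ?_) z
    rw [extend_of_mem hz, ← ofReal_value hz, ← ENNReal.ofReal_add (value_nonneg z) hε]
    exact ENNReal.ofReal_le_ofReal (by linarith [(abs_le.1 (h z hz)).2])
  have h2 : (ξ.control c).opT q (ξ.expectedPayoff c) z ≤ (ξ.control c).opT q (extend w) z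
      + ENNReal.ofReal (contractionFactor q) * ENNReal.ofReal ε := by
    refine opT_add_const (fun z hz => ?_) z
    rw [extend_of_mem hz, ← ofReal_value hz, ← ENNReal.ofReal_add (hw.1 z hz) hε]
    exact ENNReal.ofReal_le_ofReal (by linarith [(abs_le.1 (h z hz)).1])
  rw [opT_expectedPayoff hz, ← hop, ← ofReal_value hz, ← ENNReal.ofReal_mul hr] at h1 h2
  rw [← ENNReal.ofReal_add (value_nonneg z) (mul_nonneg hr hε),
    ENNReal.ofReal_le_ofReal_iff (add_nonneg (value_nonneg z) (mul_nonneg hr hε))] at h1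
  rw [← ENNReal.ofReal_add hop0 (mul_nonneg hr hε),
    ENNReal.ofReal_le_ofReal_iff (add_nonneg hop0 (mul_nonneg hr hε))] at h2
  rw [abs_le]
  constructor <;> linarith

/-- Iterates of the operator converge uniformly to the value function. -/
theorem exists_abs_sub_value_le {f : ℕ → ℝ × ℝ → ℝ} (hf : ∀ n, f n ∈ classM q)
    (hstep : ∀ n, EqOn (f (n + 1)) (opReal ξ c (f n)) quadrant) :
    ∃ K, ∀ n, ∀ z ∈ quadrant, |f n z - ξ.value c z| ≤ contractionFactor q ^ n * K := by
  obtain ⟨K₁, hK₁⟩ := (hf 0).2.2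
  obtain ⟨K₂, hK₂⟩ := exists_value_bound ξ c
  -- The starting function and the value both stay within bounded distance of `a₁ x + a₂ y`, so
  -- their initial distance is finite.
  refine ⟨K₁ + K₂, fun n => ?_⟩
  induction n with
  | zero =>
    intro z hz
    have h1 := abs_le.1 (hK₁ z hz)
    have h2 := abs_le.1 (hK₂ z hz)
    rw [pow_zero, one_mul, abs_le]
    constructor <;> linarith
  | succ n ih =>
    intro z hz
    rw [hstep n hz, pow_succ', mul_assoc]
    exact abs_opReal_sub_value_le (hf n) ih hz

theorem tendsto_contractionFactor_pow_mul (q : CollabParams) (K : ℝ) :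
    Tendsto (fun n : ℕ => contractionFactor q ^ n * K) atTop (𝓝 0) := by
  simpa using (tendsto_pow_atTop_nhds_zero_of_lt_one (contractionFactor_nonneg q)
    (contractionFactor_lt_one q)).mul_const K

theorem weight_mem_classM (q : CollabParams) : q.weight ∈ classM q := by
  refine ⟨fun z hz => q.weight_nonneg hz, ?_, 0, fun z _ => ?_⟩
  · unfold CollabParams.weight; fun_prop
  · simp [CollabParams.weight]

/-- Continuity is inherited as a uniform limit. The iteration starts from the weight and not from
zero, since the zero function is not in the class M. -/
theorem value_mem_classM (ξ : CurveStrategy q) (c : ClaimModel q P) : ξ.value c ∈ classM q := by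
  refine ⟨fun z _ => value_nonneg z, ?_, exists_value_bound ξ c⟩
  set f : ℕ → ℝ × ℝ → ℝ := fun n => (opReal ξ c)^[n] q.weight
  have hs (n : ℕ) : f (n + 1) = opReal ξ c (f n) := Function.iterate_succ_apply' _ _ _
  have hf (n : ℕ) : f n ∈ classM q := by
    induction n with
    | zero => exact weight_mem_classM q
    | succ n ih => rw [hs]; exact opReal_mem_classM ih
  obtain ⟨K, hK⟩ := exists_abs_sub_value_le (ξ := ξ) (c := c) hf fun n => by
    rw [hs]; exact fun _ _ => rfl
  refine TendstoUniformlyOn.continuousOn (F := f) (p := atTop) ?_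
    (Frequently.of_forall fun n => (hf n).2.1)
  rw [Metric.tendstoUniformlyOn_iff]
  intro ε hε
  filter_upwards [(tendsto_contractionFactor_pow_mul q K).eventually (eventually_lt_nhds hε)]
    with n hn z hz
  rw [dist_comm, Real.dist_eq]
  exact (hK n z hz).trans_lt hn

theorem opReal_value {z : ℝ × ℝ} (hz : z ∈ quadrant) :
    opReal ξ c (ξ.value c) z = ξ.value c z := by
  rw [opReal, opT_congr (W' := ξ.expectedPayoff c)
    fun z hz => (extend_of_mem hz).trans (ofReal_value hz), opT_expectedPayoff hz, value]

theorem Formulas.congr {W₀ W W' : ℝ × ℝ → ℝ} (h : ξ.Formulas c W₀ W) (hW : EqOn W W' quadrant) :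
    ξ.Formulas c W₀ W' where
  below_inner z hz := (hW hz.1) ▸ h.below_inner z hz
  below_outer z hz := (hW hz.1) ▸ h.below_outer z hz
  below_corner z hz := (hW hz.1) ▸ h.below_corner z hz
  above_inner z hz := (hW hz.1) ▸ h.above_inner z hz
  above_outer z hz := (hW hz.1) ▸ h.above_outer z hz
  above_corner z hz := (hW hz.1) ▸ h.above_corner z hz

/-- A solution agrees on the quadrant with its image under the operator, because both satisfy the
same formulas. The constant sequence `w` is thus a sequence of iterates, and its distance to the
value is bounded by a null sequence. -/
theorem eq_value_of_formulas (hw : w ∈ classM q) (h : ξ.Formulas c w w) {z : ℝ × ℝ}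
    (hz : z ∈ quadrant) : w z = ξ.value c z := by
  obtain ⟨K, hK⟩ := exists_abs_sub_value_le (ξ := ξ) (c := c) (f := fun _ => w) (fun _ => hw)
    fun _ => h.eqOn (formulas_opReal ξ c hw)
  have := ge_of_tendsto' (tendsto_contractionFactor_pow_mul q K) fun n => hK n z hz
  exact sub_eq_zero.1 (abs_nonpos_iff.1 this)

end CurveStrategy

end

theorem mainTheorem8 {Ω : Type*} [MeasurableSpace Ω] (P : Measure Ω) [IsProbabilityMeasure P]
    (q : CollabParams) (c : ClaimModel q P) (ξ : CurveStrategy q) :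
    (∀ z ∈ CurveStrategy.quadrant, ξ.expectedPayoff c z ≠ ∞) ∧
    ξ.value c ∈ CurveStrategy.classM q ∧
    ξ.Formulas c (ξ.value c) (ξ.value c) ∧
    ∀ w ∈ CurveStrategy.classM q, ξ.Formulas c w w →
      ∀ z ∈ CurveStrategy.quadrant, w z = ξ.value c z :=
  ⟨fun _ hz => CurveStrategy.expectedPayoff_ne_top hz, CurveStrategy.value_mem_classM ξ c,
    (CurveStrategy.formulas_opReal ξ c (CurveStrategy.value_mem_classM ξ c)).congr
      fun _ hz => CurveStrategy.opReal_value hz,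
    fun _ hw h _ hz => CurveStrategy.eq_value_of_formulas hw h hz⟩
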